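/- Let $V\in C^\infty(\mathbb R)$ be even with $V'(u)=u\pm u^3+\mathcal O(u^5)$ as $u\to0$ (either sign). For an energy $E$ let $a(E)$ be the smallest positive root of $V(a)=E$, and let $$T(E)=\sqrt2\int_{-a(E)}^{a(E)}\frac{dx}{\sqrt{E-V(x)}} .$$ Fix $E>V(0)$ for which $a=a(E)$ exists and $T=T(E)$ is finite, and assume $T'(E)\neq0$ and $T\neq2\pi n$ for all $n\in\mathbb N$. Let $H^2_{\rm per}(0,T)$ be the space of real $T$-periodic functions $f(t)=\sum_{m\in\mathbb Z}c_me^{2\pi imt/T}$ with norm $\big(\sum_m(1+m^2)^2|c_m|^2\big)^{1/2}<\infty$, let $H^2_e(0,T)$ be its subspace of even functions, and let $\varphi\in H^2_e(0,T)$ be the solution of $\ddot\varphi+V'(\varphi)=0$ with $\varphi(0)=a$, $\dot\varphi(0)=0$. Set $$L_0=\partial_t^2+1,\qquad L_e=\partial_t^2+V''(\varphi(t)).$$ Consider the discrete Klein--Gordon equation $$\ddot u_n+V'(u_n)=\epsilon(u_{n+1}-2u_n+u_{n-1}),\qquad n\in\mathbb Z, \tag{1}$$ for ${\bf u}=(u_n)_{n\in\mathbb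 Z}\in X:=l^2(\mathbb Z,H^2_e(0,T))$. Let ${\bf e}_n$ be the unit vectors in $l^2(\mathbb Z)$ and $(\tau_j{\bf u})_n=u_{n-j}$. Let $j\neq k$ be integers, $N=|j-k|\ge1$, and $\sigma_j,\sigma_k\in\{+1,-1\}$. Then the following holds. 1. For each of ${\bf u}^{(0)}=\varphi\,{\bf e}_0$ and ${\bf u}^{(0)}=\sigma_j\varphi\,{\bf e}_j+\sigma_k\varphi\,{\bf e}_k$ there are $\epsilon_0>0$ and $C>0$ such that for every $\epsilon$ with $|\epsilon|<\epsilon_0$ equation (1) has exactly one solution ${\bf u}\in X$ with $\|{\bf u}-{\bf u}^{(0)}\|_X\le C|\epsilon|$. For every $f\in H_e^2(0,T)$ each of the equations $L_0w=f$ and $L_ew=f$ has exactly one solution $w\in H^2_e(0,T)$. 2. Let $\boldsymbol\phi^{(\epsilon)}$ (the fundamental breather) and ${\bf u}^{(\epsilon)}$ be families of solutions of (1) in $X$, for small $|\epsilon|$, with $\|\boldsymbol\phi^{(\epsilon)}-\varphi\,{\bf e}_0\|_X\le C|\epsilon|$ and $\|{\bf u}^{(\epsilon)}-\sigma_j\varphi\,{\bf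 e}_j-\sigma_k\varphi\,{\bf e}_k\|_X\le C|\epsilon|$ for some constant $C>0$. Let $\varphi_0=\varphi$, let $\varphi_1,\dots,\varphi_N\in H_e^2(0,T)$ solve $L_0\varphi_m=\varphi_{m-1}$ for $1\le m\le N$, and let $\psi_N\in H^2_e(0,T)$ solve $L_e\psi_N=\varphi_{N-1}$. Then $\epsilon\mapsto\boldsymbol\phi^{(\epsilon)}\in X$ is $C^\infty$ near $\epsilon=0$ and, with its Taylor polynomial $$\boldsymbol\phi^{(\epsilon,N)}=\sum_{i=0}^N\frac{\epsilon^i}{i!}\frac{d^i}{d\epsilon^i}\boldsymbol\phi^{(\epsilon)}\Big|_{\epsilon=0},$$ one has, as $\epsilon\to0$, $${\bf u}^{(\epsilon)}=\sigma_j\tau_j\boldsymbol\phi^{(\epsilon,N)}+\sigma_k\tau_k\boldsymbol\phi^{(\epsilon,N)}+\epsilon^N(\sigma_j{\bf e}_k+\sigma_k{\bf e}_j)(\psi_N-\varphi_N)+\mathcal O_X(\epsilon^{N+1}).$$ -/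

import Mathlib

open Filter Topology Asymptotics MeasureTheory
open scoped ContDiff

/-! ### The periodic Sobolev space `H²_per(0,T)` -/

/-- The coefficients `(1 + m²) c_m`, where `c_m` are the Fourier coefficients of the real
`T`-periodic continuous function `f`, that is `f(t) = ∑ c_m exp(2 π i m t / T)`. -/
noncomputable def weightedFourierCoeff {T : ℝ} [Fact (0 < T)] (f : C(AddCircle T, ℝ)) (m : ℤ) : ℂ :=
  (1 + (m : ℂ) ^ 2) * fourierCoeff (fun t => ((f t : ℝ) : ℂ)) m

theorem integrable_fourier_ofReal {T : ℝ} [Fact (0 < T)] (f : C(AddCircle T, ℝ)) (m : ℤ) :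
    Integrable (fun t : AddCircle T => fourier (-m) t • ((f t : ℝ) : ℂ)) AddCircle.haarAddCircle := by
  have hc : Continuous (fun t : AddCircle T => fourier (-m) t • ((f t : ℝ) : ℂ)) := by fun_prop
  exact hc.integrable_of_hasCompactSupport (HasCompactSupport.of_compactSpace _)

theorem weightedFourierCoeff_add {T : ℝ} [Fact (0 < T)] (f g : C(AddCircle T, ℝ)) :
    weightedFourierCoeff (f + g) = weightedFourierCoeff f + weightedFourierCoeff g := by
  funext m
  have h := integral_add (integrable_fourier_ofReal f m) (integrable_fourier_ofReal g m)
  simp only [weightedFourierCoeff, fourierCoeff, Pi.add_apply, ContinuousMap.add_apply,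
    Complex.ofReal_add, smul_add]
  rw [h, mul_add]

theorem weightedFourierCoeff_smul {T : ℝ} [Fact (0 < T)] (c : ℝ) (f : C(AddCircle T, ℝ)) :
    weightedFourierCoeff (c • f) = c • weightedFourierCoeff f := by
  funext m
  have h := integral_const_mul (μ := AddCircle.haarAddCircle) (c : ℂ)
    (fun t : AddCircle T => fourier (-m) t • ((f t : ℝ) : ℂ))
  simp only [weightedFourierCoeff, fourierCoeff, Pi.smul_apply, ContinuousMap.smul_apply,
    smul_eq_mul, Complex.ofReal_mul, Complex.real_smul]
  simp only [smul_eq_mul] at h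
  rw [show (fun t : AddCircle T => fourier (-m) t * ((c : ℂ) * ((f t : ℝ) : ℂ))) =
    fun t => (c : ℂ) * (fourier (-m) t * ((f t : ℝ) : ℂ)) from by funext t; ring, h]
  ring

/-- The subspace of those continuous real `T`-periodic functions for which
`∑ (1 + m²)² |c_m|² < ∞`. Every class in `H²_per(0,T)` has exactly one continuous
representative, so this is `H²_per(0,T)`. -/
noncomputable def sobolevSubmodule (T : ℝ) [Fact (0 < T)] : Submodule ℝ C(AddCircle T, ℝ) where
  carrier := {f | Memℓp (weightedFourierCoeff f) 2}
  add_mem' := by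
    intro f g hf hg
    have h : Memℓp (weightedFourierCoeff f + weightedFourierCoeff g) 2 := Memℓp.add hf hg
    rw [← weightedFourierCoeff_add] at h
    exact h
  zero_mem' := by
    have h : weightedFourierCoeff (0 : C(AddCircle T, ℝ)) = 0 := by
      simpa using weightedFourierCoeff_smul (0 : ℝ) (0 : C(AddCircle T, ℝ))
    rw [Set.mem_ofPred_eq, h]
    exact zero_memℓp
  smul_mem' := by
    intro c f hf
    have h : Memℓp (c • weightedFourierCoeff f) 2 := Memℓp.const_smul hf c
    rw [← weightedFourierCoeff_smul] at h
    exact h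

/-- The space `H²_per(0,T)` of real functions (it gets its own norm below, not the sup norm). -/
def H2per (T : ℝ) [Fact (0 < T)] : Type := ↥(sobolevSubmodule T)

noncomputable instance (T : ℝ) [Fact (0 < T)] : AddCommGroup (H2per T) :=
  inferInstanceAs (AddCommGroup ↥(sobolevSubmodule T))

noncomputable instance (T : ℝ) [Fact (0 < T)] : Module ℝ (H2per T) :=
  inferInstanceAs (Module ℝ ↥(sobolevSubmodule T))

/-- The underlying continuous function on the circle `ℝ / Tℤ`. -/
def H2per.toC {T : ℝ} [Fact (0 < T)] (f : H2per T) : C(AddCircle T, ℝ) := f.1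

/-- The isometric embedding `f ↦ ((1 + m²) c_m)_m` of `H²_per(0,T)` into `ℓ²(ℤ, ℂ)`. -/
noncomputable def H2per.toL2 (T : ℝ) [Fact (0 < T)] : H2per T →ₗ[ℝ] lp (fun _ : ℤ => ℂ) 2 where
  toFun f := ⟨weightedFourierCoeff f.toC, f.2⟩
  map_add' f g := Subtype.ext (weightedFourierCoeff_add f.toC g.toC)
  map_smul' c f := Subtype.ext (weightedFourierCoeff_smul c f.toC)

theorem H2per.toL2_injective (T : ℝ) [Fact (0 < T)] : Function.Injective (H2per.toL2 T) := by
  rw [injective_iff_map_eq_zero]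
  intro f hf
  have hw : ∀ m : ℤ, weightedFourierCoeff f.toC m = 0 := fun m =>
    congrFun (congrArg Subtype.val hf) m
  let g : C(AddCircle T, ℂ) := ⟨fun t => ((f.toC t : ℝ) : ℂ), by fun_prop⟩
  have hg : ∀ m : ℤ, fourierCoeff (g : AddCircle T → ℂ) m = 0 := by
    intro m
    have h1 : (1 + (m : ℂ) ^ 2) ≠ 0 := by
      have h2 : (1 + (m : ℝ) ^ 2) ≠ 0 := by positivity
      exact_mod_cast h2
    exact (mul_eq_zero.mp (hw m)).resolve_left h1
  have hg' : fourierCoeff (g : AddCircle T → ℂ) = 0 := funext hg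
  have hs : Summable (fourierCoeff (g : AddCircle T → ℂ)) := by
    rw [hg']
    exact summable_zero
  have h := hasSum_fourier_series_of_summable hs
  simp only [hg, zero_smul] at h
  have hz : g = 0 := h.unique hasSum_zero
  apply Subtype.ext
  ext t
  have ht : ((f.toC t : ℝ) : ℂ) = 0 := DFunLike.congr_fun hz t
  exact_mod_cast ht

/-- The norm is `‖f‖ = (∑ (1 + m²)² |c_m|²)^(1/2)`. -/
noncomputable instance (T : ℝ) [Fact (0 < T)] : NormedAddCommGroup (H2per T) :=
  NormedAddCommGroup.induced (H2per T) (lp (fun _ : ℤ => ℂ) 2) (H2per.toL2 T)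
    (H2per.toL2_injective T)

noncomputable instance (T : ℝ) [Fact (0 < T)] : NormedSpace ℝ (H2per T) :=
  NormedSpace.induced ℝ (H2per T) (lp (fun _ : ℤ => ℂ) 2) (H2per.toL2 T)

theorem H2per.norm_eq {T : ℝ} [Fact (0 < T)] (f : H2per T) :
    ‖f‖ = Real.sqrt (∑' m : ℤ,
      (1 + (m : ℝ) ^ 2) ^ 2 * ‖fourierCoeff (fun t => ((f.toC t : ℝ) : ℂ)) m‖ ^ 2) := by
  have h : ‖f‖ = ‖H2per.toL2 T f‖ := rfl
  rw [h, lp.norm_eq_tsum_rpow (by norm_num), Real.sqrt_eq_rpow]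
  norm_num
  congr 1
  apply tsum_congr
  intro m
  change ‖weightedFourierCoeff f.toC m‖ ^ 2 = _
  have h1 : (1 + (m : ℂ) ^ 2) = ((1 + (m : ℝ) ^ 2 : ℝ) : ℂ) := by push_cast; rfl
  rw [weightedFourierCoeff, norm_mul, mul_pow, h1, Complex.norm_real, Real.norm_eq_abs, sq_abs]

/-- The subspace `H²_e(0,T)` of even functions. -/
def H2e (T : ℝ) [Fact (0 < T)] : Submodule ℝ (H2per T) where
  carrier := {f | ∀ t : AddCircle T, f.toC (-t) = f.toC t}
  add_mem' := by
    intro f g hf hg t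
    exact congrArg₂ (· + ·) (hf t) (hg t)
  zero_mem' := fun _ => rfl
  smul_mem' := by
    intro c f hf t
    exact congrArg (c * ·) (hf t)

/-- An element of `H²_e(0,T)` as a `T`-periodic function of `t ∈ ℝ`. -/
def onReal {T : ℝ} [Fact (0 < T)] (f : H2e T) (t : ℝ) : ℝ := f.1.toC (t : AddCircle T)

/-! ### The space `l²(ℤ, H²_e(0,T))`, shifts and unit vectors -/

/-- `l²(ℤ, H²_e(0,T))` with its norm `(∑ ‖u_n‖²)^(1/2)`. -/
abbrev LatticeSpace (T : ℝ) [Fact (0 < T)] : Type := ↥(lp (fun _ : ℤ => H2e T) 2)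

/-- The shift `(τ_j u)_n = u_{n - j}`. -/
noncomputable def latticeShift {T : ℝ} [Fact (0 < T)] (j : ℤ) (u : LatticeSpace T) :
    LatticeSpace T :=
  ⟨fun n => u (n - j), by
    have h := lp.memℓp u
    change Memℓp (fun n => u (n - j)) 2
    rw [memℓp_gen_iff (by norm_num)] at h ⊢
    exact (Equiv.subRight j).summable_iff.mpr h⟩

/-- The vector `f 𝐞_k`: it is `f` at the site `k` and `0` at all other sites. -/
noncomputable def atSite {T : ℝ} [Fact (0 < T)] (k : ℤ) (f : H2e T) : LatticeSpace T :=
  lp.single 2 k f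

/-! ### The differential equations -/

/-- `g` is the second derivative of `f` at every point. In all uses below `f` is in `H²_per`, and
the equation `f'' = g` has a continuous right-hand side `g`, so that a solution in the sense of
`L²` is the same as a classical one. -/
def HasSecondDeriv (f g : ℝ → ℝ) : Prop :=
  Differentiable ℝ f ∧ ∀ t, HasDerivAt (deriv f) (g t) t

/-- `f'' + V'(f) = 0`. -/
def SolvesOscillator (V : ℝ → ℝ) {T : ℝ} [Fact (0 < T)] (f : H2e T) : Prop :=
  HasSecondDeriv (onReal f) (fun t => -deriv V (onReal f t))

/-- `L₀ w = w'' + w = f`. -/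
def SolvesL0 {T : ℝ} [Fact (0 < T)] (w f : H2e T) : Prop :=
  HasSecondDeriv (onReal w) (fun t => onReal f t - onReal w t)

/-- `L_e w = w'' + V''(φ(t)) w = f`. -/
def SolvesLe (V : ℝ → ℝ) {T : ℝ} [Fact (0 < T)] (φ w f : H2e T) : Prop :=
  HasSecondDeriv (onReal w) (fun t => onReal f t - deriv (deriv V) (onReal φ t) * onReal w t)

/-- `u_n'' + V'(u_n) = ε (u_{n+1} - 2 u_n + u_{n-1})` for all `n ∈ ℤ`. -/
def SolvesKleinGordon (V : ℝ → ℝ) {T : ℝ} [Fact (0 < T)] (ε : ℝ) (u : LatticeSpace T) : Prop :=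
  ∀ n : ℤ, HasSecondDeriv (onReal (u n)) (fun t =>
    ε * (onReal (u (n + 1)) t - 2 * onReal (u n) t + onReal (u (n - 1)) t) -
      deriv V (onReal (u n) t))

/-! ### Turning point and period as functions of the energy -/

/-- The smallest positive root `a` of `V(a) = E`. -/
noncomputable def turningPoint (V : ℝ → ℝ) (E : ℝ) : ℝ := sInf {x : ℝ | 0 < x ∧ V x = E}

/-- `T(E) = √2 ∫_{-a}^{a} dx / √(E - V(x))`, where `a` is the turning point. -/
noncomputable def oscillatorPeriod (V : ℝ → ℝ) (E : ℝ) : ℝ :=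
  Real.sqrt 2 * ∫ x in (-turningPoint V E)..(turningPoint V E), 1 / Real.sqrt (E - V x)

/-! ### Continuation in the coupling constant -/

/-- The family `ε ↦ u(ε)` continues `u₀`: for all small `ε` it consists of solutions of the
lattice equation, and it is `O(ε)`-close to `u₀`. -/
def IsContinuation (V : ℝ → ℝ) {T : ℝ} [Fact (0 < T)] (u₀ : LatticeSpace T)
    (u : ℝ → LatticeSpace T) : Prop :=
  ∃ ε₀ > 0, ∃ C > 0, ∀ ε : ℝ, |ε| < ε₀ →
    SolvesKleinGordon V ε (u ε) ∧ ‖u ε - u₀‖ ≤ C * |ε|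

/-- For all small `ε` there is exactly one solution of the lattice equation in a `C |ε|`-ball
around `u₀`. -/
def HasUniqueContinuation (V : ℝ → ℝ) {T : ℝ} [Fact (0 < T)] (u₀ : LatticeSpace T) : Prop :=
  ∃ ε₀ > 0, ∃ C > 0, ∀ ε : ℝ, |ε| < ε₀ →
    ∃! v : LatticeSpace T, SolvesKleinGordon V ε v ∧ ‖v - u₀‖ ≤ C * |ε|

/-- The Taylor polynomial `∑_{i ≤ N} ε^i / i! · (d/dε)^i Φ(ε) |_{ε = 0}`. -/
noncomputable def taylorPoly {T : ℝ} [Fact (0 < T)] (Φ : ℝ → LatticeSpace T) (N : ℕ) (ε : ℝ) :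
    LatticeSpace T :=
  ∑ i ∈ Finset.range (N + 1), (ε ^ i / (Nat.factorial i : ℝ)) • iteratedDeriv i Φ 0

/-!
The equation is turned into a fixed point problem. Since `T` is not a multiple of `2π`, the operator
`L₀ = ∂² + 1` has a bounded inverse `K` from continuous even functions to `H²_e` (`IsL0Inverse`), and
the lattice equation becomes `kgMap (ε, u) = u + K (V'(u) - u) - ε K Δu = 0`, a smooth map on
`l²(ℤ, H²_e)`: the embedding of `H²` into continuous functions makes the superposition operator
smooth, and the sites decouple in the nonlinear term.

*Nondegeneracy.* At `ε = 0` the linearisation is the identity at sites at rest and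
`K L_e = 1 + K (V''(φ) - 1)` at excited sites, which is a compact perturbation of the identity, so
it is enough that `L_e` has no even periodic kernel (`linearized_eq_zero`). If `w` is in this
kernel, the Wronskian of `w` and `φ'` shows that `w` vanishes at the quarter period `T/4`, where `φ`
does too. Along `φ + δ w` the energy is conserved up to `O(δ²)`, so the period at the energy
`V(a + δ w(0))` is `T + O(δ²)`; as `T'(E) ≠ 0` and `V'(a) ≠ 0`, this forces `w(0) = 0`, and `w = 0`.
The implicit function theorem, in the form `exists_smooth_branch`, then gives a smooth branch through
every superposition of signed copies of `φ`, and with it the bound `‖W - u‖ ≤ C ‖kgMap (ε, W)‖` for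
every `W` near the branch.

*Expansion.* By this bound it is enough to find an approximate solution with residual `O(ε^(N+1))`.
It is the superposition `W` of two breathers, corrected by `ε^N (ψ - φ_N)` at the two excited sites.
The fundamental breather is `O(ε^m)` at distance `m` from its centre, because the force has no
quadratic part and each further site costs one power of `ε` (`breather_decay`), and its leading term
there is `ε^m φ_m` (`breather_leading_term`). As `V'(u) - u` vanishes to third order, two tails
interact only at order `ε^(N+1)`. At an excited site the tail `ε^N φ_N` of the other breather is not
in equilibrium, since the linearisation there is `L_e` and not `L₀`; replacing it by `ε^N ψ` restores
the balance (`excited_site_isBigO`). Altogether `kgMap_superposition_isBigO` bounds the residual, and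
Taylor's theorem replaces each breather by its Taylor polynomial of degree `N`.
-/

/-! ### The space `H²_per(0,T)`: completeness and compact embedding into continuous functions -/

section Sobolev

variable {T : ℝ} [Fact (0 < T)]

/-- `H2per.toL2` as a linear isometry. -/
noncomputable def H2per.toL2Isometry (T : ℝ) [Fact (0 < T)] :
    H2per T →ₗᵢ[ℝ] lp (fun _ : ℤ => ℂ) 2 where
  toLinearMap := H2per.toL2 T
  norm_map' _ := rfl

/-- The `m`-th Fourier coefficient as a continuous linear functional on `H²_per(0,T)`. -/
noncomputable def H2per.coeffCLM (T : ℝ) [Fact (0 < T)] (m : ℤ) : H2per T →L[ℝ] ℂ :=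
  (1 + (m : ℝ) ^ 2)⁻¹ • (lp.evalCLM ℝ (fun _ : ℤ => ℂ) 2 m ∘L
    (H2per.toL2Isometry T).toContinuousLinearMap)

/-- The rank-one operator `f ↦ c_m exp(2 π i m t / T)` from `H²_per(0,T)` to continuous functions,
where `c_m` is the `m`-th Fourier coefficient of `f`. -/
noncomputable def H2per.fourierTerm (T : ℝ) [Fact (0 < T)] (m : ℤ) :
    H2per T →L[ℝ] C(AddCircle T, ℂ) :=
  (ContinuousLinearMap.toSpanSingleton ℂ (fourier m : C(AddCircle T, ℂ))).restrictScalars ℝ ∘L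
    H2per.coeffCLM T m

theorem H2per.fourierTerm_apply (f : H2per T) (m : ℤ) :
    H2per.fourierTerm T m f = fourierCoeff (fun t => ((f.toC t : ℝ) : ℂ)) m • fourier m := by
  have h1 : (1 + (m : ℂ) ^ 2) ≠ 0 := by
    have h2 : (1 + (m : ℝ) ^ 2) ≠ 0 := by positivity
    exact_mod_cast h2
  change (((1 + (m : ℝ) ^ 2)⁻¹ : ℝ) • weightedFourierCoeff f.toC m) •
    (fourier m : C(AddCircle T, ℂ)) = _
  congr 1
  rw [weightedFourierCoeff, Complex.real_smul]
  push_cast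
  field_simp

theorem H2per.norm_fourierTerm_le (m : ℤ) : ‖H2per.fourierTerm T m‖ ≤ (1 + (m : ℝ) ^ 2)⁻¹ := by
  refine ContinuousLinearMap.opNorm_le_bound _ (by positivity) fun f => ?_
  change ‖(((1 + (m : ℝ) ^ 2)⁻¹ : ℝ) • H2per.toL2 T f m) • (fourier m : C(AddCircle T, ℂ))‖ ≤ _
  rw [norm_smul, fourier_norm, mul_one, norm_smul, Real.norm_of_nonneg (by positivity)]
  gcongr
  exact lp.norm_apply_le_norm (by norm_num) (H2per.toL2 T f) m

theorem summable_inv_one_add_int_sq : Summable fun m : ℤ => (1 + (m : ℝ) ^ 2)⁻¹ := by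
  have h := (Real.summable_one_div_int_pow (p := 2)).mpr (by norm_num)
  refine Summable.of_norm_bounded_eventually h ?_
  have hfin : ∀ᶠ m : ℤ in cofinite, m ≠ 0 :=
    (Set.finite_singleton (0 : ℤ)).compl_mem_cofinite
  filter_upwards [hfin] with m hm
  rw [Real.norm_of_nonneg (by positivity), one_div]
  have : (0 : ℝ) < (m : ℝ) ^ 2 := by positivity
  gcongr
  linarith

theorem H2per.summable_fourierTerm : Summable (H2per.fourierTerm T) :=
  Summable.of_norm_bounded summable_inv_one_add_int_sq H2per.norm_fourierTerm_le

theorem hasSum_clm_apply {ι E F : Type*} [NormedAddCommGroup E] [NormedSpace ℝ E]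
    [NormedAddCommGroup F] [NormedSpace ℝ F] {u : ι → E →L[ℝ] F} (hu : Summable u) (x : E) :
    HasSum (fun i => u i x) ((∑' i, u i) x) :=
  (ContinuousLinearMap.apply ℝ F x).hasSum hu.hasSum

theorem H2per.tsum_fourierTerm_apply (f : H2per T) (t : AddCircle T) :
    (∑' m, H2per.fourierTerm T m) f t = f.toC t := by
  let g : C(AddCircle T, ℂ) := ⟨fun t => ((f.toC t : ℝ) : ℂ), by fun_prop⟩
  have h := hasSum_clm_apply H2per.summable_fourierTerm f
  have hs : Summable (fourierCoeff (g : AddCircle T → ℂ)) := by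
    refine Summable.of_norm_bounded (summable_inv_one_add_int_sq.mul_right ‖f‖) fun m => ?_
    have hm := (H2per.fourierTerm T m).le_of_opNorm_le (H2per.norm_fourierTerm_le m) f
    rw [H2per.fourierTerm_apply, norm_smul, fourier_norm, mul_one] at hm
    exact hm
  have h2 : (fun m => H2per.fourierTerm T m f) = fun m => fourierCoeff g m • fourier m :=
    funext fun m => H2per.fourierTerm_apply f m
  rw [h2] at h
  exact DFunLike.congr_fun (h.unique (hasSum_fourier_series_of_summable hs)) t

theorem H2per.isCompactOperator_tsum_fourierTerm :
    IsCompactOperator (∑' m, H2per.fourierTerm T m : H2per T →L[ℝ] C(AddCircle T, ℂ)) := by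
  refine isCompactOperator_of_tendsto (H2per.summable_fourierTerm (T := T)).hasSum
    (.of_forall fun s => ?_)
  have hm : ∀ m, IsCompactOperator (H2per.fourierTerm T m) := fun m =>
    (isCompactOperator_of_locallyCompactSpace_dom (H2per.coeffCLM T m)).clm_comp
      ((ContinuousLinearMap.toSpanSingleton ℂ (fourier m : C(AddCircle T, ℂ))).restrictScalars ℝ)
  induction s using Finset.cons_induction with
  | empty => simpa using isCompactOperator_zero
  | cons m s hms ih =>
    rw [Finset.sum_cons]
    exact (hm m).add ih

/-- The embedding of `H²_per(0,T)` into continuous functions. -/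
noncomputable def H2per.toCCLM (T : ℝ) [Fact (0 < T)] : H2per T →L[ℝ] C(AddCircle T, ℝ) :=
  (Complex.reCLM.compLeftContinuous ℝ (AddCircle T)) ∘L (∑' m, H2per.fourierTerm T m)

theorem H2per.toCCLM_apply (f : H2per T) : H2per.toCCLM T f = f.toC := by
  ext t
  change ((∑' m, H2per.fourierTerm T m) f t).re = _
  rw [H2per.tsum_fourierTerm_apply, Complex.ofReal_re]

theorem H2per.isCompactOperator_toCCLM : IsCompactOperator (H2per.toCCLM T) :=
  (H2per.isCompactOperator_tsum_fourierTerm (T := T)).clm_comp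
    (Complex.reCLM.compLeftContinuous ℝ (AddCircle T))

theorem continuous_weightedFourierCoeff (m : ℤ) :
    Continuous fun f : C(AddCircle T, ℝ) => weightedFourierCoeff f m := by
  let L : C(AddCircle T, ℝ) →ₗ[ℝ] ℂ :=
    { toFun := fun f => weightedFourierCoeff f m
      map_add' := fun f g => congrFun (weightedFourierCoeff_add f g) m
      map_smul' := fun c f => congrFun (weightedFourierCoeff_smul c f) m }
  refine AddMonoidHomClass.continuous_of_bound L ‖1 + (m : ℂ) ^ 2‖ fun f => ?_
  change ‖(1 + (m : ℂ) ^ 2) * _‖ ≤ _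
  rw [norm_mul]
  gcongr
  refine (norm_integral_le_of_norm_le_const (C := ‖f‖) (.of_forall fun t => ?_)).trans (by simp)
  rw [norm_smul, fourier_apply, Circle.norm_coe, one_mul, Complex.norm_real]
  exact f.norm_coe_le_norm t

instance : CompleteSpace (H2per T) := by
  refine Metric.complete_of_cauchySeq_tendsto fun u hu => ?_
  obtain ⟨g, hg⟩ := cauchySeq_tendsto_of_complete
    ((H2per.toL2Isometry T).isometry.uniformContinuous.comp_cauchySeq hu)
  obtain ⟨f, hf⟩ := cauchySeq_tendsto_of_complete
    ((H2per.toCCLM T).uniformContinuous.comp_cauchySeq hu)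
  have hfg : weightedFourierCoeff f = g := by
    funext m
    refine tendsto_nhds_unique (((continuous_weightedFourierCoeff m).tendsto f).comp hf) ?_
    refine Tendsto.congr (fun n => ?_)
      (((lp.evalCLM ℝ (fun _ : ℤ => ℂ) 2 m).continuous.tendsto g).comp hg)
    change weightedFourierCoeff (u n).toC m = weightedFourierCoeff (H2per.toCCLM T (u n)) m
    rw [H2per.toCCLM_apply]
  have hmem : Memℓp (weightedFourierCoeff f) 2 := hfg ▸ lp.memℓp g
  let F : H2per T := ⟨f, hmem⟩
  refine ⟨F, (H2per.toL2Isometry T).isometry.isEmbedding.isInducing.tendsto_nhds_iff.2 ?_⟩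
  have hF : H2per.toL2Isometry T F = g := Subtype.ext hfg
  rw [hF]
  exact hg

theorem isClosed_H2e : IsClosed (H2e T : Set (H2per T)) := by
  have h : (H2e T : Set (H2per T)) = ⋂ t : AddCircle T,
      {f | H2per.toCCLM T f (-t) = H2per.toCCLM T f t} := by
    ext f
    simp only [H2per.toCCLM_apply, Set.mem_iInter, Set.mem_ofPred_eq]
    rfl
  rw [h]
  refine isClosed_iInter fun t => isClosed_eq ?_ ?_
  · exact (continuous_eval_const (-t)).comp (H2per.toCCLM T).continuous
  · exact (continuous_eval_const t).comp (H2per.toCCLM T).continuous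

instance : CompleteSpace (H2e T) := isClosed_H2e.completeSpace_coe

/-- The embedding of `H²_e(0,T)` into continuous functions. -/
noncomputable def H2e.toCCLM (T : ℝ) [Fact (0 < T)] : H2e T →L[ℝ] C(AddCircle T, ℝ) :=
  H2per.toCCLM T ∘L (H2e T).subtypeL

theorem H2e.toCCLM_apply_coe (f : H2e T) (t : ℝ) :
    H2e.toCCLM T f (t : AddCircle T) = onReal f t := by
  change H2per.toCCLM T f.1 _ = _
  rw [H2per.toCCLM_apply]
  rfl

theorem H2e.toCCLM_neg (f : H2e T) (t : AddCircle T) :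
    H2e.toCCLM T f (-t) = H2e.toCCLM T f t := by
  change H2per.toCCLM T f.1 _ = H2per.toCCLM T f.1 _
  rw [H2per.toCCLM_apply]
  exact f.2 t

theorem H2e.toCCLM_injective : Function.Injective (H2e.toCCLM T) := by
  intro f g h
  change H2per.toCCLM T f.1 = H2per.toCCLM T g.1 at h
  rw [H2per.toCCLM_apply, H2per.toCCLM_apply] at h
  exact Subtype.ext (Subtype.ext h)

theorem H2e.isCompactOperator_toCCLM : IsCompactOperator (H2e.toCCLM T) :=
  H2per.isCompactOperator_toCCLM.comp_clm _

theorem onReal_add_period (f : H2e T) (t : ℝ) : onReal f (t + T) = onReal f t := by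
  simp [onReal]

theorem onReal_neg (f : H2e T) (t : ℝ) : onReal f (-t) = onReal f t := by
  have := f.2 (t : AddCircle T)
  simpa [onReal] using this

theorem onReal_injective : Function.Injective (onReal : H2e T → ℝ → ℝ) := by
  intro f g h
  apply H2e.toCCLM_injective
  ext t
  obtain ⟨t, rfl⟩ := QuotientAddGroup.mk_surjective t
  exact (H2e.toCCLM_apply_coe f t).trans ((congrFun h t).trans (H2e.toCCLM_apply_coe g t).symm)

end Sobolev

/-! ### Second derivatives and Fourier coefficients -/

section SecondDeriv

theorem HasSecondDeriv.hasDerivAt {f g : ℝ → ℝ} (h : HasSecondDeriv f g) (t : ℝ) :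
    HasDerivAt f (deriv f t) t := (h.1 t).hasDerivAt

theorem HasSecondDeriv.of_hasDerivAt {f f' g : ℝ → ℝ} (h : ∀ t, HasDerivAt f (f' t) t)
    (h' : ∀ t, HasDerivAt f' (g t) t) : HasSecondDeriv f g := by
  have : deriv f = f' := funext fun t => (h t).deriv
  exact ⟨fun t => (h t).differentiableAt, this ▸ h'⟩

theorem HasSecondDeriv.continuous_deriv {f g : ℝ → ℝ} (h : HasSecondDeriv f g) :
    Continuous (deriv f) :=
  continuous_iff_continuousAt.2 fun t => (h.2 t).continuousAt

theorem deriv_add_period {f : ℝ → ℝ} {T : ℝ} (h : ∀ t, f (t + T) = f t) (t : ℝ) :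
    deriv f (t + T) = deriv f t := by
  rw [← deriv_comp_add_const, funext h]

/-- Uniqueness for linear differential inequalities: a function with `|f''| ≤ K |f|` and vanishing
Cauchy data at one point vanishes. -/
theorem HasSecondDeriv.eq_zero {f g : ℝ → ℝ} (h : HasSecondDeriv f g) {K t₀ : ℝ}
    (hK : ∀ t, |g t| ≤ K * |f t|) (h0 : f t₀ = 0) (h0' : deriv f t₀ = 0) (t : ℝ) : f t = 0 := by
  have key : ∀ {f g : ℝ → ℝ}, HasSecondDeriv f g → (∀ t, |g t| ≤ K * |f t|) → f t₀ = 0 →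
      deriv f t₀ = 0 → ∀ t, t₀ ≤ t → f t = 0 := by
    intro f g h hK h0 h0' t ht
    have hF : ∀ s, HasDerivAt (fun s => (f s, deriv f s)) (deriv f s, g s) s := fun s =>
      (h.hasDerivAt s).prodMk (h.2 s)
    have h1 := eq_zero_of_abs_deriv_le_mul_abs_self_of_eq_zero_right (a := t₀) (b := t)
      (K := max 1 K) (f := fun s => (f s, deriv f s)) (f' := fun s => (deriv f s, g s))
      (fun s _ => (hF s).continuousAt.continuousWithinAt) (fun s _ => (hF s).hasDerivWithinAt)
      (by simp [h0, h0']) (fun s _ => ?_) t ⟨ht, le_rfl⟩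
    · exact congrArg Prod.fst h1
    · have hf : |f s| ≤ ‖(f s, deriv f s)‖ := norm_fst_le (f s, deriv f s)
      have hf' : |deriv f s| ≤ ‖(f s, deriv f s)‖ := norm_snd_le (f s, deriv f s)
      refine norm_prod_le_iff.2 ⟨?_, ?_⟩
      · refine hf'.trans (le_mul_of_one_le_left (norm_nonneg _) (le_max_left _ _))
      · refine (hK s).trans ?_
        exact mul_le_mul (le_max_right _ _) hf (abs_nonneg _) (zero_le_one.trans (le_max_left _ _))
  rcases le_total t₀ t with ht | ht
  · exact key h hK h0 h0' t ht
  · have hr : ∀ s, HasDerivAt (fun s => f (2 * t₀ - s)) (-deriv f (2 * t₀ - s)) s := fun s =>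
      (h.hasDerivAt (2 * t₀ - s)).comp_const_sub (2 * t₀) s
    have hr' : ∀ s, HasDerivAt (fun s => -deriv f (2 * t₀ - s)) (g (2 * t₀ - s)) s := fun s => by
      have h1 := ((h.2 (2 * t₀ - s)).comp_const_sub (2 * t₀) s).neg
      rw [neg_neg] at h1
      exact h1
    have h2 := key (HasSecondDeriv.of_hasDerivAt hr hr') (fun s => hK _)
      (by simpa [two_mul] using h0) (by rw [(hr t₀).deriv]; simp [two_mul, h0']) (2 * t₀ - t)
      (by linarith)
    simpa using h2

variable {T : ℝ} [Fact (0 < T)]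

/-- Green's formula over one period against `exp(-2 π i m t / T)`: the Fourier coefficients of a
second derivative. -/
theorem weightedFourierCoeff_eq_fourierCoeff (w q : C(AddCircle T, ℝ))
    (h : HasSecondDeriv (fun t : ℝ => w t) (fun t : ℝ => q t)) (m : ℤ) :
    weightedFourierCoeff w m =
      fourierCoeff (fun t => ((w t - (T / (2 * Real.pi)) ^ 2 * q t : ℝ) : ℂ)) m := by
  have hT : (0 : ℝ) < T := Fact.out
  set e : ℝ → ℂ := fun t => fourier (-m) (t : AddCircle T) with he
  set κ : ℂ := -2 * Real.pi * Complex.I * m / T with hκ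
  have hde : ∀ t, HasDerivAt e (κ * e t) t := fun t => hasDerivAt_fourier_neg T m t
  have hdw : ∀ t, HasDerivAt (fun t : ℝ => ((w t : ℝ) : ℂ))
      ((deriv (fun t : ℝ => w t) t : ℝ) : ℂ) t := fun t => (h.hasDerivAt t).ofReal_comp
  have hddw : ∀ t : ℝ, HasDerivAt (fun t : ℝ => ((deriv (fun t : ℝ => w t) t : ℝ) : ℂ))
      ((q t : ℝ) : ℂ) t := fun t => (h.2 t).ofReal_comp
  have hG : ∀ t : ℝ, HasDerivAt
      (fun t : ℝ => ((deriv (fun t : ℝ => w t) t : ℝ) : ℂ) * e t - ((w t : ℝ) : ℂ) * (κ * e t))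
      (e t * ((q t : ℝ) : ℂ) - κ ^ 2 * (e t * ((w t : ℝ) : ℂ))) t := fun t => by
    refine (((hddw t).mul (hde t)).sub ((hdw t).mul ((hde t).const_mul κ))).congr_deriv ?_
    ring
  have hce : Continuous e := (map_continuous (fourier (-m))).comp (AddCircle.continuous_mk' T)
  have hcw : Continuous fun t : ℝ => ((w t : ℝ) : ℂ) :=
    Complex.continuous_ofReal.comp (w.continuous.comp (AddCircle.continuous_mk' T))
  have hcq : Continuous fun t : ℝ => ((q t : ℝ) : ℂ) :=
    Complex.continuous_ofReal.comp (q.continuous.comp (AddCircle.continuous_mk' T))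
  have hint : ∀ a b, IntervalIntegrable (fun t => e t * ((q t : ℝ) : ℂ)) volume a b := fun a b =>
    (hce.mul hcq).intervalIntegrable a b
  have hint' : ∀ a b, IntervalIntegrable (fun t => e t * ((w t : ℝ) : ℂ)) volume a b := fun a b =>
    (hce.mul hcw).intervalIntegrable a b
  have hper : ∀ t : ℝ, ((t + T : ℝ) : AddCircle T) = t := fun t => by simp
  have hFTC := intervalIntegral.integral_eq_sub_of_hasDerivAt (a := 0) (b := 0 + T)
    (fun t _ => hG t) ((hint _ _).sub ((hint' _ _).const_mul _))
  have hde0 : deriv (fun t : ℝ => w t) (0 + T) = deriv (fun t : ℝ => w t) 0 :=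
    deriv_add_period (fun t => by rw [hper]) 0
  have he0 : e (0 + T) = e 0 := by simp only [he, hper]
  rw [hde0, he0, hper, sub_self, intervalIntegral.integral_sub (hint _ _) ((hint' _ _).const_mul _),
    intervalIntegral.integral_const_mul, sub_eq_zero] at hFTC
  rw [weightedFourierCoeff, fourierCoeff_eq_intervalIntegral _ _ 0,
    fourierCoeff_eq_intervalIntegral _ _ 0]
  have hsplit : ∫ t in (0 : ℝ)..0 + T,
      fourier (-m) (t : AddCircle T) • ((w t - (T / (2 * Real.pi)) ^ 2 * q t : ℝ) : ℂ) =
      (∫ t in (0 : ℝ)..0 + T, e t * ((w t : ℝ) : ℂ)) -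
        ((T / (2 * Real.pi)) ^ 2 : ℝ) * ∫ t in (0 : ℝ)..0 + T, e t * ((q t : ℝ) : ℂ) := by
    rw [← intervalIntegral.integral_const_mul, ← intervalIntegral.integral_sub (hint' _ _)
      ((hint _ _).const_mul _)]
    refine intervalIntegral.integral_congr fun t _ => ?_
    simp only [he, smul_eq_mul]
    push_cast
    ring
  rw [hsplit, hFTC]
  change _ * ((1 / T) • ∫ t in (0 : ℝ)..0 + T, e t * ((w t : ℝ) : ℂ)) = _
  have hk : (((T / (2 * Real.pi)) ^ 2 : ℝ) : ℂ) * κ ^ 2 = -(m : ℂ) ^ 2 := by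
    have h1 : (T : ℂ) ≠ 0 := by exact_mod_cast hT.ne'
    have h2 : (Real.pi : ℂ) ≠ 0 := by exact_mod_cast Real.pi_ne_zero
    rw [hκ]
    push_cast
    field_simp
    rw [Complex.I_sq]
    ring
  rw [← mul_assoc, hk, Complex.real_smul, Complex.real_smul]
  ring

/-- Parseval's identity gives the `ℓ²` norm of the Fourier coefficients of a continuous function,
which is at most its sup norm. -/
theorem exists_lp_eq_fourierCoeff (r : C(AddCircle T, ℝ)) :
    ∃ c : lp (fun _ : ℤ => ℂ) 2, (∀ m, c m = fourierCoeff (fun t => ((r t : ℝ) : ℂ)) m) ∧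
      ‖c‖ ≤ ‖r‖ := by
  let g : C(AddCircle T, ℂ) := ⟨fun t => ((r t : ℝ) : ℂ), by fun_prop⟩
  refine ⟨fourierBasis.repr (ContinuousMap.toLp (E := ℂ) 2 AddCircle.haarAddCircle ℂ g), ?_, ?_⟩
  · intro m
    rw [fourierBasis_repr, fourierCoeff_toLp]
    rfl
  · rw [LinearIsometryEquiv.norm_map]
    refine (ContinuousLinearMap.le_opNorm _ _).trans ?_
    have h1 : ‖(ContinuousMap.toLp 2 AddCircle.haarAddCircle ℂ :
        C(AddCircle T, ℂ) →L[ℂ] Lp ℂ 2 AddCircle.haarAddCircle)‖ ≤ 1 := by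
      refine (ContinuousMap.toLp_norm_le (𝕜 := ℂ) AddCircle.haarAddCircle).trans ?_
      simp [measureUnivNNReal]
    have h2 : ‖g‖ ≤ ‖r‖ := (ContinuousMap.norm_le _ (norm_nonneg _)).2 fun t => by
      change ‖((r t : ℝ) : ℂ)‖ ≤ _
      rw [Complex.norm_real]
      exact r.norm_coe_le_norm t
    calc _ ≤ 1 * ‖r‖ := mul_le_mul h1 h2 (norm_nonneg _) zero_le_one
      _ = ‖r‖ := one_mul _

/-- A `C²` function lies in `H²_per(0,T)`. Its norm is the `L²` norm of `w - (T / 2π)² w''`, hence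
at most the sup norm of this function. -/
theorem exists_H2per_of_hasSecondDeriv (w q : C(AddCircle T, ℝ))
    (h : HasSecondDeriv (fun t : ℝ => w t) (fun t : ℝ => q t)) :
    ∃ f : H2per T, f.toC = w ∧ ‖f‖ ≤ ‖w - (T / (2 * Real.pi)) ^ 2 • q‖ := by
  obtain ⟨c, hc, hn⟩ := exists_lp_eq_fourierCoeff (w - (T / (2 * Real.pi)) ^ 2 • q)
  have hcw : weightedFourierCoeff w = c := by
    funext m
    rw [weightedFourierCoeff_eq_fourierCoeff w q h m, hc m]
    rfl
  have hmem : Memℓp (weightedFourierCoeff w) 2 := hcw ▸ lp.memℓp c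
  refine ⟨⟨w, hmem⟩, rfl, ?_⟩
  have : H2per.toL2 T ⟨w, hmem⟩ = c := Subtype.ext hcw
  change ‖H2per.toL2 T ⟨w, hmem⟩‖ ≤ _
  rw [this]
  exact hn

end SecondDeriv

/-! ### The inverse of `L₀` and the Fredholm alternative -/

section Resolvent

theorem sin_half_ne_zero {T : ℝ} (hT : 0 < T) (hres : ∀ n : ℕ, T ≠ 2 * Real.pi * n) :
    Real.sin (T / 2) ≠ 0 := by
  rw [Ne, Real.sin_eq_zero_iff]
  rintro ⟨n, hn⟩
  have hn0 : (0 : ℝ) < n := by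
    by_contra h
    have : (n : ℝ) * Real.pi ≤ 0 := mul_nonpos_of_nonpos_of_nonneg (not_lt.1 h) Real.pi_pos.le
    linarith
  have hn0' : 0 < n := by exact_mod_cast hn0
  refine hres n.toNat ?_
  have : ((n.toNat : ℕ) : ℝ) = (n : ℝ) := by
    exact_mod_cast Int.toNat_of_nonneg hn0'.le
  rw [this]
  linarith

theorem deriv_neg_of_even {f : ℝ → ℝ} (h : ∀ t, f (-t) = f t) (t : ℝ) :
    deriv f (-t) = -deriv f t := by
  have h1 := deriv_comp_neg f t
  rw [funext h] at h1
  linarith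

/-- An even `T`-periodic function is symmetric about the half period, so its derivative vanishes
there. -/
theorem deriv_half_period_eq_zero {f : ℝ → ℝ} {T : ℝ} (h : ∀ t, f (-t) = f t)
    (hp : ∀ t, f (t + T) = f t) : deriv f (T / 2) = 0 := by
  have h1 := deriv_neg_of_even h (T / 2)
  have h2 := deriv_add_period hp (-(T / 2))
  rw [show -(T / 2) + T = T / 2 by ring] at h2
  linarith

/-- Variation of constants for `w'' + w = F` with `F` even and periodic. The multiple of `cos` is
chosen such that `w'(T/2) = 0`, which makes the even solution `w` periodic; this is possible when
`T` is not a multiple of `2π`. -/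
theorem exists_even_periodic_solution {T : ℝ} (hT : 0 < T) (hs : Real.sin (T / 2) ≠ 0) {F : ℝ → ℝ}
    (hF : Continuous F) (hFe : ∀ t, F (-t) = F t) (hFp : ∀ t, F (t + T) = F t) {M : ℝ}
    (hM : ∀ t, |F t| ≤ M) :
    ∃ w : ℝ → ℝ, HasSecondDeriv w (fun t => F t - w t) ∧ (∀ t, w (-t) = w t) ∧
      (∀ t, w (t + T) = w t) ∧
      ∀ t, |w t| ≤ (2 * T + 2 * T / |Real.sin (T / 2)|) * M := by
  set A : ℝ → ℝ := fun t => ∫ s in (0 : ℝ)..t, Real.cos s * F s with hA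
  set B : ℝ → ℝ := fun t => ∫ s in (0 : ℝ)..t, Real.sin s * F s with hB
  have hcA : Continuous fun s => Real.cos s * F s := Real.continuous_cos.mul hF
  have hcB : Continuous fun s => Real.sin s * F s := Real.continuous_sin.mul hF
  have hdA : ∀ t, HasDerivAt A (Real.cos t * F t) t := fun t => hcA.integral_hasStrictDerivAt 0 t
    |>.hasDerivAt
  have hdB : ∀ t, HasDerivAt B (Real.sin t * F t) t := fun t => hcB.integral_hasStrictDerivAt 0 t
    |>.hasDerivAt
  have hAneg : ∀ t, A (-t) = -A t := by
    intro t
    have h := intervalIntegral.integral_comp_neg (a := 0) (b := t) (fun s => Real.cos s * F s)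
    simp only [Real.cos_neg, hFe, neg_zero] at h
    rw [hA]
    simp only
    rw [h, intervalIntegral.integral_symm]
  have hBneg : ∀ t, B (-t) = B t := by
    intro t
    have h := intervalIntegral.integral_comp_neg (a := 0) (b := t) (fun s => Real.sin s * F s)
    simp only [Real.sin_neg, hFe, neg_zero, neg_mul, intervalIntegral.integral_neg] at h
    rw [hB]
    simp only
    rw [intervalIntegral.integral_symm, ← h, neg_neg]
  set c : ℝ := (Real.cos (T / 2) * A (T / 2) + Real.sin (T / 2) * B (T / 2)) / Real.sin (T / 2)
    with hc
  set w : ℝ → ℝ := fun t => Real.sin t * A t - Real.cos t * B t + c * Real.cos t with hw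
  set w' : ℝ → ℝ := fun t => Real.cos t * A t + Real.sin t * B t - c * Real.sin t with hw'
  have hdw : ∀ t, HasDerivAt w (w' t) t := fun t => by
    refine ((((Real.hasDerivAt_sin t).mul (hdA t)).sub ((Real.hasDerivAt_cos t).mul (hdB t))).add
      ((Real.hasDerivAt_cos t).const_mul c)).congr_deriv ?_
    simp only [hw']
    ring
  have hdw' : ∀ t, HasDerivAt w' (F t - w t) t := fun t => by
    refine ((((Real.hasDerivAt_cos t).mul (hdA t)).add ((Real.hasDerivAt_sin t).mul (hdB t))).sub
      ((Real.hasDerivAt_sin t).const_mul c)).congr_deriv ?_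
    simp only [hw]
    linear_combination F t * Real.sin_sq_add_cos_sq t
  have hsol := HasSecondDeriv.of_hasDerivAt hdw hdw'
  have heven : ∀ t, w (-t) = w t := fun t => by
    simp only [hw, Real.sin_neg, Real.cos_neg, hAneg, hBneg]
    ring
  have hw'0 : w' (T / 2) = 0 := by
    simp only [hw', hc]
    field_simp
    ring
  have hdeq : deriv w = w' := funext fun t => (hdw t).deriv
  have hper : ∀ t, w (t + T) = w t := by
    have hd : HasSecondDeriv (fun t => w (t + T) - w t) (fun t => -(w (t + T) - w t)) := by
      refine HasSecondDeriv.of_hasDerivAt (f' := fun t => w' (t + T) - w' t)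
        (fun t => ((hdw (t + T)).comp_add_const t T).sub (hdw t)) (fun t => ?_)
      refine (((hdw' (t + T)).comp_add_const t T).sub (hdw' t)).congr_deriv ?_
      rw [hFp]
      ring
    intro t
    have := hd.eq_zero (K := 1) (t₀ := -(T / 2)) (fun t => by rw [abs_neg, one_mul]) ?_ ?_ t
    · linarith
    · rw [show -(T / 2) + T = T / 2 by ring, heven, sub_self]
    · have h1 : HasDerivAt (fun t => w (t + T) - w t) (w' (-(T / 2) + T) - w' (-(T / 2)))
          (-(T / 2)) := ((hdw (-(T / 2) + T)).comp_add_const _ T).sub (hdw _)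
      rw [h1.deriv, show -(T / 2) + T = T / 2 by ring, ← hdeq, deriv_neg_of_even heven, hdeq, hw'0]
      simp
  refine ⟨w, hsol, heven, hper, ?_⟩
  have hM0 : 0 ≤ M := (abs_nonneg _).trans (hM 0)
  have hAb : ∀ t, 0 ≤ t → t ≤ T → |A t| ≤ M * T := fun t h0 h1 => by
    have := intervalIntegral.norm_integral_le_of_norm_le_const (a := 0) (b := t) (C := M)
      (f := fun s => Real.cos s * F s) (fun s _ => by
        rw [norm_mul]
        exact (mul_le_of_le_one_left (norm_nonneg _) (Real.abs_cos_le_one s)).trans (hM s))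
    rw [sub_zero, abs_of_nonneg h0] at this
    exact this.trans (mul_le_mul_of_nonneg_left h1 hM0)
  have hBb : ∀ t, 0 ≤ t → t ≤ T → |B t| ≤ M * T := fun t h0 h1 => by
    have := intervalIntegral.norm_integral_le_of_norm_le_const (a := 0) (b := t) (C := M)
      (f := fun s => Real.sin s * F s) (fun s _ => by
        rw [norm_mul]
        exact (mul_le_of_le_one_left (norm_nonneg _) (Real.abs_sin_le_one s)).trans (hM s))
    rw [sub_zero, abs_of_nonneg h0] at this
    exact this.trans (mul_le_mul_of_nonneg_left h1 hM0)
  have hmul : ∀ {x y : ℝ}, |x| ≤ 1 → |y| ≤ M * T → |x * y| ≤ M * T := fun {x y} hx hy => by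
    rw [abs_mul]
    exact (mul_le_of_le_one_left (abs_nonneg _) hx).trans hy
  have hcb : |c| ≤ 2 * (M * T) / |Real.sin (T / 2)| := by
    rw [hc, abs_div]
    gcongr
    refine (abs_add_le _ _).trans ?_
    have h1 := hmul (Real.abs_cos_le_one (T / 2)) (hAb (T / 2) (by linarith) (by linarith))
    have h2 := hmul (Real.abs_sin_le_one (T / 2)) (hBb (T / 2) (by linarith) (by linarith))
    linarith
  intro t
  obtain ⟨y, hy, hty⟩ := (show Function.Periodic w T from hper).exists_mem_Ico₀ hT t
  rw [hty]
  have h1 := hmul (Real.abs_sin_le_one y) (hAb y hy.1 hy.2.le)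
  have h2 := hmul (Real.abs_cos_le_one y) (hBb y hy.1 hy.2.le)
  have h3 : |c * Real.cos y| ≤ |c| := by
    rw [abs_mul]
    exact mul_le_of_le_one_right (abs_nonneg _) (Real.abs_cos_le_one y)
  calc |w y| ≤ |Real.sin y * A y| + |Real.cos y * B y| + |c * Real.cos y| :=
        (abs_add_le _ _).trans (add_le_add_left (abs_sub _ _) _)
    _ ≤ M * T + M * T + 2 * (M * T) / |Real.sin (T / 2)| := by linarith
    _ = _ := by ring

theorem exists_continuousMap_of_periodic {T : ℝ} {g : ℝ → ℝ} (hg : Continuous g)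
    (hp : ∀ t, g (t + T) = g t) : ∃ G : C(AddCircle T, ℝ), ∀ t : ℝ, G t = g t :=
  ⟨⟨(show Function.Periodic g T from hp).lift, continuous_coinduced_dom.2 hg⟩, fun _ => rfl⟩

variable {T : ℝ} [Fact (0 < T)]

/-- `K` inverts `L₀ = ∂² + 1` on even periodic functions: for even continuous `f`, the equation
`w'' + w = f` has the only solution `w = K f`. -/
def IsL0Inverse (K : C(AddCircle T, ℝ) →L[ℝ] H2e T) : Prop :=
  ∀ f : C(AddCircle T, ℝ), (∀ t, f (-t) = f t) → ∀ w : H2e T,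
    HasSecondDeriv (onReal w) (fun t => f t - onReal w t) ↔ w = K f

theorem eq_of_hasSecondDeriv_sub (hs : Real.sin (T / 2) ≠ 0) {F : ℝ → ℝ} {v w : H2e T}
    (hv : HasSecondDeriv (onReal v) (fun t => F t - onReal v t))
    (hw : HasSecondDeriv (onReal w) (fun t => F t - onReal w t)) : v = w := by
  set d : ℝ → ℝ := fun t => onReal v t - onReal w t with hd
  have hd2 : HasSecondDeriv d (fun t => -d t) := by
    refine HasSecondDeriv.of_hasDerivAt (fun t => (hv.hasDerivAt t).sub (hw.hasDerivAt t))
      (fun t => ((hv.2 t).sub (hw.2 t)).congr_deriv ?_)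
    simp only [hd]
    ring
  have heven : ∀ t, d (-t) = d t := fun t => by simp only [hd, onReal_neg]
  have hper : ∀ t, d (t + T) = d t := fun t => by simp only [hd, onReal_add_period]
  have hd'0 : deriv d 0 = 0 := by
    have := deriv_neg_of_even heven 0
    rw [neg_zero] at this
    linarith
  -- `d - d(0) cos` solves `z'' + z = 0` with vanishing Cauchy data at `0`
  have hcos : ∀ t, d t = d 0 * Real.cos t := by
    have hz1 : ∀ t, HasDerivAt (fun t => d t - d 0 * Real.cos t) (deriv d t + d 0 * Real.sin t) t :=
      fun t => ((hd2.hasDerivAt t).sub ((Real.hasDerivAt_cos t).const_mul _)).congr_deriv (by ring)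
    have hz : HasSecondDeriv (fun t => d t - d 0 * Real.cos t)
        (fun t => -(d t - d 0 * Real.cos t)) := by
      refine HasSecondDeriv.of_hasDerivAt hz1 (fun t => ?_)
      exact ((hd2.2 t).add ((Real.hasDerivAt_sin t).const_mul _)).congr_deriv (by ring)
    intro t
    have := hz.eq_zero (K := 1) (t₀ := 0) (fun t => by rw [abs_neg, one_mul]) (by simp) (by
      rw [(hz1 0).deriv, hd'0]; simp) t
    linarith
  have h1 := deriv_half_period_eq_zero heven hper
  have h2 : HasDerivAt d (d 0 * -Real.sin (T / 2)) (T / 2) :=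
    ((Real.hasDerivAt_cos _).const_mul _).congr_of_eventuallyEq (.of_forall hcos)
  rw [h2.deriv] at h1
  have h0 : d 0 = 0 := by simpa [hs] using h1
  apply onReal_injective
  funext t
  have := hcos t
  rw [h0, zero_mul] at this
  simp only [hd] at this
  linarith

theorem exists_isL0Inverse (hs : Real.sin (T / 2) ≠ 0) :
    ∃ K : C(AddCircle T, ℝ) →L[ℝ] H2e T, IsL0Inverse K := by
  have hT : (0 : ℝ) < T := Fact.out
  set C : ℝ := 2 * T + 2 * T / |Real.sin (T / 2)| with hC
  have hC0 : 0 ≤ C := by positivity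
  set D : ℝ := (T / (2 * Real.pi)) ^ 2 with hD
  have hD0 : 0 ≤ D := by positivity
  -- solve for the even part of the right-hand side, to obtain a map on all continuous functions
  have hex : ∀ f : C(AddCircle T, ℝ), ∃ w : H2e T,
      HasSecondDeriv (onReal w) (fun t : ℝ => (f t + f (-t : ℝ)) / 2 - onReal w t) ∧
        ‖w‖ ≤ (C + D * (1 + C)) * ‖f‖ := by
    intro f
    have hcf : Continuous fun t : ℝ => f t := f.continuous.comp (AddCircle.continuous_mk' T)
    have hFc : Continuous fun t : ℝ => (f t + f (-t : ℝ)) / 2 :=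
      (hcf.add (hcf.comp continuous_neg)).div_const 2
    have hFp : ∀ t : ℝ, (f (t + T : ℝ) + f (-(t + T) : ℝ)) / 2 = (f t + f (-t : ℝ)) / 2 := fun t => by
      have h1 : ((t + T : ℝ) : AddCircle T) = t := by simp
      have h2 : ((-(t + T) : ℝ) : AddCircle T) = (-t : ℝ) := by simp
      rw [h1, h2]
    have hFb : ∀ t : ℝ, |(f t + f (-t : ℝ)) / 2| ≤ ‖f‖ := fun t => by
      have h1 := f.norm_coe_le_norm t
      have h2 := f.norm_coe_le_norm (-t : ℝ)
      rw [Real.norm_eq_abs] at h1 h2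
      rw [abs_div, abs_two]
      have := abs_add_le (f t) (f (-t : ℝ))
      linarith
    obtain ⟨w, hw, hwe, hwp, hwb⟩ := exists_even_periodic_solution hT hs hFc
      (fun t => by rw [neg_neg, add_comm]) hFp hFb
    obtain ⟨W, hW⟩ := exists_continuousMap_of_periodic (T := T)
      (continuous_iff_continuousAt.2 fun t => (hw.1 t).continuousAt) hwp
    obtain ⟨G, hG⟩ := exists_continuousMap_of_periodic (T := T) hFc hFp
    have hW' : (fun t : ℝ => W t) = w := funext hW
    have hq : HasSecondDeriv (fun t : ℝ => W t) (fun t : ℝ => (G - W) t) := by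
      have : (fun t : ℝ => (G - W) t) = fun t : ℝ => (f t + f (-t : ℝ)) / 2 - w t := by
        funext t
        rw [ContinuousMap.sub_apply, hG, hW]
      rw [this, hW']
      exact hw
    obtain ⟨u, hu, hun⟩ := exists_H2per_of_hasSecondDeriv W (G - W) hq
    have hue : u ∈ H2e T := by
      intro t
      obtain ⟨t, rfl⟩ := QuotientAddGroup.mk_surjective t
      rw [hu]
      exact (hW (-t)).trans ((hwe t).trans (hW t).symm)
    have hon : onReal (⟨u, hue⟩ : H2e T) = w := funext fun t => by
      change u.toC t = w t
      rw [hu, hW]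
    refine ⟨⟨u, hue⟩, by rw [hon]; exact hw, ?_⟩
    have hWn : ‖W‖ ≤ C * ‖f‖ := (ContinuousMap.norm_le _ (by positivity)).2 fun t => by
      obtain ⟨t, rfl⟩ := QuotientAddGroup.mk_surjective t
      exact (congrArg norm (hW t)).trans_le (hwb t)
    have hGn : ‖G‖ ≤ ‖f‖ := (ContinuousMap.norm_le _ (by positivity)).2 fun t => by
      obtain ⟨t, rfl⟩ := QuotientAddGroup.mk_surjective t
      exact (congrArg norm (hG t)).trans_le (hFb t)
    calc ‖u‖ ≤ ‖W - D • (G - W)‖ := hun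
      _ ≤ ‖W‖ + D * (‖G‖ + ‖W‖) := by
        refine (norm_sub_le _ _).trans ?_
        rw [norm_smul, Real.norm_of_nonneg hD0]
        gcongr
        exact norm_sub_le _ _
      _ ≤ C * ‖f‖ + D * (‖f‖ + C * ‖f‖) := by gcongr
      _ = _ := by ring
  choose K hK hKn using hex
  let L : C(AddCircle T, ℝ) →ₗ[ℝ] H2e T :=
    { toFun := K
      map_add' := fun f g => by
        refine eq_of_hasSecondDeriv_sub hs (hK (f + g)) ?_
        refine HasSecondDeriv.of_hasDerivAt
          (fun t => ((hK f).hasDerivAt t).add ((hK g).hasDerivAt t))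
          (fun t => (((hK f).2 t).add ((hK g).2 t)).congr_deriv ?_)
        change _ = _ - (onReal (K f) t + onReal (K g) t)
        simp only [ContinuousMap.add_apply]
        ring
      map_smul' := fun c f => by
        refine eq_of_hasSecondDeriv_sub hs (hK (c • f)) ?_
        refine HasSecondDeriv.of_hasDerivAt
          (fun t => ((hK f).hasDerivAt t).const_mul c)
          (fun t => (((hK f).2 t).const_mul c).congr_deriv ?_)
        change _ = _ - (c * onReal (K f) t)
        simp only [ContinuousMap.smul_apply, smul_eq_mul]
        ring }
  refine ⟨L.mkContinuous _ hKn, fun f hf w => ?_⟩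
  have hKf : HasSecondDeriv (onReal (K f)) (fun t : ℝ => f t - onReal (K f) t) := by
    have h : (fun t : ℝ => f t - onReal (K f) t) =
        fun t : ℝ => (f t + f (-t : ℝ)) / 2 - onReal (K f) t := by
      funext t
      have h1 : f ((-t : ℝ) : AddCircle T) = f t := hf t
      rw [h1]
      ring
    rw [h]
    exact hK f
  constructor
  · intro hw
    exact eq_of_hasSecondDeriv_sub hs hw hKf
  · rintro rfl
    exact hKf

/-- Fredholm alternative for `1 + L₀⁻¹ b`, where `b` is an even coefficient: it is invertible as
soon as the equation `w'' + (1 + b) w = 0` has no nontrivial even periodic solution. -/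
theorem IsL0Inverse.exists_equiv {K : C(AddCircle T, ℝ) →L[ℝ] H2e T} (hK : IsL0Inverse K)
    (b : C(AddCircle T, ℝ)) (hb : ∀ t, b (-t) = b t)
    (hker : ∀ w : H2e T, HasSecondDeriv (onReal w) (fun t => -((1 + b t) * onReal w t)) → w = 0) :
    ∃ e : H2e T ≃L[ℝ] H2e T, ∀ h, e h = h + K (b * H2e.toCCLM T h) := by
  let S : H2e T →L[ℝ] H2e T :=
    -(K ∘L (ContinuousLinearMap.mul ℝ C(AddCircle T, ℝ) b) ∘L H2e.toCCLM T)
  have hSapp : ∀ h, S h = -K (b * H2e.toCCLM T h) := fun h => rfl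
  have hS : IsCompactOperator S := by
    refine IsCompactOperator.neg ?_
    exact ((H2e.isCompactOperator_toCCLM (T := T)).clm_comp
      (ContinuousLinearMap.mul ℝ C(AddCircle T, ℝ) b)).clm_comp K
  have hne : ¬ Module.End.HasEigenvalue (S : Module.End ℝ (H2e T)) 1 := by
    intro h
    obtain ⟨w, hw⟩ := h.exists_hasEigenvector
    refine hw.2 (hker w ?_)
    have h1 : S w = w := by simpa using hw.apply_eq_smul
    have h2 : w = K (-(b * H2e.toCCLM T w)) := by
      rw [map_neg, ← hSapp, h1]
    have h3 := (hK (-(b * H2e.toCCLM T w)) (fun t => ?_) w).2 h2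
    · convert! h3 using 2 with t
      rw [ContinuousMap.neg_apply, ContinuousMap.mul_apply, H2e.toCCLM_apply_coe]
      ring
    · rw [ContinuousMap.neg_apply, ContinuousMap.neg_apply, ContinuousMap.mul_apply,
        ContinuousMap.mul_apply, hb, H2e.toCCLM_neg]
  have hunit : IsUnit (1 - S) := by
    have := (hS.hasEigenvalue_or_mem_resolventSet one_ne_zero).resolve_left hne
    rw [spectrum.mem_resolventSet_iff, map_one] at this
    exact this
  obtain ⟨U, hU⟩ := hunit
  refine ⟨ContinuousLinearEquiv.unitsEquiv ℝ (H2e T) U, fun h => ?_⟩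
  change (U : H2e T →L[ℝ] H2e T) h = _
  rw [hU]
  change h - S h = _
  rw [hSapp, sub_neg_eq_add]

end Resolvent

/-! ### Superposition operators -/

section Superposition

theorem ContDiff.infty_deriv {g : ℝ → ℝ} (hg : ContDiff ℝ ∞ g) : ContDiff ℝ ∞ (deriv g) :=
  (contDiff_infty_iff_deriv.1 hg).2

theorem ContDiff.exists_abs_le {g : ℝ → ℝ} (hg : ContDiff ℝ ∞ g) (R : ℝ) :
    ∃ M > 0, ∀ x, |x| ≤ R → |g x| ≤ M := by
  obtain ⟨M, hM⟩ := (isCompact_Icc (a := -R) (b := R)).exists_bound_of_continuousOn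
    hg.continuous.continuousOn
  exact ⟨max M 1, by positivity, fun x hx => (hM x (abs_le.1 hx)).trans (le_max_left _ _)⟩

theorem ContDiff.exists_abs_sub_le {g : ℝ → ℝ} (hg : ContDiff ℝ ∞ g) (R : ℝ) :
    ∃ M > 0, ∀ x y, |x| ≤ R → |y| ≤ R → |g x - g y| ≤ M * |x - y| := by
  obtain ⟨M, hM0, hM⟩ := hg.infty_deriv.exists_abs_le R
  refine ⟨M, hM0, fun x y hx hy => ?_⟩
  exact (convex_Icc (-R) R).norm_image_sub_le_of_norm_deriv_le
    (fun z _ => (hg.differentiable (by simp)) z) (fun z hz => hM z (abs_le.2 hz))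
    (abs_le.1 hy) (abs_le.1 hx)

/-- The first order Taylor estimate, uniform on bounded sets. -/
theorem ContDiff.exists_abs_sub_sub_le {g : ℝ → ℝ} (hg : ContDiff ℝ ∞ g) (R : ℝ) :
    ∃ M > 0, ∀ x h, |x| ≤ R → |x + h| ≤ R → |g (x + h) - g x - deriv g x * h| ≤ M * |h| ^ 2 := by
  obtain ⟨M, hM0, hM⟩ := hg.infty_deriv.exists_abs_sub_le R
  refine ⟨M, hM0, fun x h hx hh => ?_⟩
  have hd : ∀ z, HasDerivAt (fun z => g z - deriv g x * z) (deriv g z - deriv g x) z := fun z => by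
    simpa using! ((hg.differentiable (by simp)) z).hasDerivAt.sub
      ((hasDerivAt_id z).const_mul (deriv g x))
  have hseg : ∀ z ∈ Set.uIcc x (x + h), |z| ≤ R ∧ |z - x| ≤ |h| := fun z hz => by
    refine ⟨abs_le.2 ((Set.uIcc_subset_Icc (abs_le.1 hx) (abs_le.1 hh)) hz), ?_⟩
    simpa using Set.abs_sub_left_of_mem_uIcc hz
  have := (convex_uIcc x (x + h)).norm_image_sub_le_of_norm_hasDerivWithin_le (C := M * |h|)
    (fun z _ => (hd z).hasDerivWithinAt) (fun z hz => ?_) Set.left_mem_uIcc Set.right_mem_uIcc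
  · simp only [Real.norm_eq_abs, add_sub_cancel_left] at this
    calc |g (x + h) - g x - deriv g x * h|
        = |g (x + h) - deriv g x * (x + h) - (g x - deriv g x * x)| := by congr 1; ring
      _ ≤ M * |h| * |h| := this
      _ = M * |h| ^ 2 := by ring
  · exact (hM z x (hseg z hz).1 hx).trans (mul_le_mul_of_nonneg_left (hseg z hz).2 hM0.le)

variable {S : Type*} [TopologicalSpace S]

/-- The superposition operator `a ↦ g ∘ a` on continuous functions. -/
def superpose {g : ℝ → ℝ} (hg : ContDiff ℝ ∞ g) (a : C(S, ℝ)) : C(S, ℝ) :=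
  (⟨g, hg.continuous⟩ : C(ℝ, ℝ)).comp a

theorem superpose_apply {g : ℝ → ℝ} (hg : ContDiff ℝ ∞ g) (a : C(S, ℝ)) (t : S) :
    superpose hg a t = g (a t) := rfl

theorem superpose_neg_of_odd {g : ℝ → ℝ} (hg : ContDiff ℝ ∞ g) (ho : ∀ x, g (-x) = -g x)
    (a : C(S, ℝ)) : superpose hg (-a) = -superpose hg a := by
  ext t
  exact ho (a t)

theorem superpose_zero {g : ℝ → ℝ} (hg : ContDiff ℝ ∞ g) (h0 : g 0 = 0) :
    superpose hg (0 : C(S, ℝ)) = 0 := by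
  ext t
  exact h0

variable [CompactSpace S] {ι : Type*}

theorem exists_norm_superpose_le {g : ℝ → ℝ} (hg : ContDiff ℝ ∞ g) (R : ℝ) :
    ∃ M > 0, ∀ a : C(S, ℝ), ‖a‖ ≤ R → ‖superpose hg a‖ ≤ M := by
  obtain ⟨M, hM0, hM⟩ := hg.exists_abs_le R
  exact ⟨M, hM0, fun a ha => (ContinuousMap.norm_le _ hM0.le).2 fun t =>
    hM _ ((a.norm_coe_le_norm t).trans ha)⟩

theorem exists_norm_superpose_sub_le {g : ℝ → ℝ} (hg : ContDiff ℝ ∞ g) (R : ℝ) :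
    ∃ M > 0, ∀ a b : C(S, ℝ), ‖a‖ ≤ R → ‖b‖ ≤ R →
      ‖superpose hg a - superpose hg b‖ ≤ M * ‖a - b‖ := by
  obtain ⟨M, hM0, hM⟩ := hg.exists_abs_sub_le R
  refine ⟨M, hM0, fun a b ha hb => (ContinuousMap.norm_le _ (by positivity)).2 fun t => ?_⟩
  refine (hM _ _ ((a.norm_coe_le_norm t).trans ha) ((b.norm_coe_le_norm t).trans hb)).trans ?_
  gcongr
  exact (a - b).norm_coe_le_norm t

theorem exists_norm_superpose_sub_sub_le {g : ℝ → ℝ} (hg : ContDiff ℝ ∞ g) (R : ℝ) :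
    ∃ M > 0, ∀ a b : C(S, ℝ), ‖a‖ ≤ R → ‖a + b‖ ≤ R →
      ‖superpose hg (a + b) - superpose hg a - superpose hg.infty_deriv a * b‖ ≤ M * ‖b‖ ^ 2 := by
  obtain ⟨M, hM0, hM⟩ := hg.exists_abs_sub_sub_le R
  refine ⟨M, hM0, fun a b ha hb => (ContinuousMap.norm_le _ (by positivity)).2 fun t => ?_⟩
  refine (hM _ _ ((a.norm_coe_le_norm t).trans ha)
    (((a + b).norm_coe_le_norm t).trans hb)).trans ?_
  gcongr
  exact b.norm_coe_le_norm t

/-- The superposition operator on bounded families of continuous functions. -/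
noncomputable def superposeInfty {g : ℝ → ℝ} (hg : ContDiff ℝ ∞ g)
    (u : lp (fun _ : ι => C(S, ℝ)) ⊤) : lp (fun _ : ι => C(S, ℝ)) ⊤ :=
  ⟨fun n => superpose hg (u n), by
    obtain ⟨M, -, hM⟩ := exists_norm_superpose_le (S := S) hg ‖u‖
    refine memℓp_infty ⟨M, ?_⟩
    rintro _ ⟨n, rfl⟩
    exact hM _ (lp.norm_apply_le_norm (by simp) u n)⟩

theorem hasFDerivAt_superposeInfty {g : ℝ → ℝ} (hg : ContDiff ℝ ∞ g)
    (u : lp (fun _ : ι => C(S, ℝ)) ⊤) :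
    HasFDerivAt (superposeInfty hg)
      (ContinuousLinearMap.mul ℝ (lp (fun _ : ι => C(S, ℝ)) ⊤)
        (superposeInfty hg.infty_deriv u)) u := by
  obtain ⟨M, hM0, hM⟩ := exists_norm_superpose_sub_sub_le (S := S) hg (‖u‖ + 1)
  rw [hasFDerivAt_iff_isLittleO_nhds_zero]
  refine IsBigO.trans_isLittleO ?_ (isLittleO_norm_pow_id one_lt_two)
  refine IsBigO.of_bound M ?_
  filter_upwards [Metric.closedBall_mem_nhds (0 : lp (fun _ : ι => C(S, ℝ)) ⊤) one_pos] with h hh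
  rw [mem_closedBall_zero_iff] at hh
  rw [Real.norm_of_nonneg (by positivity)]
  refine lp.norm_le_of_forall_le (by positivity) fun n => ?_
  have hu := lp.norm_apply_le_norm (by simp) u n
  have hh' := lp.norm_apply_le_norm (by simp) h n
  refine (hM (u n) (h n) (by linarith) ((norm_add_le _ _).trans (by linarith))).trans ?_
  gcongr

theorem contDiff_superposeInfty {g : ℝ → ℝ} (hg : ContDiff ℝ ∞ g) :
    ContDiff ℝ ∞ (superposeInfty (S := S) (ι := ι) hg) := by
  rw [contDiff_infty]
  intro n
  induction n generalizing g with
  | zero =>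
    refine contDiff_zero.2 (continuous_iff_continuousAt.2 fun u => ?_)
    exact (hasFDerivAt_superposeInfty hg u).continuousAt
  | succ n ih =>
    refine contDiff_succ_iff_hasFDerivAt.2 ⟨_, ?_, hasFDerivAt_superposeInfty hg⟩
    exact (ContinuousLinearMap.mul ℝ (lp (fun _ : ι => C(S, ℝ)) ⊤)).contDiff.comp
      (ih hg.infty_deriv)

end Superposition

/-! ### The nonlinear operator on square summable sequences -/

section LatticeNonlinearity

theorem lp_norm_le_mul {ι : Type*} {E F : ι → Type*} [∀ i, NormedAddCommGroup (E i)]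
    [∀ i, NormedAddCommGroup (F i)] [∀ i, NormedSpace ℝ (F i)]
    (f : lp E 2) (h : lp F 2) {C : ℝ} (hC : 0 ≤ C) (hf : ∀ n, ‖f n‖ ≤ C * ‖h n‖) :
    ‖f‖ ≤ C * ‖h‖ := by
  have h1 : ‖f‖ ≤ ‖C • h‖ := lp.norm_mono (by norm_num) fun n => by
    rw [lp.coeFn_smul, Pi.smul_apply, norm_smul, Real.norm_of_nonneg hC]
    exact hf n
  rwa [norm_smul, Real.norm_of_nonneg hC] at h1

theorem lp_norm_apply_le {ι : Type*} {E : ι → Type*} [∀ i, NormedAddCommGroup (E i)]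
    (u : lp E 2) (n : ι) : ‖u n‖ ≤ ‖u‖ :=
  lp.norm_apply_le_norm (by norm_num) u n

theorem memℓp_two_of_norm_le {ι : Type*} {E F : ι → Type*} [∀ i, NormedAddCommGroup (E i)]
    [∀ i, NormedAddCommGroup (F i)] (h : lp F 2) {f : ∀ i, E i} {C : ℝ}
    (hf : ∀ n, ‖f n‖ ≤ C * ‖h n‖) : Memℓp f 2 := by
  refine (((lp.memℓp h).norm.const_mul C).mono fun n => ?_).of_norm
  rw [norm_norm]
  exact hf n

variable {S : Type*} [TopologicalSpace S] [CompactSpace S] {ι : Type*}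
  {E : Type*} [NormedAddCommGroup E] [NormedSpace ℝ E]

theorem exists_norm_superpose_le_mul {g : ℝ → ℝ} (hg : ContDiff ℝ ∞ g) (h0 : g 0 = 0) (R : ℝ) :
    ∃ M > 0, ∀ a : C(S, ℝ), ‖a‖ ≤ R → ‖superpose hg a‖ ≤ M * ‖a‖ := by
  obtain ⟨M, hM0, hM⟩ := exists_norm_superpose_sub_le (S := S) hg (max R 0)
  refine ⟨M, hM0, fun a ha => ?_⟩
  have := hM a 0 (ha.trans (le_max_left _ _)) (by simp)
  have h2 : superpose hg (0 : C(S, ℝ)) = 0 := by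
    ext t
    exact h0
  rwa [h2, sub_zero, sub_zero] at this

/-- The operator `u ↦ (K (g ∘ j u_n))_n` on square summable sequences, for `g(0) = 0`. -/
noncomputable def latticeSuperpose (j : E →L[ℝ] C(S, ℝ)) (K : C(S, ℝ) →L[ℝ] E) {g : ℝ → ℝ}
    (hg : ContDiff ℝ ∞ g) (h0 : g 0 = 0) (u : lp (fun _ : ι => E) 2) : lp (fun _ : ι => E) 2 :=
  ⟨fun n => K (superpose hg (j (u n))), by
    obtain ⟨M, hM0, hM⟩ := exists_norm_superpose_le_mul (S := S) hg h0 (‖j‖ * ‖u‖)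
    refine memℓp_two_of_norm_le (C := ‖K‖ * (M * ‖j‖)) u fun n => ?_
    have h1 : ‖j (u n)‖ ≤ ‖j‖ * ‖u n‖ := j.le_opNorm _
    calc ‖K (superpose hg (j (u n)))‖ ≤ ‖K‖ * ‖superpose hg (j (u n))‖ := K.le_opNorm _
      _ ≤ ‖K‖ * (M * (‖j‖ * ‖u n‖)) := by
        gcongr
        refine (hM _ (h1.trans ?_)).trans ?_
        · gcongr
          exact lp_norm_apply_le u n
        · gcongr
      _ = _ := by ring⟩

/-- The bounded family `(j u_n)_n` of continuous functions. -/
noncomputable def lpToInfty (j : E →L[ℝ] C(S, ℝ)) :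
    lp (fun _ : ι => E) 2 →L[ℝ] lp (fun _ : ι => C(S, ℝ)) ⊤ :=
  (lp.linearMapOfLE ℝ (fun _ : ι => C(S, ℝ)) le_top).mkContinuous 1 (fun f => by
      rw [one_mul]
      exact lp.norm_le_of_forall_le (norm_nonneg _) fun n => lp_norm_apply_le f n) ∘L
    lp.mapCLM 2 (fun _ : ι => j) (norm_nonneg j) (fun _ => le_rfl)

/-- The bilinear operator `(m, h) ↦ (K (m_n · j h_n))_n`. -/
noncomputable def latticeMul (ι : Type*) (j : E →L[ℝ] C(S, ℝ)) (K : C(S, ℝ) →L[ℝ] E) :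
    lp (fun _ : ι => C(S, ℝ)) ⊤ →L[ℝ] lp (fun _ : ι => E) 2 →L[ℝ] lp (fun _ : ι => E) 2 :=
  lp.holderL 2 (fun _ : ι => (ContinuousLinearMap.compL ℝ E C(S, ℝ) E K) ∘L
      ((ContinuousLinearMap.compL ℝ E C(S, ℝ) C(S, ℝ)).flip j) ∘L
      (ContinuousLinearMap.mul ℝ C(S, ℝ)))
    (K := ‖(ContinuousLinearMap.compL ℝ E C(S, ℝ) E K) ∘L
      ((ContinuousLinearMap.compL ℝ E C(S, ℝ) C(S, ℝ)).flip j) ∘L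
      (ContinuousLinearMap.mul ℝ C(S, ℝ))‖₊) (fun _ => le_rfl)

theorem hasFDerivAt_latticeSuperpose (j : E →L[ℝ] C(S, ℝ)) (K : C(S, ℝ) →L[ℝ] E) {g : ℝ → ℝ}
    (hg : ContDiff ℝ ∞ g) (h0 : g 0 = 0) (u : lp (fun _ : ι => E) 2) :
    HasFDerivAt (latticeSuperpose j K hg h0)
      (latticeMul ι j K (superposeInfty hg.infty_deriv (lpToInfty j u))) u := by
  obtain ⟨M, hM0, hM⟩ := exists_norm_superpose_sub_sub_le (S := S) hg (‖j‖ * (‖u‖ + 1))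
  rw [hasFDerivAt_iff_isLittleO_nhds_zero]
  refine IsBigO.trans_isLittleO ?_ (isLittleO_norm_pow_id one_lt_two)
  refine IsBigO.of_bound (‖K‖ * (M * ‖j‖ ^ 2)) ?_
  filter_upwards [Metric.closedBall_mem_nhds (0 : lp (fun _ : ι => E) 2) one_pos] with h hh
  rw [mem_closedBall_zero_iff] at hh
  rw [Real.norm_of_nonneg (by positivity)]
  have key : ∀ n, ‖(latticeSuperpose j K hg h0 (u + h) - latticeSuperpose j K hg h0 u -
      latticeMul ι j K (superposeInfty hg.infty_deriv (lpToInfty j u)) h) n‖ ≤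
      ‖K‖ * (M * ‖j‖ ^ 2) * ‖h‖ * ‖h n‖ := fun n => by
    have h1 : ‖j (h n)‖ ≤ ‖j‖ * ‖h n‖ := j.le_opNorm _
    have h2 : ‖j (u n)‖ ≤ ‖j‖ * ‖u n‖ := j.le_opNorm _
    have hun := lp_norm_apply_le u n
    have hhn := lp_norm_apply_le h n
    have e : (latticeSuperpose j K hg h0 (u + h) - latticeSuperpose j K hg h0 u -
        latticeMul ι j K (superposeInfty hg.infty_deriv (lpToInfty j u)) h) n =
        K (superpose hg (j (u n) + j (h n)) - superpose hg (j (u n)) -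
          superpose hg.infty_deriv (j (u n)) * j (h n)) := by
      rw [map_sub, map_sub, ← map_add]
      rfl
    rw [e]
    refine (K.le_opNorm _).trans ?_
    have h3 := hM (j (u n)) (j (h n)) (h2.trans (by gcongr; linarith))
      ((norm_add_le _ _).trans (by
        calc ‖j (u n)‖ + ‖j (h n)‖ ≤ ‖j‖ * ‖u n‖ + ‖j‖ * ‖h n‖ := add_le_add h2 h1
          _ = ‖j‖ * (‖u n‖ + ‖h n‖) := by ring
          _ ≤ ‖j‖ * (‖u‖ + 1) := by gcongr; linarith))
    calc ‖K‖ * _ ≤ ‖K‖ * (M * (‖j‖ * ‖h n‖) ^ 2) := by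
          gcongr
          refine h3.trans ?_
          gcongr
      _ = ‖K‖ * (M * ‖j‖ ^ 2) * ‖h n‖ * ‖h n‖ := by ring
      _ ≤ _ := by gcongr
  refine (lp_norm_le_mul _ h (by positivity) key).trans (le_of_eq (by ring))

theorem contDiff_latticeSuperpose (j : E →L[ℝ] C(S, ℝ)) (K : C(S, ℝ) →L[ℝ] E) {g : ℝ → ℝ}
    (hg : ContDiff ℝ ∞ g) (h0 : g 0 = 0) :
    ContDiff ℝ ∞ (latticeSuperpose (ι := ι) j K hg h0) := by
  rw [contDiff_infty_iff_fderiv]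
  refine ⟨fun u => (hasFDerivAt_latticeSuperpose j K hg h0 u).differentiableAt, ?_⟩
  have h : fderiv ℝ (latticeSuperpose (ι := ι) j K hg h0) =
      fun u => latticeMul ι j K (superposeInfty hg.infty_deriv (lpToInfty j u)) :=
    funext fun u => (hasFDerivAt_latticeSuperpose j K hg h0 u).fderiv
  rw [h]
  exact (latticeMul ι j K).contDiff.comp
    ((contDiff_superposeInfty hg.infty_deriv).comp (lpToInfty j).contDiff)

end LatticeNonlinearity

/-! ### A quantitative implicit function theorem -/

section Implicit

/-- The implicit function theorem for `G(ε, v) = 0` near a nondegenerate solution `(0, u₀)`: there is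
a smooth branch `U` of solutions, and near `u₀` the distance to the branch is controlled by the
residual `G(ε, v)`. In particular the branch contains all solutions near `(0, u₀)`. -/
theorem exists_smooth_branch {X : Type*} [NormedAddCommGroup X] [NormedSpace ℝ X] [CompleteSpace X]
    {G : ℝ × X → X} (hG : ContDiff ℝ ∞ G) {u₀ : X} (h0 : G (0, u₀) = 0) (D : X ≃L[ℝ] X)
    (hD : HasFDerivAt (fun v => G (0, v)) (D : X →L[ℝ] X) u₀) :
    ∃ δ > 0, ∃ r > 0, ∃ C > 0, ∃ U : ℝ → X, U 0 = u₀ ∧ ContDiffOn ℝ ∞ U (Set.Ioo (-δ) δ) ∧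
      ∀ ε, |ε| < δ → G (ε, U ε) = 0 ∧ ∀ v, ‖v - u₀‖ < r → ‖v - U ε‖ ≤ C * ‖G (ε, v)‖ := by
  set Ψ : ℝ × X → ℝ × X := fun p => (p.1, G p) with hΨ
  have hΨc : ContDiff ℝ ∞ Ψ := contDiff_fst.prodMk hG
  set G' : ℝ × X →L[ℝ] X := fderiv ℝ G (0, u₀) with hG'
  have hGd : HasFDerivAt G G' (0, u₀) := (hG.differentiable (by simp) _).hasFDerivAt
  have hGD : G' ∘L ContinuousLinearMap.inr ℝ ℝ X = D := by
    have h1 : HasFDerivAt (fun v : X => ((0 : ℝ), v)) (ContinuousLinearMap.inr ℝ ℝ X) u₀ :=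
      (hasFDerivAt_const (0 : ℝ) u₀).prodMk (hasFDerivAt_id u₀)
    exact (HasFDerivAt.comp u₀ hGd h1).unique hD
  set Ψ' : (ℝ × X) ≃L[ℝ] (ℝ × X) := ContinuousLinearEquiv.skewProd
    (ContinuousLinearEquiv.refl ℝ ℝ) D (G' ∘L ContinuousLinearMap.inl ℝ ℝ X) with hΨ'
  have hΨd : HasFDerivAt Ψ (Ψ' : (ℝ × X) →L[ℝ] (ℝ × X)) (0, u₀) := by
    refine (hasFDerivAt_fst.prodMk hGd).congr_fderiv ?_
    ext p
    · simp [hΨ']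
    · simp [hΨ']
    · simp [hΨ']
    · have := DFunLike.congr_fun hGD p
      simpa [hΨ', Prod.mk_zero_zero] using this
  have hΨs : HasStrictFDerivAt Ψ (Ψ' : (ℝ × X) →L[ℝ] (ℝ × X)) (0, u₀) :=
    hΨc.contDiffAt.hasStrictFDerivAt' hΨd (by simp)
  set H := hΨs.toOpenPartialHomeomorph Ψ with hH
  have hHc : ∀ p, H p = Ψ p := fun p => rfl
  have hsrc : ((0 : ℝ), u₀) ∈ H.source := hΨs.mem_toOpenPartialHomeomorph_source
  have hΨ0 : Ψ (0, u₀) = (0, 0) := by simp [hΨ, h0]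
  have htgt : ((0 : ℝ), (0 : X)) ∈ H.target := hΨ0 ▸ H.map_source hsrc
  have hsymm0 : H.symm (0, 0) = (0, u₀) := by
    have := H.left_inv hsrc
    rwa [hHc, hΨ0] at this
  have hsmooth : ∀ᶠ b in 𝓝 ((0 : ℝ), (0 : X)), ContDiffAt ℝ ∞ H.symm b := by
    have hcont : ContinuousAt (fun b => fderiv ℝ Ψ (H.symm b)) ((0 : ℝ), (0 : X)) :=
      (hΨc.continuous_fderiv (by simp)).continuousAt.comp (H.continuousAt_symm htgt)
    have hmem : ∀ᶠ b in 𝓝 ((0 : ℝ), (0 : X)), fderiv ℝ Ψ (H.symm b) ∈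
        Set.range ((↑) : ((ℝ × X) ≃L[ℝ] (ℝ × X)) → (ℝ × X) →L[ℝ] (ℝ × X)) := by
      refine hcont.eventually_mem ?_
      rw [hsymm0, hΨd.fderiv]
      exact ContinuousLinearEquiv.nhds Ψ'
    filter_upwards [hmem, H.open_target.mem_nhds htgt] with b hb hbt
    obtain ⟨e, he⟩ := hb
    refine H.contDiffAt_symm hbt (f₀' := e) ?_ hΨc.contDiffAt
    rw [he]
    exact (hΨc.differentiable (by simp) _).hasFDerivAt
  obtain ⟨L, W, hW, hLip⟩ := (hsmooth.self_of_nhds.of_le (m := 1) (by simp)).exists_lipschitzOnWith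
  have hline : Tendsto (fun ε : ℝ => (ε, (0 : X))) (𝓝 0) (𝓝 (0, 0)) :=
    (continuous_id.prodMk continuous_const).tendsto' _ _ rfl
  have hgood : ∀ᶠ b in 𝓝 ((0 : ℝ), (0 : X)), ContDiffAt ℝ ∞ H.symm b ∧ b ∈ W ∧ b ∈ H.target :=
    hsmooth.and (Filter.Eventually.and hW (H.open_target.mem_nhds htgt))
  have hnear : ∀ᶠ p in 𝓝 ((0 : ℝ), u₀), p ∈ H.source ∧ Ψ p ∈ W := by
    refine Filter.Eventually.and (H.open_source.mem_nhds hsrc)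
      (hΨc.continuous.continuousAt.eventually_mem ?_)
    rwa [hΨ0]
  obtain ⟨δ₁, hδ₁, hball⟩ := Metric.eventually_nhds_iff.1 (hline.eventually hgood)
  obtain ⟨δ₂, hδ₂, hball₂⟩ := Metric.eventually_nhds_iff.1 hnear
  have hin : ∀ {ε : ℝ}, |ε| < min δ₁ δ₂ → dist ε 0 < δ₁ := fun {ε} h => by
    rw [Real.dist_0_eq_abs]
    exact h.trans_le (min_le_left _ _)
  refine ⟨min δ₁ δ₂, lt_min hδ₁ hδ₂, δ₂, hδ₂, L + 1, by positivity,
    fun ε => (H.symm (ε, 0)).2, congrArg Prod.snd hsymm0, ?_, ?_⟩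
  · intro ε hε
    have h1 := (hball (hin (abs_lt.2 hε))).1
    have h2 : ContDiffAt ℝ ∞ (fun ε : ℝ => (ε, (0 : X))) ε := contDiffAt_id.prodMk contDiffAt_const
    exact (contDiffAt_snd.comp ε (h1.comp ε h2)).contDiffWithinAt
  · intro ε hε
    obtain ⟨-, hεW, hεt⟩ := hball (hin hε)
    have hr := H.right_inv hεt
    rw [hHc] at hr
    have hfst : (H.symm (ε, 0)).1 = ε := congrArg Prod.fst hr
    have heq : H.symm (ε, 0) = (ε, (H.symm (ε, 0)).2) := Prod.ext hfst rfl
    refine ⟨?_, fun v hv => ?_⟩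
    · have := congrArg Prod.snd hr
      rwa [heq] at this
    · have hp : dist (ε, v) ((0 : ℝ), u₀) < δ₂ := by
        rw [Prod.dist_eq, Real.dist_0_eq_abs, dist_eq_norm]
        exact max_lt (hε.trans_le (min_le_right _ _)) hv
      obtain ⟨hs, hw⟩ := hball₂ hp
      have hl := H.left_inv hs
      rw [hHc] at hl
      have h1 := hLip.dist_le_mul _ hw _ hεW
      rw [hl, heq, Prod.dist_eq, dist_eq_norm, Prod.dist_eq] at h1
      have h2 : ‖v - (H.symm (ε, 0)).2‖ ≤ L * max (dist ε ε) (dist (G (ε, v)) 0) := by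
        rw [← dist_eq_norm]
        exact (le_max_right _ _).trans h1
      rw [dist_self, dist_zero_right, max_eq_right (norm_nonneg _)] at h2
      exact h2.trans (mul_le_mul_of_nonneg_right (by linarith) (norm_nonneg _))

end Implicit

/-! ### The lattice equation as an operator equation -/

section KleinGordon

/-- An isomorphism of square summable sequences acting by one of two isomorphisms at each site. -/
theorem exists_lp_equiv {ι E : Type*} [NormedAddCommGroup E] [NormedSpace ℝ E] (p : ι → Prop)
    (e : E ≃L[ℝ] E) :
    ∃ D : lp (fun _ : ι => E) 2 ≃L[ℝ] lp (fun _ : ι => E) 2,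
      ∀ h n, (p n → D h n = h n) ∧ (¬ p n → D h n = e (h n)) := by
  classical
  let d : ι → (E ≃L[ℝ] E) := fun n => if p n then ContinuousLinearEquiv.refl ℝ E else e
  have hb : ∀ n, ‖(d n : E →L[ℝ] E)‖ ≤ 1 + ‖(e : E →L[ℝ] E)‖ := fun n => by
    by_cases hn : p n
    · simp only [d, hn, if_true]
      refine ContinuousLinearMap.norm_id_le.trans ?_
      linarith [norm_nonneg (e : E →L[ℝ] E)]
    · simp [d, hn]
  have hb' : ∀ n, ‖((d n).symm : E →L[ℝ] E)‖ ≤ 1 + ‖(e.symm : E →L[ℝ] E)‖ := fun n => by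
    by_cases hn : p n
    · simp only [d, hn, if_true]
      refine ContinuousLinearMap.norm_id_le.trans ?_
      linarith [norm_nonneg (e.symm : E →L[ℝ] E)]
    · simp [d, hn]
  refine ⟨ContinuousLinearEquiv.equivOfInverse
    (lp.mapCLM 2 (fun n => (d n : E →L[ℝ] E)) (by positivity) hb)
    (lp.mapCLM 2 (fun n => ((d n).symm : E →L[ℝ] E)) (by positivity) hb') (fun h => ?_)
    (fun h => ?_), fun h n => ⟨fun hn => ?_, fun hn => ?_⟩⟩
  · ext n
    exact (d n).symm_apply_apply (h n)
  · ext n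
    exact (d n).apply_symm_apply (h n)
  · change d n (h n) = _
    simp [d, hn]
  · change d n (h n) = _
    simp [d, hn]

variable {T : ℝ} [Fact (0 < T)]

theorem latticeShift_apply (j : ℤ) (u : LatticeSpace T) (n : ℤ) :
    latticeShift j u n = u (n - j) := rfl

theorem norm_latticeShift (j : ℤ) (u : LatticeSpace T) : ‖latticeShift j u‖ = ‖u‖ := by
  rw [lp.norm_eq_tsum_rpow (by norm_num), lp.norm_eq_tsum_rpow (by norm_num)]
  congr 1
  exact (Equiv.subRight j).tsum_eq (fun n => ‖u n‖ ^ (2 : ENNReal).toReal)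

/-- The shift as a continuous linear map. -/
noncomputable def latticeShiftCLM (T : ℝ) [Fact (0 < T)] (j : ℤ) :
    LatticeSpace T →L[ℝ] LatticeSpace T :=
  LinearMap.mkContinuous
    { toFun := latticeShift j
      map_add' := fun _ _ => rfl
      map_smul' := fun _ _ => rfl } 1
    (fun u => (norm_latticeShift j u).le.trans (one_mul _).symm.le)

/-- The operator `u ↦ (K (u_{n+1} - 2 u_n + u_{n-1}))_n`. -/
noncomputable def latticeLaplacian (K : C(AddCircle T, ℝ) →L[ℝ] H2e T) :
    LatticeSpace T →L[ℝ] LatticeSpace T :=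
  lp.mapCLM 2 (fun _ : ℤ => K ∘L H2e.toCCLM T) (norm_nonneg (K ∘L H2e.toCCLM T))
      (fun _ => le_rfl) ∘L
    (latticeShiftCLM T (-1) - (2 : ℝ) • ContinuousLinearMap.id ℝ _ + latticeShiftCLM T 1)

theorem latticeLaplacian_apply (K : C(AddCircle T, ℝ) →L[ℝ] H2e T) (u : LatticeSpace T) (n : ℤ) :
    latticeLaplacian K u n =
      K (H2e.toCCLM T (u (n + 1) - (2 : ℝ) • u n + u (n - 1))) := by
  change K (H2e.toCCLM T (u (n - -1) - (2 : ℝ) • u n + u (n - 1))) = _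
  rw [sub_neg_eq_add]

/-- The nonlinear part `V'(x) - x` of the force. -/
noncomputable def nonlinearForce (V : ℝ → ℝ) (x : ℝ) : ℝ := deriv V x - x

/-- The lattice equation after inversion of `L₀`: the map
`(ε, u) ↦ u + L₀⁻¹ (V'(u) - u) - ε L₀⁻¹ Δ u`. -/
noncomputable def kgMap {V : ℝ → ℝ} (K : C(AddCircle T, ℝ) →L[ℝ] H2e T)
    (hN : ContDiff ℝ ∞ (nonlinearForce V)) (h0 : nonlinearForce V 0 = 0)
    (p : ℝ × LatticeSpace T) : LatticeSpace T :=
  p.2 + latticeSuperpose (H2e.toCCLM T) K hN h0 p.2 - p.1 • latticeLaplacian K p.2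

variable {V : ℝ → ℝ} {K : C(AddCircle T, ℝ) →L[ℝ] H2e T}
  (hN : ContDiff ℝ ∞ (nonlinearForce V)) (h0 : nonlinearForce V 0 = 0)

theorem contDiff_kgMap : ContDiff ℝ ∞ (kgMap K hN h0) :=
  (contDiff_snd.add ((contDiff_latticeSuperpose _ K hN h0).comp contDiff_snd)).sub
    (contDiff_fst.smul ((latticeLaplacian K).contDiff.comp contDiff_snd))

theorem kgMap_apply (ε : ℝ) (u : LatticeSpace T) (n : ℤ) :
    kgMap K hN h0 (ε, u) n = u n + K (superpose hN (H2e.toCCLM T (u n))) -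
      ε • K (H2e.toCCLM T (u (n + 1) - (2 : ℝ) • u n + u (n - 1))) := by
  rw [← latticeLaplacian_apply]
  rfl

theorem superpose_toCCLM_neg {g : ℝ → ℝ} (hg : ContDiff ℝ ∞ g) (w : H2e T) (t : AddCircle T) :
    superpose hg (H2e.toCCLM T w) (-t) = superpose hg (H2e.toCCLM T w) t := by
  rw [superpose_apply, superpose_apply, H2e.toCCLM_neg]

theorem solvesKleinGordon_iff (hK : IsL0Inverse K) (ε : ℝ) (u : LatticeSpace T) :
    SolvesKleinGordon V ε u ↔ kgMap K hN h0 (ε, u) = 0 := by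
  have key : ∀ n : ℤ, HasSecondDeriv (onReal (u n)) (fun t =>
      ε * (onReal (u (n + 1)) t - 2 * onReal (u n) t + onReal (u (n - 1)) t) -
      deriv V (onReal (u n) t)) ↔ kgMap K hN h0 (ε, u) n = 0 := fun n => by
    set d : H2e T := u (n + 1) - (2 : ℝ) • u n + u (n - 1) with hd
    have h1 := hK (ε • H2e.toCCLM T d - superpose hN (H2e.toCCLM T (u n))) (fun t => by
      simp only [ContinuousMap.sub_apply, ContinuousMap.smul_apply, superpose_toCCLM_neg,
        H2e.toCCLM_neg]) (u n)
    have h2 : (fun t : ℝ => ε * (onReal (u (n + 1)) t - 2 * onReal (u n) t + onReal (u (n - 1)) t) -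
        deriv V (onReal (u n) t)) = fun t : ℝ => (ε • H2e.toCCLM T d -
          superpose hN (H2e.toCCLM T (u n))) t - onReal (u n) t := by
      funext t
      rw [ContinuousMap.sub_apply, ContinuousMap.smul_apply, superpose_apply,
        H2e.toCCLM_apply_coe, H2e.toCCLM_apply_coe, nonlinearForce]
      have h3 : onReal d t = onReal (u (n + 1)) t - 2 * onReal (u n) t + onReal (u (n - 1)) t := rfl
      rw [h3, smul_eq_mul]
      ring
    rw [h2, h1, kgMap_apply, map_sub, map_smul, ← hd, sub_eq_zero, eq_sub_iff_add_eq]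
  constructor
  · intro h
    ext1
    funext n
    exact (key n).1 (h n)
  · intro h n
    refine (key n).2 ?_
    rw [h]
    rfl

theorem solvesL0_iff (hK : IsL0Inverse K) (w f : H2e T) :
    SolvesL0 w f ↔ w = K (H2e.toCCLM T f) := by
  rw [← hK _ (H2e.toCCLM_neg f)]
  simp only [H2e.toCCLM_apply_coe]
  rfl

theorem deriv_nonlinearForce (hV : ContDiff ℝ ∞ V) (x : ℝ) :
    deriv (nonlinearForce V) x = deriv (deriv V) x - 1 := by
  have h := ((hV.infty_deriv.differentiable (by simp)) x).hasDerivAt.sub (hasDerivAt_id x)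
  exact h.deriv

theorem contDiff_nonlinearForce (hV : ContDiff ℝ ∞ V) : ContDiff ℝ ∞ (nonlinearForce V) :=
  hV.infty_deriv.sub contDiff_id

theorem solvesLe_iff (hV : ContDiff ℝ ∞ V) (hK : IsL0Inverse K) (φ w f : H2e T) :
    SolvesLe V φ w f ↔
      w + K (superpose hN.infty_deriv (H2e.toCCLM T φ) * H2e.toCCLM T w) = K (H2e.toCCLM T f) := by
  have h1 := hK (H2e.toCCLM T f - superpose hN.infty_deriv (H2e.toCCLM T φ) * H2e.toCCLM T w)
    (fun t => by
      simp only [ContinuousMap.sub_apply, ContinuousMap.mul_apply, superpose_toCCLM_neg,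
        H2e.toCCLM_neg]) w
  have h2 : (fun t => onReal f t - deriv (deriv V) (onReal φ t) * onReal w t) = fun t : ℝ =>
      (H2e.toCCLM T f - superpose hN.infty_deriv (H2e.toCCLM T φ) * H2e.toCCLM T w) t -
        onReal w t := by
    funext t
    rw [ContinuousMap.sub_apply, ContinuousMap.mul_apply, superpose_apply,
        H2e.toCCLM_apply_coe, H2e.toCCLM_apply_coe, H2e.toCCLM_apply_coe, deriv_nonlinearForce hV]
    ring
  rw [SolvesLe, h2, h1, map_sub, eq_sub_iff_add_eq]

/-- The linearisation of the lattice equation at `ε = 0` acts site by site: it is the identity at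
the sites at rest, and `L₀⁻¹ L_e` at the excited sites. -/
theorem exists_equiv_hasFDerivAt_kgMap {φ : H2e T} (e : H2e T ≃L[ℝ] H2e T)
    (he : ∀ h, e h = h + K (superpose hN.infty_deriv (H2e.toCCLM T φ) * H2e.toCCLM T h))
    (hodd : ∀ x, nonlinearForce V (-x) = -nonlinearForce V x)
    (hd0 : deriv (nonlinearForce V) 0 = 0) {u₀ : LatticeSpace T}
    (hu₀ : ∀ n, u₀ n = 0 ∨ u₀ n = φ ∨ u₀ n = -φ) :
    ∃ D : LatticeSpace T ≃L[ℝ] LatticeSpace T,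
      HasFDerivAt (fun v => kgMap K hN h0 (0, v)) (D : LatticeSpace T →L[ℝ] LatticeSpace T) u₀ := by
  obtain ⟨D, hD⟩ := exists_lp_equiv (fun n : ℤ => u₀ n = 0) e
  refine ⟨D, ?_⟩
  have h1 := (hasFDerivAt_id u₀).add (hasFDerivAt_latticeSuperpose (H2e.toCCLM T) K hN h0 u₀)
  have h2 : (fun v => kgMap K hN h0 (0, v)) =
      fun v => v + latticeSuperpose (H2e.toCCLM T) K hN h0 v := by
    funext v
    simp [kgMap]
  rw [h2]
  refine h1.congr_fderiv ?_
  have heven : ∀ x, deriv (nonlinearForce V) (-x) = deriv (nonlinearForce V) x := fun x => by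
    have h3 := deriv_comp_neg (nonlinearForce V) x
    rw [funext hodd, deriv.fun_neg] at h3
    linarith
  refine ContinuousLinearMap.ext fun h => ?_
  ext1
  funext n
  change h n + K (superpose hN.infty_deriv (H2e.toCCLM T (u₀ n)) * H2e.toCCLM T (h n)) = D h n
  by_cases hn : u₀ n = 0
  · rw [(hD h n).1 hn, hn, map_zero, superpose_zero _ hd0, zero_mul, map_zero, add_zero]
  · rw [(hD h n).2 hn, he]
    rcases (hu₀ n).resolve_left hn with h3 | h3
    · rw [h3]
    · have h4 : superpose hN.infty_deriv (H2e.toCCLM T (-φ)) =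
          superpose hN.infty_deriv (H2e.toCCLM T φ) := by
        rw [map_neg]
        ext t
        exact heven _
      rw [h3, h4]

theorem solvesOscillator_iff (hK : IsL0Inverse K) (φ : H2e T) :
    SolvesOscillator V φ ↔ φ + K (superpose hN (H2e.toCCLM T φ)) = 0 := by
  have h1 := hK (-superpose hN (H2e.toCCLM T φ)) (fun t => by
    simp only [ContinuousMap.neg_apply, superpose_toCCLM_neg]) φ
  have h2 : (fun t => -deriv V (onReal φ t)) = fun t : ℝ =>
      (-superpose hN (H2e.toCCLM T φ)) t - onReal φ t := by
    funext t
    rw [ContinuousMap.neg_apply, superpose_apply, H2e.toCCLM_apply_coe, nonlinearForce]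
    ring
  rw [SolvesOscillator, h2, h1, map_neg, eq_neg_iff_add_eq_zero]

theorem kgMap_zero_eq_zero {φ : H2e T} (hφ : φ + K (superpose hN (H2e.toCCLM T φ)) = 0)
    (hodd : ∀ x, nonlinearForce V (-x) = -nonlinearForce V x) {u₀ : LatticeSpace T}
    (hu₀ : ∀ n, u₀ n = 0 ∨ u₀ n = φ ∨ u₀ n = -φ) : kgMap K hN h0 (0, u₀) = 0 := by
  ext1
  funext n
  rw [kgMap_apply, zero_smul, sub_zero]
  change _ = (0 : H2e T)
  rcases hu₀ n with h | h | h
  · rw [h, map_zero, superpose_zero _ h0, map_zero, add_zero]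
  · rw [h, hφ]
  · rw [h, map_neg, superpose_neg_of_odd _ hodd, map_neg, ← neg_add, hφ, neg_zero]

end KleinGordon

/-! ### The period as a time of flight -/

section Period

theorem abs_inv_sub_one_le {ρ η : ℝ} (hρ : 0 ≤ ρ) (hη : η ≤ 1 / 2) (h : |ρ ^ 2 - 1| ≤ η) :
    |1 / ρ - 1| ≤ 2 * η := by
  obtain ⟨h1, h2⟩ := abs_le.1 h
  have hρ2 : 1 / 2 ≤ ρ ^ 2 := by linarith
  have hρ0 : 0 < ρ := lt_of_le_of_ne hρ fun h0 => by rw [← h0] at hρ2; norm_num at hρ2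
  have h3 : 1 / ρ - 1 = -(ρ ^ 2 - 1) / (ρ * (1 + ρ)) := by
    field_simp
    ring
  have h4 : 1 / 2 ≤ ρ * (1 + ρ) := by nlinarith
  rw [h3, abs_div, abs_neg, abs_of_pos (a := ρ * (1 + ρ)) (by positivity),
    div_le_iff₀ (by positivity)]
  nlinarith [abs_nonneg (ρ ^ 2 - 1)]

/-- Integrals of even functions over symmetric intervals; no integrability is needed. -/
theorem intervalIntegral_eq_two_mul_of_even {g : ℝ → ℝ} (hg : ∀ x, g (-x) = g x) {b : ℝ}
    (hb : 0 < b) : ∫ x in (-b)..b, g x = 2 * ∫ x in Set.Ioo 0 b, g x := by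
  have h := integral_comp_abs (f := (Set.Iio b).indicator g)
  have h1 : (fun x => (Set.Iio b).indicator g |x|) = (Set.Ioo (-b) b).indicator g := by
    funext x
    by_cases hx : |x| < b
    · rw [Set.indicator_of_mem (Set.mem_Iio.2 hx), Set.indicator_of_mem (Set.mem_Ioo.2 (abs_lt.1 hx))]
      rcases abs_choice x with h | h <;> rw [h]
      exact hg x
    · rw [Set.indicator_of_notMem (show |x| ∉ Set.Iio b from hx), Set.indicator_of_notMem
        (show x ∉ Set.Ioo (-b) b from fun h => hx (abs_lt.2 h))]
  rw [h1, integral_indicator measurableSet_Ioo, setIntegral_indicator measurableSet_Iio] at h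
  rw [intervalIntegral.integral_of_le (by linarith), integral_Ioc_eq_integral_Ioo, h]
  rfl

/-- An arc `y` that decreases from the turning point to `0` in time `τ`, and conserves the energy up
to the relative error `η`, determines the period up to the relative error `2 η`. -/
theorem abs_oscillatorPeriod_sub_le {V : ℝ → ℝ} (hV : Continuous V) (hVe : ∀ x, V (-x) = V x)
    {y y' : ℝ → ℝ} (hy : ∀ t, HasDerivAt y (y' t) t) (hy'c : Continuous y') {τ η : ℝ} (hτ : 0 < τ)
    (hyτ : y τ = 0) (hneg : ∀ t ∈ Set.Ioo 0 τ, y' t < 0) (hη : η ≤ 1 / 2)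
    (herr : ∀ t ∈ Set.Ioo 0 τ, |2 * (V (y 0) - V (y t)) - y' t ^ 2| ≤ η * y' t ^ 2) :
    |oscillatorPeriod V (V (y 0)) - 4 * τ| ≤ 8 * τ * η := by
  set b := y 0 with hb
  have hyc : Continuous y := continuous_iff_continuousAt.2 fun t => (hy t).continuousAt
  have hanti : StrictAntiOn y (Set.Icc 0 τ) := by
    refine strictAntiOn_of_deriv_neg (convex_Icc 0 τ) hyc.continuousOn fun t ht => ?_
    rw [interior_Icc] at ht
    rw [(hy t).deriv]
    exact hneg t ht
  have hb0 : 0 < b := hyτ ▸ hanti ⟨le_rfl, hτ.le⟩ ⟨hτ.le, le_rfl⟩ hτ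
  have himg : y '' Set.Ioo 0 τ = Set.Ioo 0 b := by
    apply Set.Subset.antisymm
    · rintro _ ⟨t, ht, rfl⟩
      refine ⟨?_, hanti ⟨le_rfl, hτ.le⟩ ⟨ht.1.le, ht.2.le⟩ ht.1⟩
      exact hyτ ▸ hanti ⟨ht.1.le, ht.2.le⟩ ⟨hτ.le, le_rfl⟩ ht.2
    · have := intermediate_value_Ioo' hτ.le hyc.continuousOn (f := y)
      rwa [hyτ] at this
  have hpos : ∀ t ∈ Set.Ioo 0 τ, 0 < V b - V (y t) := fun t ht => by
    have h1 := (abs_le.1 (herr t ht)).1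
    have h2 : 0 < y' t ^ 2 := by
      have := (hneg t ht).ne
      positivity
    nlinarith
  have hturn : turningPoint V (V b) = b := by
    refine IsLeast.csInf_eq ⟨⟨hb0, rfl⟩, fun x hx => ?_⟩
    by_contra hlt
    have hmem : x ∈ y '' Set.Ioo 0 τ := by
      rw [himg]
      exact ⟨hx.1, not_le.1 hlt⟩
    obtain ⟨t, ht, rfl⟩ := hmem
    have := hpos t ht
    rw [hx.2] at this
    linarith
  set k : ℝ → ℝ := fun t => |y' t| / Real.sqrt (2 * (V b - V (y t))) with hk
  have hper : oscillatorPeriod V (V b) = 4 * ∫ t in Set.Ioo 0 τ, k t := by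
    rw [oscillatorPeriod, hturn, intervalIntegral_eq_two_mul_of_even (fun x => by rw [hVe]) hb0,
      ← himg, integral_image_eq_integral_abs_deriv_smul measurableSet_Ioo
        (fun t _ => (hy t).hasDerivWithinAt)
        (hanti.injOn.mono Set.Ioo_subset_Icc_self)]
    rw [← integral_const_mul, ← integral_const_mul, ← integral_const_mul]
    refine setIntegral_congr_fun measurableSet_Ioo fun t ht => ?_
    have h1 := hpos t ht
    simp only [hk, smul_eq_mul]
    rw [Real.sqrt_mul zero_le_two]
    have h2 : 0 < Real.sqrt (V b - V (y t)) := Real.sqrt_pos.2 h1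
    have h3 : (0 : ℝ) < Real.sqrt 2 := Real.sqrt_pos.2 two_pos
    have h4 : Real.sqrt 2 ^ 2 = 2 := Real.sq_sqrt zero_le_two
    field_simp
    rw [h4]
    ring
  have hkb : ∀ t ∈ Set.Ioo 0 τ, |k t - 1| ≤ 2 * η := fun t ht => by
    have h1 := hpos t ht
    have h2 : 0 < |y' t| := abs_pos.2 (hneg t ht).ne
    have h3 : k t = 1 / (Real.sqrt (2 * (V b - V (y t))) / |y' t|) := by
      rw [one_div_div]
    rw [h3]
    refine abs_inv_sub_one_le (by positivity) hη ?_
    rw [div_pow, Real.sq_sqrt (by positivity), sq_abs]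
    have h4 : 0 < y' t ^ 2 := by
      rw [← sq_abs]
      positivity
    rw [div_sub_one h4.ne', abs_div, abs_of_pos h4, div_le_iff₀ h4]
    exact herr t ht
  have hkc : ContinuousOn k (Set.Ioo 0 τ) := by
    refine ContinuousOn.div hy'c.abs.continuousOn ?_ fun t ht => ?_
    · exact (Real.continuous_sqrt.comp (continuous_const.mul
        (continuous_const.sub (hV.comp hyc)))).continuousOn
    · exact (Real.sqrt_pos.2 (mul_pos two_pos (hpos t ht))).ne'
  have hkint : IntegrableOn k (Set.Ioo 0 τ) := by
    refine Integrable.of_bound (hkc.aestronglyMeasurable measurableSet_Ioo) (1 + 2 * η) ?_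
    refine (ae_restrict_iff' measurableSet_Ioo).2 (.of_forall fun t ht => ?_)
    have h1 := hkb t ht
    calc ‖k t‖ = |1 + (k t - 1)| := by rw [Real.norm_eq_abs]; congr 1; ring
      _ ≤ |(1 : ℝ)| + |k t - 1| := abs_add_le _ _
      _ ≤ _ := by rw [abs_one]; linarith
  have hone : ∫ _ in Set.Ioo 0 τ, (1 : ℝ) = τ := by
    simp [hτ.le]
  have hdiff : ∫ t in Set.Ioo 0 τ, (k t - 1) = (∫ t in Set.Ioo 0 τ, k t) - τ := by
    rw [integral_sub hkint (integrableOn_const (by simp)), hone]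
  have hle := norm_setIntegral_le_of_norm_le_const (f := fun t => k t - 1) (C := 2 * η)
    (μ := volume) (s := Set.Ioo 0 τ) (by simp) hkb
  rw [hdiff, Real.norm_eq_abs] at hle
  have hvol : volume.real (Set.Ioo 0 τ) = τ := by simp [hτ.le]
  rw [hvol] at hle
  rw [hper, ← mul_sub, abs_mul, abs_of_pos (four_pos : (0 : ℝ) < 4)]
  linarith

/-- `V < E` strictly inside the potential well. -/
theorem lt_of_abs_lt_turningPoint {V : ℝ → ℝ} (hV : Continuous V) (hVe : ∀ x, V (-x) = V x)
    {E a : ℝ} (hE : V 0 < E) (ha : IsLeast {x : ℝ | 0 < x ∧ V x = E} a) {x : ℝ} (hx : |x| < a) :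
    V x < E := by
  have key : ∀ x, 0 ≤ x → x < a → V x < E := fun x h0 hxa => by
    by_contra hn
    obtain ⟨z, hz, hzE⟩ := intermediate_value_Icc h0 hV.continuousOn
      (show E ∈ Set.Icc (V 0) (V x) from ⟨hE.le, not_lt.1 hn⟩)
    have hz0 : 0 < z := lt_of_le_of_ne hz.1 fun h => by
      rw [← h] at hzE
      exact hE.ne hzE
    exact absurd (ha.2 ⟨hz0, hzE⟩) (not_le.2 (hz.2.trans_lt hxa))
  rcases le_total 0 x with h | h
  · exact key x h (by rwa [abs_of_nonneg h] at hx)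
  · rw [← hVe]
    exact key (-x) (by linarith) (by rwa [abs_of_nonpos h] at hx)

/-- At a turning point with finite nonzero period the force does not vanish: otherwise
`1 / √(E - V)` is not integrable, and its integral takes the value `0`. -/
theorem deriv_pos_of_oscillatorPeriod_ne_zero {V : ℝ → ℝ} (hV : ContDiff ℝ ∞ V)
    (hVe : ∀ x, V (-x) = V x) {E a : ℝ} (hE : V 0 < E)
    (ha : IsLeast {x : ℝ | 0 < x ∧ V x = E} a) (hT : oscillatorPeriod V E ≠ 0) : 0 < deriv V a := by
  by_contra hn
  rw [not_lt] at hn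
  have ha0 : 0 < a := ha.1.1
  have hVa : V a = E := ha.1.2
  obtain ⟨M, hM0, hM⟩ := hV.exists_abs_sub_sub_le a
  have hup : ∀ x ∈ Set.Ioo 0 a, 0 < E - V x ∧ E - V x ≤ M * (a - x) ^ 2 := fun x hx => by
    refine ⟨sub_pos.2 (lt_of_abs_lt_turningPoint hV.continuous hVe hE ha ?_), ?_⟩
    · rw [abs_of_pos hx.1]
      exact hx.2
    · have h1 := hM a (x - a) (by rw [abs_of_pos ha0]) (by
        rw [add_sub_cancel, abs_of_pos hx.1]
        exact hx.2.le)
      rw [add_sub_cancel, sq_abs, hVa] at h1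
      have h2 := (abs_le.1 h1).1
      have h3 : 0 ≤ deriv V a * (x - a) := mul_nonneg_of_nonpos_of_nonpos hn (by linarith [hx.2])
      nlinarith
  refine hT ?_
  have hturn : turningPoint V E = a := ha.csInf_eq
  rw [oscillatorPeriod, hturn, intervalIntegral.integral_undef, mul_zero]
  intro hint
  have h1 : IntervalIntegrable (fun x => 1 / Real.sqrt (E - V x)) volume 0 a :=
    hint.mono_set (by
      rw [Set.uIcc_of_le ha0.le, Set.uIcc_of_le (by linarith)]
      exact Set.Icc_subset_Icc (by linarith) le_rfl)
  have h2 : IntervalIntegrable (fun x => (x - a)⁻¹) volume 0 a := by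
    rw [intervalIntegrable_iff_integrableOn_Ioo_of_le ha0.le] at h1 ⊢
    refine Integrable.mono' (h1.const_mul (Real.sqrt M))
      (measurable_id.sub_const a).inv.aestronglyMeasurable ?_
    refine (ae_restrict_iff' measurableSet_Ioo).2 (.of_forall fun x hx => ?_)
    obtain ⟨h3, h4⟩ := hup x hx
    have h5 : Real.sqrt (E - V x) ≤ Real.sqrt M * (a - x) := by
      refine (Real.sqrt_le_sqrt h4).trans_eq ?_
      rw [Real.sqrt_mul hM0.le, Real.sqrt_sq (by linarith [hx.2])]
    have h6 : 0 < Real.sqrt (E - V x) := Real.sqrt_pos.2 h3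
    have h7 : 0 < a - x := by linarith [hx.2]
    rw [norm_inv, Real.norm_eq_abs, abs_sub_comm, abs_of_pos h7, mul_one_div, inv_eq_one_div,
      div_le_div_iff₀ h7 h6]
    linarith
  rw [intervalIntegrable_sub_inv_iff] at h2
  rcases h2 with h2 | h2
  · exact ha0.ne h2
  · exact h2 Set.right_mem_uIcc

theorem deriv_zero_of_even {f : ℝ → ℝ} (h : ∀ t, f (-t) = f t) : deriv f 0 = 0 := by
  have := deriv_neg_of_even h 0
  rw [neg_zero] at this
  linarith

/-- Conservation of energy. -/
theorem energy_eq {V f : ℝ → ℝ} (hV : ContDiff ℝ ∞ V)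
    (hf : HasSecondDeriv f (fun t => -deriv V (f t))) (hf0 : deriv f 0 = 0) (t : ℝ) :
    deriv f t ^ 2 / 2 + V (f t) = V (f 0) := by
  have hd : ∀ t, HasDerivAt (fun t => deriv f t ^ 2 / 2 + V (f t)) 0 t := fun t => by
    have h1 := ((hf.2 t).pow 2).div_const 2
    have h2 := HasDerivAt.comp t ((hV.differentiable (by simp)) (f t)).hasDerivAt (hf.hasDerivAt t)
    refine (h1.add h2).congr_deriv ?_
    norm_num
    ring
  have := is_const_of_deriv_eq_zero (fun t => (hd t).differentiableAt) (fun t => (hd t).deriv) t 0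
  simpa [hf0] using this

/-- The solution starting at the turning point decreases until it reaches `0`. -/
theorem exists_quarter_period {V f : ℝ → ℝ} (hV : ContDiff ℝ ∞ V) (hVe : ∀ x, V (-x) = V x)
    {E a T : ℝ} (hT0 : 0 < T) (hE : V 0 < E) (ha : IsLeast {x : ℝ | 0 < x ∧ V x = E} a)
    (hpos : 0 < deriv V a) (hf : HasSecondDeriv f (fun t => -deriv V (f t)))
    (hfe : ∀ t, f (-t) = f t) (hfp : ∀ t, f (t + T) = f t) (hf0 : f 0 = a) :
    ∃ τ > 0, f τ = 0 ∧ ∀ t ∈ Set.Ioc 0 τ, deriv f t < 0 := by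
  have hd0 : deriv f 0 = 0 := deriv_zero_of_even hfe
  have hdc := hf.continuous_deriv
  have hfc : Continuous f := continuous_iff_continuousAt.2 fun t => (hf.hasDerivAt t).continuousAt
  have hdT : deriv f T = 0 := by
    have := deriv_add_period hfp 0
    rwa [zero_add, hd0] at this
  -- near `0` the velocity has the sign of the acceleration `- V'(a)`
  obtain ⟨η, hη0, hη⟩ : ∃ η > 0, ∀ t ∈ Set.Ioo 0 η, deriv f t < 0 := by
    have h1 : HasDerivAt (deriv f) (-deriv V a) 0 := hf0 ▸ hf.2 0
    have h2 := (hasDerivAt_iff_tendsto_slope.1 h1).eventually_lt_const (neg_lt_zero.2 hpos)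
    rw [eventually_nhdsWithin_iff, Metric.eventually_nhds_iff] at h2
    obtain ⟨η, hη0, hη⟩ := h2
    refine ⟨η, hη0, fun t ht => ?_⟩
    have h3 := hη (by rw [Real.dist_0_eq_abs, abs_of_pos ht.1]; exact ht.2) ht.1.ne'
    rw [slope_def_field, hd0, sub_zero, sub_zero] at h3
    by_contra hn
    exact absurd h3 (not_lt.2 (div_nonneg (not_lt.1 hn) ht.1.le))
  have hηT : η ≤ T := by
    by_contra hlt
    exact absurd hdT (hη T ⟨hT0, not_le.1 hlt⟩).ne
  -- the first positive zero `S` of the velocity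
  obtain ⟨S, hS, hSmin⟩ : ∃ S, IsLeast {t | t ∈ Set.Icc (η / 2) T ∧ deriv f t = 0} S := by
    have hcl : IsCompact {t | t ∈ Set.Icc (η / 2) T ∧ deriv f t = 0} :=
      isCompact_Icc.inter_right (isClosed_eq hdc continuous_const)
    exact hcl.exists_isLeast ⟨T, ⟨by linarith, le_rfl⟩, hdT⟩
  have hS0 : 0 < S := lt_of_lt_of_le (by linarith) hS.1.1
  have hneg : ∀ t ∈ Set.Ioo 0 S, deriv f t < 0 := fun t ht => by
    by_contra hn
    have hηt : η ≤ t := by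
      by_contra hlt
      exact hn (hη t ⟨ht.1, not_le.1 hlt⟩)
    obtain ⟨z, hz, hz0⟩ := intermediate_value_Icc (by linarith : η / 2 ≤ t) hdc.continuousOn
      (show (0 : ℝ) ∈ Set.Icc (deriv f (η / 2)) (deriv f t) from
        ⟨(hη _ ⟨by linarith, by linarith⟩).le, not_lt.1 hn⟩)
    have := hSmin ⟨⟨hz.1, hz.2.trans (ht.2.le.trans hS.1.2)⟩, hz0⟩
    linarith [hz.2, ht.2]
  have hanti : StrictAntiOn f (Set.Icc 0 S) := by
    refine strictAntiOn_of_deriv_neg (convex_Icc 0 S) hfc.continuousOn fun t ht => ?_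
    rw [interior_Icc] at ht
    exact hneg t ht
  have hfS : f S < 0 := by
    have h1 : f S < a := hf0 ▸ hanti ⟨le_rfl, hS0.le⟩ ⟨hS0.le, le_rfl⟩ hS0
    have h2 := energy_eq hV hf hd0 S
    rw [hS.2, hf0, ha.1.2] at h2
    by_contra hn
    have := lt_of_abs_lt_turningPoint hV.continuous hVe hE ha
      (show |f S| < a by rwa [abs_of_nonneg (not_lt.1 hn)])
    linarith
  obtain ⟨τ, hτ, hfτ⟩ := intermediate_value_Ioo' hS0.le hfc.continuousOn
    (show (0 : ℝ) ∈ Set.Ioo (f S) (f 0) from ⟨hfS, hf0.symm ▸ ha.1.1⟩)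
  exact ⟨τ, hτ.1, hfτ, fun t ht => hneg t ⟨ht.1, ht.2.trans_lt hτ.2⟩⟩

/-- A function with vanishing value at `0` is bounded by a multiple of `t` on compact intervals. -/
theorem exists_abs_le_mul {g : ℝ → ℝ} (hg : Differentiable ℝ g) (h0 : g 0 = 0) (τ : ℝ) :
    ∃ C > 0, ∀ t ∈ Set.Icc 0 τ, |g t| ≤ C * t := by
  have hc : Continuous (dslope g 0) := continuous_iff_continuousAt.2 fun t => by
    by_cases ht : t = 0
    · rw [ht, continuousAt_dslope_same]
      exact hg 0
    · rw [continuousAt_dslope_of_ne ht]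
      exact (hg t).continuousAt
  obtain ⟨C, hC⟩ := (isCompact_Icc (a := (0 : ℝ)) (b := τ)).exists_bound_of_continuousOn
    hc.continuousOn
  refine ⟨max C 1, by positivity, fun t ht => ?_⟩
  have h1 := sub_smul_dslope g 0 t
  rw [h0, sub_zero, sub_zero, smul_eq_mul] at h1
  rw [← h1, abs_mul, abs_of_nonneg ht.1, mul_comm]
  exact mul_le_mul_of_nonneg_right ((hC t ht).trans (le_max_left _ _)) ht.1

/-- A function which vanishes at `0` with negative derivative and is negative on `(0,τ]` is bounded
above by a negative multiple of `t`. -/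
theorem exists_le_neg_mul {g : ℝ → ℝ} (hg : Differentiable ℝ g) (h0 : g 0 = 0)
    (h0' : deriv g 0 < 0) {τ : ℝ} (hτ : 0 < τ) (hneg : ∀ t ∈ Set.Ioc 0 τ, g t < 0) :
    ∃ c > 0, ∀ t ∈ Set.Icc 0 τ, g t ≤ -(c * t) := by
  have hc : Continuous (dslope g 0) := continuous_iff_continuousAt.2 fun t => by
    by_cases ht : t = 0
    · rw [ht, continuousAt_dslope_same]
      exact hg 0
    · rw [continuousAt_dslope_of_ne ht]
      exact (hg t).continuousAt
  have hmul : ∀ t, t * dslope g 0 t = g t := fun t => by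
    have h1 := sub_smul_dslope g 0 t
    rwa [h0, sub_zero, sub_zero, smul_eq_mul] at h1
  have hn : ∀ t ∈ Set.Icc 0 τ, dslope g 0 t < 0 := fun t ht => by
    rcases ht.1.eq_or_lt with h | h
    · rw [← h, dslope_same]
      exact h0'
    · have h2 := hneg t ⟨h, ht.2⟩
      rw [← hmul t] at h2
      exact (pos_iff_neg_of_mul_neg h2).1 h
  obtain ⟨m, hm, hmax⟩ := (isCompact_Icc (a := (0 : ℝ)) (b := τ)).exists_isMaxOn
    ⟨0, le_rfl, hτ.le⟩ hc.continuousOn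
  refine ⟨-dslope g 0 m, by linarith [hn m hm], fun t ht => ?_⟩
  rw [← hmul t]
  have h3 : dslope g 0 t ≤ dslope g 0 m := hmax ht
  nlinarith [ht.1]

end Period

/-! ### Nondegeneracy of the oscillator orbit -/

section Nondegenerate

theorem exists_abs_le_of_periodic {f : ℝ → ℝ} (hf : Continuous f) {T : ℝ} (hT : 0 < T)
    (hp : ∀ t, f (t + T) = f t) : ∃ R, ∀ t, |f t| ≤ R := by
  obtain ⟨R, hR⟩ := (isCompact_Icc (a := (0 : ℝ)) (b := T)).exists_bound_of_continuousOn
    hf.continuousOn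
  refine ⟨R, fun t => ?_⟩
  obtain ⟨s, hs, hts⟩ := (show Function.Periodic f T from hp).exists_mem_Ico₀ hT t
  rw [hts]
  exact hR s ⟨hs.1, hs.2.le⟩

theorem deriv_odd_of_even {V : ℝ → ℝ} (hVe : ∀ x, V (-x) = V x) (x : ℝ) :
    deriv V (-x) = -deriv V x := deriv_neg_of_even hVe x

theorem deriv_deriv_even_of_even {V : ℝ → ℝ} (hVe : ∀ x, V (-x) = V x) (x : ℝ) :
    deriv (deriv V) (-x) = deriv (deriv V) x := by
  have h := deriv_comp_neg (deriv V) x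
  rw [funext (deriv_odd_of_even hVe), deriv.fun_neg] at h
  linarith

theorem HasSecondDeriv.comp_const_sub {f g : ℝ → ℝ} (h : HasSecondDeriv f g) (c : ℝ) :
    HasSecondDeriv (fun t => f (c - t)) (fun t => g (c - t)) ∧
      ∀ t, deriv (fun t => f (c - t)) t = -deriv f (c - t) := by
  have h1 : ∀ t, HasDerivAt (fun t => f (c - t)) (-deriv f (c - t)) t := fun t =>
    (h.hasDerivAt (c - t)).comp_const_sub c t
  refine ⟨HasSecondDeriv.of_hasDerivAt h1 fun t => ?_, fun t => (h1 t).deriv⟩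
  have h2 := ((h.2 (c - t)).comp_const_sub c t).neg
  rw [neg_neg] at h2
  exact h2

theorem HasSecondDeriv.add {f g u v : ℝ → ℝ} (h : HasSecondDeriv f g) (h' : HasSecondDeriv u v) :
    HasSecondDeriv (fun t => f t + u t) (fun t => g t + v t) ∧
      ∀ t, deriv (fun t => f t + u t) t = deriv f t + deriv u t := by
  have h1 : ∀ t, HasDerivAt (fun t => f t + u t) (deriv f t + deriv u t) t := fun t =>
    (h.hasDerivAt t).add (h'.hasDerivAt t)
  exact ⟨HasSecondDeriv.of_hasDerivAt h1 fun t => (h.2 t).add (h'.2 t), fun t => (h1 t).deriv⟩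

variable {V : ℝ → ℝ} {f w : ℝ → ℝ} {T τ a : ℝ}

/-- Reflection at a zero reverses the sign of a solution of the oscillator equation, since the force
is odd. -/
theorem reflect_eq_neg (hV : ContDiff ℝ ∞ V) (hVe : ∀ x, V (-x) = V x)
    (hf : HasSecondDeriv f (fun t => -deriv V (f t))) {R : ℝ} (hR : ∀ t, |f t| ≤ R)
    (hτ : f τ = 0) (t : ℝ) : f (2 * τ - t) = -f t := by
  obtain ⟨M, -, hM⟩ := hV.infty_deriv.exists_abs_sub_le R
  obtain ⟨h1, h1'⟩ := hf.comp_const_sub (2 * τ)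
  obtain ⟨h2, h2'⟩ := h1.add hf
  have h3 : 2 * τ - τ = τ := by ring
  have := h2.eq_zero (K := M) (t₀ := τ) (fun t => ?_) (by rw [h3, hτ, add_zero])
    (by rw [h2', h1', h3, neg_add_cancel]) t
  · linarith
  · have h4 := hM (f (2 * τ - t)) (-f t) (hR _) (by rw [abs_neg]; exact hR t)
    rw [deriv_odd_of_even hVe, sub_neg_eq_add, sub_neg_eq_add] at h4
    rw [← neg_add, abs_neg]
    exact h4

/-- An even periodic solution of the linearised equation vanishes at the quarter period. The
Wronskian with `f'` shows that `w(T/2) = -w(0)`, hence `w` is odd about `T/4`. -/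
theorem linearized_quarter_period_eq_zero (hV : ContDiff ℝ ∞ V) (hVe : ∀ x, V (-x) = V x)
    (hf : HasSecondDeriv f (fun t => -deriv V (f t))) {R : ℝ} (hR : ∀ t, |f t| ≤ R)
    (hfe : ∀ t, f (-t) = f t) (hfp : ∀ t, f (t + 4 * τ) = f t) (hτ : f τ = 0)
    (hpos : deriv V (f 0) ≠ 0)
    (hw : HasSecondDeriv w (fun t => -(deriv (deriv V) (f t) * w t)))
    (hwe : ∀ t, w (-t) = w t) (hwp : ∀ t, w (t + 4 * τ) = w t) : w τ = 0 := by
  have hrefl := reflect_eq_neg hV hVe hf hR hτ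
  have hVd : ∀ t, HasDerivAt (fun t => deriv V (f t)) (deriv (deriv V) (f t) * deriv f t) t :=
    fun t => HasDerivAt.comp t ((hV.infty_deriv.differentiable (by simp)) (f t)).hasDerivAt
      (hf.hasDerivAt t)
  have hW : ∀ t, HasDerivAt (fun t => deriv V (f t) * w t + deriv f t * deriv w t) 0 t := fun t => by
    refine (((hVd t).mul (hw.hasDerivAt t)).add ((hf.2 t).mul (hw.2 t))).congr_deriv ?_
    ring
  have hconst := is_const_of_deriv_eq_zero (fun t => (hW t).differentiableAt)
    (fun t => (hW t).deriv) (2 * τ) 0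
  have hhalf : 4 * τ / 2 = 2 * τ := by ring
  have hf2 : deriv f (2 * τ) = 0 := hhalf ▸ deriv_half_period_eq_zero hfe hfp
  have hw2 : deriv w (2 * τ) = 0 := hhalf ▸ deriv_half_period_eq_zero hwe hwp
  have hf20 : f (2 * τ) = -f 0 := by
    have := hrefl 0
    rwa [sub_zero] at this
  rw [hf2, hf20, deriv_odd_of_even hVe, deriv_zero_of_even hfe, zero_mul, zero_mul, add_zero,
    add_zero, neg_mul, ← mul_neg] at hconst
  have hw20 : w (2 * τ) + w 0 = 0 := by
    have := mul_left_cancel₀ hpos hconst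
    linarith
  obtain ⟨M, -, hM⟩ := hV.infty_deriv.infty_deriv.exists_abs_le R
  obtain ⟨h1, h1'⟩ := hw.comp_const_sub (2 * τ)
  obtain ⟨h2, h2'⟩ := h1.add hw
  have := h2.eq_zero (K := M) (t₀ := 0) (fun t => ?_) (by rw [sub_zero, hw20])
    (by rw [h2', h1', sub_zero, hw2, deriv_zero_of_even hwe, neg_zero, add_zero]) τ
  · rw [show 2 * τ - τ = τ by ring] at this
    linarith
  · rw [hrefl, deriv_deriv_even_of_even hVe, ← neg_add, abs_neg, ← mul_add, abs_mul]
    exact mul_le_mul_of_nonneg_right (hM _ (hR t)) (abs_nonneg _)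

/-- Along `f + δ w`, where `w` solves the linearised equation and vanishes at the quarter period,
energy is conserved up to `O(δ²)`, so the period changes only by `O(δ²)`. -/
theorem exists_abs_oscillatorPeriod_sub_le_sq (hV : ContDiff ℝ ∞ V) (hVe : ∀ x, V (-x) = V x)
    (hf : HasSecondDeriv f (fun t => -deriv V (f t))) (hfe : ∀ t, f (-t) = f t)
    (hτ0 : 0 < τ) (hτ : f τ = 0) (hneg : ∀ t ∈ Set.Ioc 0 τ, deriv f t < 0)
    (hpos : 0 < deriv V (f 0))
    (hw : HasSecondDeriv w (fun t => -(deriv (deriv V) (f t) * w t)))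
    (hwe : ∀ t, w (-t) = w t) (hwτ : w τ = 0) :
    ∃ δ₀ > 0, ∃ C, ∀ δ, |δ| < δ₀ →
      |oscillatorPeriod V (V (f 0 + δ * w 0)) - 4 * τ| ≤ C * δ ^ 2 := by
  have hf'd : Differentiable ℝ (deriv f) := fun t => (hf.2 t).differentiableAt
  have hw'd : Differentiable ℝ (deriv w) := fun t => (hw.2 t).differentiableAt
  have hf'0 := deriv_zero_of_even hfe
  have hw'0 := deriv_zero_of_even hwe
  obtain ⟨c, hc0, hc⟩ := exists_le_neg_mul hf'd hf'0 (by rw [(hf.2 0).deriv]; linarith) hτ0 hneg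
  obtain ⟨C₁, hC₁0, hC₁⟩ := exists_abs_le_mul hf'd hf'0 τ
  obtain ⟨C₂, hC₂0, hC₂⟩ := exists_abs_le_mul hw'd hw'0 τ
  obtain ⟨A, hA⟩ := (isCompact_Icc (a := (0 : ℝ)) (b := τ)).exists_bound_of_continuousOn
    hf.1.continuous.continuousOn
  obtain ⟨B, hB⟩ := (isCompact_Icc (a := (0 : ℝ)) (b := τ)).exists_bound_of_continuousOn
    hw.1.continuous.continuousOn
  have hB0 : 0 ≤ B := (norm_nonneg _).trans (hB 0 ⟨le_rfl, hτ0.le⟩)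
  obtain ⟨M, hM0, hM⟩ := hV.infty_deriv.exists_abs_sub_sub_le (A + B)
  set κ : ℝ := 2 * ((C₁ + C₂) * (M * B ^ 2)) with hκ
  have hκ0 : 0 ≤ κ := by positivity
  set L : ℝ := 4 * κ / c ^ 2 with hL
  have hL0 : 0 ≤ L := by positivity
  refine ⟨min 1 (min (c / (2 * C₂)) (1 / (2 * (L + 1)))), by positivity, 8 * τ * L,
    fun δ hδ => ?_⟩
  have hδ1 : |δ| < 1 := hδ.trans_le (min_le_left _ _)
  have hδ2 : |δ| * C₂ ≤ c / 2 := by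
    have h := hδ.trans_le ((min_le_right _ _).trans (min_le_left _ _))
    rw [lt_div_iff₀ (by positivity)] at h
    linarith
  have hδ3 : L * δ ^ 2 ≤ 1 / 2 := by
    have h := hδ.trans_le ((min_le_right _ _).trans (min_le_right _ _))
    rw [lt_div_iff₀ (by positivity)] at h
    have h2 : δ ^ 2 ≤ |δ| := by
      rw [← sq_abs]
      nlinarith [abs_nonneg δ]
    nlinarith [abs_nonneg δ]
  set y : ℝ → ℝ := fun t => f t + δ * w t with hy
  set y' : ℝ → ℝ := fun t => deriv f t + δ * deriv w t with hy'
  have hdy : ∀ t, HasDerivAt y (y' t) t := fun t =>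
    (hf.hasDerivAt t).add ((hw.hasDerivAt t).const_mul δ)
  have hdy' : ∀ t, HasDerivAt y' (-deriv V (f t) + δ * -(deriv (deriv V) (f t) * w t)) t :=
    fun t => (hf.2 t).add ((hw.2 t).const_mul δ)
  have hy'le : ∀ t ∈ Set.Icc 0 τ, y' t ≤ -(c / 2 * t) := fun t ht => by
    have h1 : δ * deriv w t ≤ |δ| * (C₂ * t) := by
      refine (le_abs_self _).trans ?_
      rw [abs_mul]
      exact mul_le_mul_of_nonneg_left (hC₂ t ht) (abs_nonneg _)
    have h2 := hc t ht
    simp only [hy']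
    nlinarith [ht.1]
  have hy'abs : ∀ t ∈ Set.Icc 0 τ, |y' t| ≤ (C₁ + C₂) * t := fun t ht => by
    refine (abs_add_le _ _).trans ?_
    rw [abs_mul, add_mul]
    refine add_le_add (hC₁ t ht) ((mul_le_of_le_one_left (abs_nonneg _) hδ1.le).trans (hC₂ t ht))
  -- the energy defect and its derivative
  set e : ℝ → ℝ := fun t => 2 * (V (y 0) - V (y t)) - y' t ^ 2 with he
  have hde : ∀ t, HasDerivAt e (-(2 * (y' t * (deriv V (f t + δ * w t) - deriv V (f t) -
      deriv (deriv V) (f t) * (δ * w t))))) t := fun t => by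
    have h1 := HasDerivAt.comp t ((hV.differentiable (by simp)) (y t)).hasDerivAt (hdy t)
    refine (((h1.const_sub (V (y 0))).const_mul 2).sub ((hdy' t).pow 2)).congr_deriv ?_
    simp only [hy]
    norm_num
    ring
  have he0 : e 0 = 0 := by
    simp only [he, hy', hf'0, hw'0]
    ring
  have hde_le : ∀ t ∈ Set.Icc 0 τ, |(-(2 * (y' t * (deriv V (f t + δ * w t) - deriv V (f t) -
      deriv (deriv V) (f t) * (δ * w t)))))| ≤ κ * δ ^ 2 * t := fun t ht => by
    have h1 : |δ * w t| ≤ |δ| * B := by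
      rw [abs_mul]
      exact mul_le_mul_of_nonneg_left (hB t ht) (abs_nonneg _)
    have h2 : |δ * w t| ≤ B := h1.trans (mul_le_of_le_one_left hB0 hδ1.le)
    have h3 := hM (f t) (δ * w t) ((hA t ht).trans (by linarith))
      ((abs_add_le _ _).trans (add_le_add (hA t ht) h2))
    have h4 : |δ * w t| ^ 2 ≤ δ ^ 2 * B ^ 2 := by
      rw [← sq_abs δ, ← mul_pow]
      exact pow_le_pow_left₀ (abs_nonneg _) h1 2
    rw [abs_neg, abs_mul, abs_two, abs_mul]
    calc 2 * (|y' t| * _) ≤ 2 * (((C₁ + C₂) * t) * (M * (δ ^ 2 * B ^ 2))) := by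
          refine mul_le_mul_of_nonneg_left (mul_le_mul (hy'abs t ht) (h3.trans ?_) (abs_nonneg _)
            (mul_nonneg (by positivity) ht.1)) zero_le_two
          exact mul_le_mul_of_nonneg_left h4 hM0.le
      _ = κ * δ ^ 2 * t := by
          rw [hκ]
          ring
  have he_le : ∀ t ∈ Set.Icc 0 τ, |e t| ≤ κ * δ ^ 2 * t * t := fun t ht => by
    have := (convex_Icc 0 t).norm_image_sub_le_of_norm_hasDerivWithin_le (C := κ * δ ^ 2 * t)
      (fun s _ => (hde s).hasDerivWithinAt) (fun s hs => ?_)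
      (Set.left_mem_Icc.2 ht.1) (Set.right_mem_Icc.2 ht.1)
    · rw [he0, sub_zero, sub_zero, Real.norm_eq_abs, Real.norm_eq_abs, abs_of_nonneg ht.1] at this
      exact this
    · refine (hde_le s ⟨hs.1, hs.2.trans ht.2⟩).trans ?_
      exact mul_le_mul_of_nonneg_left hs.2 (by positivity)
  have hmain := abs_oscillatorPeriod_sub_le hV.continuous hVe hdy
    (hf.continuous_deriv.add (continuous_const.mul hw.continuous_deriv)) hτ0
    (by simp only [hy, hτ, hwτ]; ring) (η := L * δ ^ 2) (fun t ht => ?_) hδ3 (fun t ht => ?_)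
  · refine hmain.trans (le_of_eq ?_)
    ring
  · refine (hy'le t ⟨ht.1.le, ht.2.le⟩).trans_lt ?_
    have := mul_pos hc0 ht.1
    linarith
  · refine (he_le t ⟨ht.1.le, ht.2.le⟩).trans ?_
    have h1 := hy'le t ⟨ht.1.le, ht.2.le⟩
    have h2 : (c / 2 * t) ^ 2 ≤ y' t ^ 2 := by
      rw [← neg_sq (y' t)]
      exact pow_le_pow_left₀ (mul_nonneg (by positivity) ht.1.le) (by linarith) 2
    calc κ * δ ^ 2 * t * t = L * δ ^ 2 * (c / 2 * t) ^ 2 := by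
          rw [hL]
          field_simp
          ring
      _ ≤ L * δ ^ 2 * y' t ^ 2 := mul_le_mul_of_nonneg_left h2 (by positivity)

/-- If the period depends on the energy with nonzero derivative, then the linearised equation has no
nontrivial even periodic solution. -/
theorem linearized_eq_zero {E : ℝ} (hV : ContDiff ℝ ∞ V) (hVe : ∀ x, V (-x) = V x)
    (hE : V 0 < E) (ha : IsLeast {x : ℝ | 0 < x ∧ V x = E} a) (hT0 : 0 < T)
    (hT : T = oscillatorPeriod V E) (hT' : deriv (oscillatorPeriod V) E ≠ 0)
    (hf : HasSecondDeriv f (fun t => -deriv V (f t))) (hfe : ∀ t, f (-t) = f t)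
    (hfp : ∀ t, f (t + T) = f t) (hf0 : f 0 = a)
    (hw : HasSecondDeriv w (fun t => -(deriv (deriv V) (f t) * w t)))
    (hwe : ∀ t, w (-t) = w t) (hwp : ∀ t, w (t + T) = w t) (t : ℝ) : w t = 0 := by
  have hpos : 0 < deriv V a := deriv_pos_of_oscillatorPeriod_ne_zero hV hVe hE ha (hT ▸ hT0.ne')
  obtain ⟨R, hR⟩ := exists_abs_le_of_periodic hf.1.continuous hT0 hfp
  obtain ⟨M, -, hM⟩ := hV.infty_deriv.infty_deriv.exists_abs_le R
  obtain ⟨τ, hτ0, hτ, hneg⟩ := exists_quarter_period hV hVe hT0 hE ha hpos hf hfe hfp hf0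
  have hVf0 : V (f 0) = E := by rw [hf0, ha.1.2]
  have hperiod : T = 4 * τ := by
    have h := abs_oscillatorPeriod_sub_le hV.continuous hVe hf.hasDerivAt hf.continuous_deriv hτ0 hτ
      (η := 0) (fun t ht => hneg t ⟨ht.1, ht.2.le⟩) (by norm_num) (fun t _ => ?_)
    · rw [hVf0, ← hT, mul_zero] at h
      have := abs_nonpos_iff.1 h
      linarith
    · have := energy_eq hV hf (deriv_zero_of_even hfe) t
      rw [zero_mul, abs_nonpos_iff]
      linarith
  rw [← hf0] at hpos
  have hwτ := linearized_quarter_period_eq_zero hV hVe hf hR hfe (hperiod ▸ hfp) hτ hpos.ne' hw hwe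
    (hperiod ▸ hwp)
  obtain ⟨δ₀, hδ₀, C, hC⟩ := exists_abs_oscillatorPeriod_sub_le_sq hV hVe hf hfe hτ0 hτ hneg hpos
    hw hwe hwτ
  have hder : HasDerivAt (fun δ : ℝ => oscillatorPeriod V (V (f 0 + δ * w 0)))
      (deriv (oscillatorPeriod V) E * (deriv V (f 0) * w 0)) 0 := by
    have h1 : HasDerivAt (fun δ : ℝ => f 0 + δ * w 0) (w 0) 0 := by
      simpa using! ((hasDerivAt_id (0 : ℝ)).mul_const (w 0)).const_add (f 0)
    have h0 : f 0 + 0 * w 0 = f 0 := by ring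
    have h2 : HasDerivAt V (deriv V (f 0)) (f 0 + 0 * w 0) := by
      rw [h0]
      exact ((hV.differentiable (by simp)) (f 0)).hasDerivAt
    have h3 : HasDerivAt (oscillatorPeriod V) (deriv (oscillatorPeriod V) E)
        (V (f 0 + 0 * w 0)) := by
      rw [h0, hVf0]
      exact (differentiableAt_of_deriv_ne_zero hT').hasDerivAt
    exact HasDerivAt.comp (h₂ := oscillatorPeriod V) (h := fun δ : ℝ => V (f 0 + δ * w 0)) (0 : ℝ)
      h3 (HasDerivAt.comp (0 : ℝ) h2 h1)
  have hder0 : HasDerivAt (fun δ : ℝ => oscillatorPeriod V (V (f 0 + δ * w 0))) 0 0 := by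
    rw [hasDerivAt_iff_isLittleO_nhds_zero]
    refine IsBigO.trans_isLittleO (g := fun δ : ℝ => δ ^ 2) ?_ ?_
    · refine IsBigO.of_bound C ?_
      filter_upwards [Metric.ball_mem_nhds (0 : ℝ) hδ₀] with δ hδ
      rw [mem_ball_zero_iff, Real.norm_eq_abs] at hδ
      have h1 := hC δ hδ
      rw [zero_add, zero_mul, add_zero, hVf0, ← hT, smul_zero, sub_zero, Real.norm_eq_abs, norm_pow,
        Real.norm_eq_abs, sq_abs, hperiod]
      exact h1
    · exact (isLittleO_pow_id one_lt_two)
  have hw0 : w 0 = 0 := by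
    have := hder.unique hder0
    simpa [hT', hpos.ne'] using this
  refine hw.eq_zero (K := M) (t₀ := 0) (fun t => ?_) hw0 (deriv_zero_of_even hwe) t
  rw [abs_neg, abs_mul]
  exact mul_le_mul_of_nonneg_right (hM _ (hR t)) (abs_nonneg _)

end Nondegenerate

/-! ### Estimates for the nonlinearity at one site -/

section SiteEstimates

theorem isBigO_pow_of_le {m n : ℕ} (h : m ≤ n) :
    (fun ε : ℝ => ε ^ n) =O[𝓝 0] fun ε : ℝ => ε ^ m := by
  refine IsBigO.of_bound 1 ?_
  filter_upwards [Metric.closedBall_mem_nhds (0 : ℝ) one_pos] with ε hε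
  rw [mem_closedBall_zero_iff] at hε
  rw [norm_pow, norm_pow, one_mul]
  exact pow_le_pow_of_le_one (norm_nonneg _) hε h

theorem eventually_norm_le_of_isBigO_sub {X : Type*} [NormedAddCommGroup X] {F : ℝ → X} {x₀ : X}
    (h : (fun ε => F ε - x₀) =O[𝓝 0] fun ε : ℝ => ε) : ∀ᶠ ε in 𝓝 (0 : ℝ), ‖F ε‖ ≤ ‖x₀‖ + 1 := by
  have h1 := (h.trans_tendsto (continuous_id.tendsto' (0 : ℝ) 0 rfl)).norm
  rw [norm_zero] at h1
  filter_upwards [h1.eventually_le_const one_pos] with ε hε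
  calc ‖F ε‖ = ‖x₀ + (F ε - x₀)‖ := by rw [add_sub_cancel]
    _ ≤ _ := (norm_add_le _ _).trans (by linarith)

theorem eventually_norm_le_of_isBigO_pow {X : Type*} [NormedAddCommGroup X] {F : ℝ → X} {m : ℕ}
    (h : F =O[𝓝 0] fun ε : ℝ => ε ^ m) : ∃ R > 0, ∀ᶠ ε in 𝓝 (0 : ℝ), ‖F ε‖ ≤ R := by
  obtain ⟨C, hC0, hC⟩ := (h.trans (isBigO_pow_of_le (Nat.zero_le m))).exists_pos
  refine ⟨C, hC0, hC.bound.mono fun ε hε => ?_⟩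
  simpa using hε

/-- Nonlinear interaction of two states: since `g(0) = 0` and `g''(0) = 0`, the defect
`g(x + y) - g(x) - g(y)` is of third order. -/
theorem exists_abs_add_sub_sub_le {g : ℝ → ℝ} (hg : ContDiff ℝ ∞ g) (h0 : g 0 = 0)
    (h2 : deriv (deriv g) 0 = 0) (R : ℝ) :
    ∃ M > 0, ∀ x y, |x| ≤ R → |y| ≤ R →
      |g (x + y) - g x - g y| ≤ M * (|x| * |y| * (|x| + |y|)) := by
  obtain ⟨M, hM0, hM⟩ := hg.infty_deriv.infty_deriv.exists_abs_sub_le (2 * R)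
  refine ⟨M, hM0, fun x y hx hy => ?_⟩
  have hR : 0 ≤ R := (abs_nonneg x).trans hx
  have hd : ∀ s, HasDerivAt g (deriv g s) s := fun s =>
    ((hg.differentiable (by simp)) s).hasDerivAt
  have hd' : ∀ s, HasDerivAt (deriv g) (deriv (deriv g) s) s := fun s =>
    ((hg.infty_deriv.differentiable (by simp)) s).hasDerivAt
  have hy0 : ∀ s ∈ Set.uIcc 0 y, |s| ≤ |y| := fun s hs => by
    simpa using Set.abs_sub_left_of_mem_uIcc hs
  have hstep : ∀ s ∈ Set.uIcc 0 y,
      |deriv g (x + s) - deriv g s| ≤ M * (|x| + |y|) * |x| := fun s hs => by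
    have := (convex_uIcc s (x + s)).norm_image_sub_le_of_norm_hasDerivWithin_le
      (C := M * (|x| + |y|)) (fun z _ => (hd' z).hasDerivWithinAt) (fun z hz => ?_)
      Set.left_mem_uIcc Set.right_mem_uIcc
    · simpa only [Real.norm_eq_abs, add_sub_cancel_right] using this
    · have h3 := Set.abs_sub_left_of_mem_uIcc hz
      rw [add_sub_cancel_right] at h3
      have hz' : |z| ≤ |x| + |y| := by
        calc |z| = |(z - s) + s| := by rw [sub_add_cancel]
          _ ≤ |z - s| + |s| := abs_add_le _ _
          _ ≤ _ := add_le_add h3 (hy0 s hs)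
      have h4 := hM z 0 (by linarith) (by rw [abs_zero]; linarith)
      rw [h2, sub_zero, sub_zero] at h4
      exact h4.trans (mul_le_mul_of_nonneg_left hz' hM0.le)
  have hF : ∀ s, HasDerivAt (fun s => g (x + s) - g s) (deriv g (x + s) - deriv g s) s := fun s =>
    ((hd (x + s)).comp_const_add x s).sub (hd s)
  have := (convex_uIcc 0 y).norm_image_sub_le_of_norm_hasDerivWithin_le
    (fun s _ => (hF s).hasDerivWithinAt) hstep Set.left_mem_uIcc Set.right_mem_uIcc
  rw [add_zero, h0, sub_zero, sub_zero, Real.norm_eq_abs, Real.norm_eq_abs] at this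
  calc |g (x + y) - g x - g y| = |g (x + y) - g y - g x| := by rw [sub_right_comm]
    _ ≤ M * (|x| + |y|) * |x| * |y| := this
    _ = _ := by ring

variable {T : ℝ} [Fact (0 < T)]

/-- The nonlinear term `L₀⁻¹ g(w)` at one site. -/
noncomputable def siteForce (K : C(AddCircle T, ℝ) →L[ℝ] H2e T) {g : ℝ → ℝ} (hg : ContDiff ℝ ∞ g)
    (w : H2e T) : H2e T :=
  K (superpose hg (H2e.toCCLM T w))

variable (K : C(AddCircle T, ℝ) →L[ℝ] H2e T) {g : ℝ → ℝ} (hg : ContDiff ℝ ∞ g)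

theorem norm_toCCLM_le_of_norm_le {w : H2e T} {R : ℝ} (hw : ‖w‖ ≤ R) :
    ‖H2e.toCCLM T w‖ ≤ ‖H2e.toCCLM T‖ * R :=
  (H2e.toCCLM T).le_opNorm_of_le hw

theorem exists_norm_siteForce_le_sq (h0 : g 0 = 0) (h1 : deriv g 0 = 0) (R : ℝ) :
    ∃ M > 0, ∀ w : H2e T, ‖w‖ ≤ R → ‖siteForce K hg w‖ ≤ M * ‖w‖ ^ 2 := by
  obtain ⟨M, hM0, hM⟩ := exists_norm_superpose_sub_sub_le (S := AddCircle T) hg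
    (‖H2e.toCCLM T‖ * max R 0)
  refine ⟨(‖K‖ + 1) * (M * (‖H2e.toCCLM T‖ + 1) ^ 2), by positivity, fun w hw => ?_⟩
  have h2 := hM 0 (H2e.toCCLM T w) (by rw [norm_zero]; positivity) (by
    rw [zero_add]
    exact norm_toCCLM_le_of_norm_le (hw.trans (le_max_left _ _)))
  rw [zero_add, superpose_zero _ h0, superpose_zero _ h1, zero_mul, sub_zero, sub_zero] at h2
  have h3 : ‖H2e.toCCLM T w‖ ≤ (‖H2e.toCCLM T‖ + 1) * ‖w‖ :=
    ((H2e.toCCLM T).le_opNorm w).trans (by gcongr; linarith)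
  calc ‖siteForce K hg w‖ ≤ ‖K‖ * ‖superpose hg (H2e.toCCLM T w)‖ := K.le_opNorm _
    _ ≤ (‖K‖ + 1) * (M * ((‖H2e.toCCLM T‖ + 1) * ‖w‖) ^ 2) := by
      gcongr
      · linarith
      · exact h2.trans (by gcongr)
    _ = _ := by ring

theorem exists_norm_siteForce_add_sub_sub_le (h0 : g 0 = 0) (h2 : deriv (deriv g) 0 = 0) (R : ℝ) :
    ∃ M > 0, ∀ v w : H2e T, ‖v‖ ≤ R → ‖w‖ ≤ R →
      ‖siteForce K hg (v + w) - siteForce K hg v - siteForce K hg w‖ ≤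
        M * (‖v‖ * ‖w‖ * (‖v‖ + ‖w‖)) := by
  set J : ℝ := ‖H2e.toCCLM T‖ + 1 with hJ
  obtain ⟨M, hM0, hM⟩ := exists_abs_add_sub_sub_le hg h0 h2 (J * max R 0)
  refine ⟨(‖K‖ + 1) * (M * J ^ 3), by positivity, fun v w hv hw => ?_⟩
  have hb : ∀ w : H2e T, ∀ t, |H2e.toCCLM T w t| ≤ J * ‖w‖ := fun w t =>
    ((H2e.toCCLM T w).norm_coe_le_norm t).trans
      (((H2e.toCCLM T).le_opNorm w).trans (by gcongr; linarith))
  have hbR : ∀ w : H2e T, ‖w‖ ≤ R → ∀ t, |H2e.toCCLM T w t| ≤ J * max R 0 := fun w hw t =>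
    (hb w t).trans (by gcongr; exact hw.trans (le_max_left _ _))
  have hsup : ‖superpose hg (H2e.toCCLM T v + H2e.toCCLM T w) - superpose hg (H2e.toCCLM T v) -
      superpose hg (H2e.toCCLM T w)‖ ≤
      M * ((J * ‖v‖) * (J * ‖w‖) * (J * ‖v‖ + J * ‖w‖)) := by
    refine (ContinuousMap.norm_le _ (by positivity)).2 fun t => ?_
    refine (hM _ _ (hbR v hv t) (hbR w hw t)).trans ?_
    have h3 := hb v t
    have h4 := hb w t
    gcongr
  have he : siteForce K hg (v + w) - siteForce K hg v - siteForce K hg w =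
      K (superpose hg (H2e.toCCLM T v + H2e.toCCLM T w) - superpose hg (H2e.toCCLM T v) -
        superpose hg (H2e.toCCLM T w)) := by
    rw [map_sub, map_sub, ← map_add]
    rfl
  rw [he]
  calc _ ≤ ‖K‖ * _ := K.le_opNorm _
    _ ≤ (‖K‖ + 1) * (M * ((J * ‖v‖) * (J * ‖w‖) * (J * ‖v‖ + J * ‖w‖))) := by
      gcongr
      linarith
    _ = _ := by ring

/-- Linearisation of the nonlinear term, with the coefficient frozen at a nearby state `v₀`. -/
theorem exists_norm_siteForce_add_sub_linear_le (R : ℝ) :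
    ∃ M > 0, ∀ v₀ v w : H2e T, ‖v₀‖ ≤ R → ‖v‖ ≤ R → ‖w‖ ≤ R →
      ‖siteForce K hg (v + w) - siteForce K hg v -
          K (superpose hg.infty_deriv (H2e.toCCLM T v₀) * H2e.toCCLM T w)‖ ≤
        M * (‖w‖ ^ 2 + ‖v - v₀‖ * ‖w‖) := by
  set J : ℝ := ‖H2e.toCCLM T‖ + 1 with hJ
  obtain ⟨M, hM0, hM⟩ := exists_norm_superpose_sub_sub_le (S := AddCircle T) hg (J * (2 * R))
  obtain ⟨M', hM'0, hM'⟩ := exists_norm_superpose_sub_le (S := AddCircle T) hg.infty_deriv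
    (J * (2 * R))
  refine ⟨(‖K‖ + 1) * ((M + M') * J ^ 2), by positivity, fun v₀ v w hv₀ hv hw => ?_⟩
  have hR : 0 ≤ R := (norm_nonneg _).trans hv
  have hb : ∀ w : H2e T, ‖H2e.toCCLM T w‖ ≤ J * ‖w‖ := fun w =>
    ((H2e.toCCLM T).le_opNorm w).trans (by gcongr; linarith)
  have hbR : ∀ w : H2e T, ‖w‖ ≤ 2 * R → ‖H2e.toCCLM T w‖ ≤ J * (2 * R) := fun w hw =>
    (hb w).trans (by gcongr)
  have h1 := hM (H2e.toCCLM T v) (H2e.toCCLM T w) (hbR v (by linarith)) (by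
    rw [← map_add]
    exact hbR _ ((norm_add_le _ _).trans (by linarith)))
  have h2 := hM' (H2e.toCCLM T v) (H2e.toCCLM T v₀) (hbR v (by linarith)) (hbR v₀ (by linarith))
  rw [← map_sub] at h2
  have he : siteForce K hg (v + w) - siteForce K hg v -
      K (superpose hg.infty_deriv (H2e.toCCLM T v₀) * H2e.toCCLM T w) =
      K ((superpose hg (H2e.toCCLM T v + H2e.toCCLM T w) - superpose hg (H2e.toCCLM T v) -
        superpose hg.infty_deriv (H2e.toCCLM T v) * H2e.toCCLM T w) +
        (superpose hg.infty_deriv (H2e.toCCLM T v) - superpose hg.infty_deriv (H2e.toCCLM T v₀)) *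
          H2e.toCCLM T w) := by
    rw [siteForce, siteForce, map_add (H2e.toCCLM T), ← map_sub, ← map_sub]
    congr 1
    ring
  rw [he]
  refine (K.le_opNorm _).trans ?_
  have h3 : ‖(superpose hg (H2e.toCCLM T v + H2e.toCCLM T w) - superpose hg (H2e.toCCLM T v) -
        superpose hg.infty_deriv (H2e.toCCLM T v) * H2e.toCCLM T w) +
        (superpose hg.infty_deriv (H2e.toCCLM T v) - superpose hg.infty_deriv (H2e.toCCLM T v₀)) *
          H2e.toCCLM T w‖ ≤ M * (J * ‖w‖) ^ 2 + M' * (J * ‖v - v₀‖) * (J * ‖w‖) := by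
    refine (norm_add_le _ _).trans (add_le_add (h1.trans ?_) ((norm_mul_le _ _).trans ?_))
    · have := hb w
      gcongr
    · have h4 := hb w
      have h5 := h2.trans (mul_le_mul_of_nonneg_left (hb (v - v₀)) hM'0.le)
      gcongr
  calc ‖K‖ * _ ≤ (‖K‖ + 1) * (M * (J * ‖w‖) ^ 2 + M' * (J * ‖v - v₀‖) * (J * ‖w‖)) := by
        gcongr
        linarith
    _ ≤ (‖K‖ + 1) * ((M + M') * (J * ‖w‖) ^ 2 + (M + M') * (J * ‖v - v₀‖) * (J * ‖w‖)) := by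
        gcongr <;> linarith
    _ = _ := by ring

end SiteEstimates

/-! ### Decay of the fundamental breather away from the excited site -/

section Breather

variable {T : ℝ} [Fact (0 < T)]

open Classical in
/-- The restriction of a sequence to a set of sites, extended by zero. -/
noncomputable def latticeRestrict (S : Set ℤ) : LatticeSpace T →L[ℝ] LatticeSpace T :=
  lp.mapCLM 2 (fun n : ℤ => if n ∈ S then ContinuousLinearMap.id ℝ (H2e T) else 0) zero_le_one
    (fun n => by
      split_ifs
      · exact ContinuousLinearMap.norm_id_le
      · exact (norm_zero (E := H2e T →L[ℝ] H2e T)).trans_le zero_le_one)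

open Classical in
theorem latticeRestrict_apply_of_mem {S : Set ℤ} {n : ℤ} (h : n ∈ S) (u : LatticeSpace T) :
    latticeRestrict S u n = u n := by
  change (if n ∈ S then ContinuousLinearMap.id ℝ (H2e T) else 0) (u n) = _
  rw [if_pos h]
  rfl

open Classical in
theorem latticeRestrict_apply_of_notMem {S : Set ℤ} {n : ℤ} (h : n ∉ S) (u : LatticeSpace T) :
    latticeRestrict S u n = 0 := by
  change (if n ∈ S then ContinuousLinearMap.id ℝ (H2e T) else 0) (u n) = _
  rw [if_neg h]
  rfl

theorem norm_latticeRestrict_le (S : Set ℤ) (u : LatticeSpace T) : ‖latticeRestrict S u‖ ≤ ‖u‖ := by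
  have := lp_norm_le_mul (latticeRestrict S u) u zero_le_one fun n => by
    rw [one_mul]
    by_cases h : n ∈ S
    · rw [latticeRestrict_apply_of_mem h]
    · rw [latticeRestrict_apply_of_notMem h, norm_zero]
      exact norm_nonneg _
  rwa [one_mul] at this

theorem atSite_apply_self (k : ℤ) (f : H2e T) : atSite k f k = f :=
  lp.single_apply_self (E := fun _ : ℤ => H2e T) 2 k f

theorem atSite_apply_ne {k n : ℤ} (h : n ≠ k) (f : H2e T) : atSite k f n = 0 :=
  lp.single_apply_ne (E := fun _ : ℤ => H2e T) 2 k f h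

variable {V : ℝ → ℝ} {K : C(AddCircle T, ℝ) →L[ℝ] H2e T}
  {hN : ContDiff ℝ ∞ (nonlinearForce V)} {h0 : nonlinearForce V 0 = 0}

theorem kgMap_eq_zero_apply {ε : ℝ} {u : LatticeSpace T} (h : kgMap K hN h0 (ε, u) = 0) (n : ℤ) :
    u n = -siteForce K hN (u n) +
      ε • K (H2e.toCCLM T (u (n + 1) - (2 : ℝ) • u n + u (n - 1))) := by
  have h1 := kgMap_apply hN h0 ε u n (K := K)
  rw [h] at h1
  have h2 : u n + siteForce K hN (u n) -
      ε • K (H2e.toCCLM T (u (n + 1) - (2 : ℝ) • u n + u (n - 1))) = 0 := h1.symm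
  rw [sub_eq_zero] at h2
  rw [← h2]
  abel

/-- The breather is of order `ε^m` at distance at least `m` from the excited site: the nonlinearity
is quadratically small there, so each further site costs one power of the coupling. -/
theorem breather_decay (h1 : deriv (nonlinearForce V) 0 = 0) {φ : H2e T} {Φ : ℝ → LatticeSpace T}
    (hsol : ∀ᶠ ε in 𝓝 (0 : ℝ), kgMap K hN h0 (ε, Φ ε) = 0)
    (hΦ : (fun ε => Φ ε - atSite 0 φ) =O[𝓝 0] fun ε : ℝ => ε) (m : ℕ) :
    (fun ε => latticeRestrict {n : ℤ | (m : ℤ) ≤ |n|} (Φ ε)) =O[𝓝 0] fun ε : ℝ => ε ^ m := by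
  induction m with
  | zero =>
    refine IsBigO.of_bound (‖atSite 0 φ‖ + 1) ?_
    filter_upwards [eventually_norm_le_of_isBigO_sub hΦ] with ε hε
    rw [pow_zero, norm_one, mul_one]
    exact (norm_latticeRestrict_le _ _).trans hε
  | succ m ih =>
    set S : Set ℤ := {n : ℤ | ((m + 1 : ℕ) : ℤ) ≤ |n|} with hS
    set S' : Set ℤ := {n : ℤ | (m : ℤ) ≤ |n|} with hS'
    have hsub : ∀ ε, ‖latticeRestrict S (Φ ε)‖ ≤ ‖Φ ε - atSite 0 φ‖ := fun ε => by
      have hz : latticeRestrict S (atSite 0 φ) = 0 := by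
        ext1
        funext n
        change _ = (0 : H2e T)
        by_cases hn : n ∈ S
        · rw [latticeRestrict_apply_of_mem hn, atSite_apply_ne]
          rintro rfl
          rw [hS, Set.mem_ofPred_eq, abs_zero] at hn
          omega
        · rw [latticeRestrict_apply_of_notMem hn]
      have h2 := norm_latticeRestrict_le S (Φ ε - atSite 0 φ)
      rwa [map_sub, hz, sub_zero] at h2
    obtain ⟨M, hM0, hM⟩ := exists_norm_siteForce_le_sq K hN h0 h1 1
    have hsmall : ∀ᶠ ε in 𝓝 (0 : ℝ), ‖Φ ε - atSite 0 φ‖ ≤ min 1 (1 / (2 * M)) := by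
      have h2 := (hΦ.trans_tendsto (continuous_id.tendsto' (0 : ℝ) 0 rfl)).norm
      rw [norm_zero] at h2
      exact h2.eventually_le_const (by positivity)
    have hbound : ∀ᶠ ε in 𝓝 (0 : ℝ), ‖latticeRestrict S (Φ ε)‖ ≤
        2 * (‖latticeLaplacian K‖ * (|ε| * ‖latticeRestrict S' (Φ ε)‖)) := by
      filter_upwards [hsol, hsmall] with ε hε hs
      set v := latticeRestrict S (Φ ε) with hv
      have hv1 : ‖v‖ ≤ min 1 (1 / (2 * M)) := (hsub ε).trans hs
      set q := latticeRestrict S (ε • latticeLaplacian K (latticeRestrict S' (Φ ε))) with hq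
      have hvq : ‖v - q‖ ≤ 1 / 2 * ‖v‖ := by
        refine lp_norm_le_mul _ _ (by norm_num) fun n => ?_
        rw [lp.coeFn_sub, Pi.sub_apply]
        by_cases hn : n ∈ S
        · have hnb : ∀ i : ℤ, |i| ≤ 1 → latticeRestrict S' (Φ ε) (n + i) = Φ ε (n + i) :=
            fun i hi => by
              refine latticeRestrict_apply_of_mem ?_ _
              rw [hS, Set.mem_ofPred_eq] at hn
              have h3 : |n| ≤ |n + i| + |i| := by
                calc |n| = |n + i - i| := by rw [add_sub_cancel_right]
                  _ ≤ _ := abs_sub _ _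
              rw [hS', Set.mem_ofPred_eq]
              push_cast at hn
              linarith
          have e1 := hnb 1 (by simp)
          have e2 := hnb 0 (by simp)
          have e3 := hnb (-1) (by simp)
          rw [add_zero] at e2
          rw [← sub_eq_add_neg] at e3
          have hvn : v n = Φ ε n := latticeRestrict_apply_of_mem hn _
          have hqn : q n = ε • K (H2e.toCCLM T (Φ ε (n + 1) - (2 : ℝ) • Φ ε n + Φ ε (n - 1))) := by
            rw [hq, latticeRestrict_apply_of_mem hn, lp.coeFn_smul, Pi.smul_apply,
              latticeLaplacian_apply, e1, e2, e3]
          have h4 := kgMap_eq_zero_apply hε n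
          rw [← hqn, ← hvn] at h4
          have h5 : v n - q n = -siteForce K hN (v n) := by
            rw [sub_eq_iff_eq_add]
            exact h4
          rw [h5, norm_neg]
          have hvn1 := (lp_norm_apply_le v n).trans hv1
          refine (hM (v n) (hvn1.trans (min_le_left _ _))).trans ?_
          have h6 := hvn1.trans (min_le_right _ _)
          rw [le_div_iff₀ (by positivity)] at h6
          nlinarith [norm_nonneg (v n)]
        · rw [hv, hq, latticeRestrict_apply_of_notMem hn, latticeRestrict_apply_of_notMem hn,
            sub_zero, norm_zero, mul_zero]
      have hqb : ‖q‖ ≤ ‖latticeLaplacian K‖ * (|ε| * ‖latticeRestrict S' (Φ ε)‖) := by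
        refine (norm_latticeRestrict_le _ _).trans ?_
        rw [norm_smul, Real.norm_eq_abs, mul_left_comm]
        exact mul_le_mul_of_nonneg_left ((latticeLaplacian K).le_opNorm _) (abs_nonneg _)
      have h7 : ‖v‖ ≤ ‖v - q‖ + ‖q‖ := by
        calc ‖v‖ = ‖v - q + q‖ := by rw [sub_add_cancel]
          _ ≤ _ := norm_add_le _ _
      linarith
    refine IsBigO.trans (IsBigO.of_bound (2 * ‖latticeLaplacian K‖)
      (g := fun ε : ℝ => ε * ‖latticeRestrict S' (Φ ε)‖) ?_) ?_
    · filter_upwards [hbound] with ε hε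
      rw [norm_mul, norm_norm, Real.norm_eq_abs]
      linarith
    · exact ((isBigO_refl (fun ε : ℝ => ε) (𝓝 0)).mul ih.norm_left).congr_right
        fun ε => (pow_succ' ε m).symm

/-- The breather at a site at distance `|n|`, to every order up to `|n|`. -/
theorem breather_apply_isBigO (h1 : deriv (nonlinearForce V) 0 = 0) {φ : H2e T}
    {Φ : ℝ → LatticeSpace T} (hsol : ∀ᶠ ε in 𝓝 (0 : ℝ), kgMap K hN h0 (ε, Φ ε) = 0)
    (hΦ : (fun ε => Φ ε - atSite 0 φ) =O[𝓝 0] fun ε : ℝ => ε) {m : ℕ} {n : ℤ} (hn : (m : ℤ) ≤ |n|) :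
    (fun ε => Φ ε n) =O[𝓝 0] fun ε : ℝ => ε ^ m := by
  refine IsBigO.trans (IsBigO.of_bound 1 (.of_forall fun ε => ?_)) (breather_decay h1 hsol hΦ m)
  rw [one_mul, ← latticeRestrict_apply_of_mem (show n ∈ {n : ℤ | (m : ℤ) ≤ |n|} from hn) (Φ ε)]
  exact lp_norm_apply_le _ n

/-- The leading term of the breather at distance `m` from the excited site is `ε^m φ_m`, where
`L₀ φ_m = φ_{m-1}`. -/
theorem breather_leading_term (h1 : deriv (nonlinearForce V) 0 = 0) {Φ : ℝ → LatticeSpace T}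
    {φs : ℕ → H2e T} (hsol : ∀ᶠ ε in 𝓝 (0 : ℝ), kgMap K hN h0 (ε, Φ ε) = 0)
    (hΦ : (fun ε => Φ ε - atSite 0 (φs 0)) =O[𝓝 0] fun ε : ℝ => ε) {s : ℤ} (hs : s = 1 ∨ s = -1)
    (m : ℕ) (hφs : ∀ i < m, φs (i + 1) = K (H2e.toCCLM T (φs i))) :
    (fun ε => Φ ε (s * m) - ε ^ m • φs m) =O[𝓝 0] fun ε : ℝ => ε ^ (m + 1) := by
  have habs : ∀ i : ℕ, |s * i| = i := fun i => by
    rcases hs with rfl | rfl <;> simp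
  induction m with
  | zero =>
    refine IsBigO.trans (IsBigO.of_bound 1 (.of_forall fun ε => ?_)) (by simpa using hΦ)
    rw [one_mul, Nat.cast_zero, mul_zero, pow_zero, one_smul]
    have := lp_norm_apply_le (Φ ε - atSite 0 (φs 0)) 0
    rwa [lp.coeFn_sub, Pi.sub_apply, atSite_apply_self] at this
  | succ m ih =>
    have ih' := ih fun i hi => hφs i (by omega)
    have hstep := hφs m (by omega)
    set A := K ∘L H2e.toCCLM T with hA
    have hO1 : (fun ε => Φ ε (s * (m + 1 : ℕ))) =O[𝓝 0] fun ε : ℝ => ε ^ (m + 1) :=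
      breather_apply_isBigO h1 hsol hΦ (habs _).ge
    have hO2 : (fun ε => Φ ε (s * (m + 2 : ℕ))) =O[𝓝 0] fun ε : ℝ => ε ^ (m + 1) :=
      breather_apply_isBigO h1 hsol hΦ (by rw [habs]; push_cast; linarith)
    obtain ⟨R, hR0, hR⟩ := eventually_norm_le_of_isBigO_pow hO1
    obtain ⟨M, hM0, hM⟩ := exists_norm_siteForce_le_sq K hN h0 h1 R
    have hk : (fun ε => siteForce K hN (Φ ε (s * (m + 1 : ℕ)))) =O[𝓝 0]
        fun ε : ℝ => ε ^ (m + 1 + 1) := by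
      refine IsBigO.trans (IsBigO.of_bound M (g := fun ε => ‖Φ ε (s * (m + 1 : ℕ))‖ ^ 2) ?_) ?_
      · filter_upwards [hR] with ε hε
        rw [norm_pow, norm_norm]
        exact hM _ hε
      · refine (hO1.norm_left.pow 2).trans ?_
        refine (isBigO_pow_of_le (m := m + 1 + 1) (n := (m + 1) * 2) (by omega)).congr_left ?_
        intro ε
        rw [pow_mul]
    have hlin : ∀ {F : ℝ → H2e T}, F =O[𝓝 0] (fun ε : ℝ => ε ^ (m + 1)) →
        (fun ε => ε • A (F ε)) =O[𝓝 0] fun ε : ℝ => ε ^ (m + 1 + 1) := fun {F} hF => by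
      refine ((isBigO_refl (fun ε : ℝ => ε) (𝓝 0)).smul ((A.isBigO_comp F _).trans hF)).congr_right
        fun ε => ?_
      rw [smul_eq_mul, ← pow_succ']
    have hO1' : (fun ε => (2 : ℝ) • Φ ε (s * (m + 1 : ℕ))) =O[𝓝 0] fun ε : ℝ => ε ^ (m + 1) :=
      hO1.const_smul_left (2 : ℝ)
    have hsum := (hk.neg_left.add (hlin (hO2.sub hO1'))).add (hlin ih')
    refine hsum.congr' ?_ EventuallyEq.rfl
    filter_upwards [hsol] with ε hε
    have h3 := kgMap_eq_zero_apply hε (s * (m + 1 : ℕ))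
    have hnb : Φ ε (s * (m + 1 : ℕ) + 1) - (2 : ℝ) • Φ ε (s * (m + 1 : ℕ)) +
        Φ ε (s * (m + 1 : ℕ) - 1) =
        (Φ ε (s * (m + 2 : ℕ)) - (2 : ℝ) • Φ ε (s * (m + 1 : ℕ))) + Φ ε (s * m) := by
      rcases hs with rfl | rfl
      · have e1 : (1 : ℤ) * (m + 1 : ℕ) + 1 = 1 * (m + 2 : ℕ) := by push_cast; ring
        have e2 : (1 : ℤ) * (m + 1 : ℕ) - 1 = 1 * m := by push_cast; ring
        rw [e1, e2]
      · have e1 : (-1 : ℤ) * (m + 1 : ℕ) + 1 = -1 * m := by push_cast; ring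
        have e2 : (-1 : ℤ) * (m + 1 : ℕ) - 1 = -1 * (m + 2 : ℕ) := by push_cast; ring
        rw [e1, e2]
        abel
    rw [hnb] at h3
    have hA' : ∀ x, K (H2e.toCCLM T x) = A x := fun x => rfl
    conv_rhs => rw [h3]
    rw [hstep, hA', hA', map_sub A (Φ ε (s * m)), map_add A _ (Φ ε (s * m)), map_smul A (ε ^ m),
      smul_add, smul_sub _ (A (Φ ε (s * m))), smul_smul, ← pow_succ']
    abel

end Breather

/-! ### The residual of the superposition of two breathers -/

section Residual

variable {T : ℝ} [Fact (0 < T)]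

/-- A bound for a family of sequences follows from bounds at finitely many sites and a bound for the
rest of the sequence. -/
theorem isBigO_of_latticeRestrict {F : ℝ → LatticeSpace T} {f : ℝ → ℝ} (S : Finset ℤ)
    (hS : ∀ n ∈ S, (fun ε => F ε n) =O[𝓝 0] f)
    (hF : (fun ε => latticeRestrict {n : ℤ | n ∉ S} (F ε)) =O[𝓝 0] f) : F =O[𝓝 0] f := by
  have hsingle : ∀ n ∈ S, (fun ε => atSite n (F ε n)) =O[𝓝 0] f := fun n hn => by
    refine IsBigO.trans (IsBigO.of_bound 1 (.of_forall fun ε => ?_)) (hS n hn)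
    rw [one_mul]
    exact (lp.norm_single (by norm_num) n _).le
  refine (hF.add (IsBigO.fun_sum hsingle)).congr_left fun ε => ?_
  ext1
  funext m
  rw [lp.coeFn_add, Pi.add_apply, lp.coeFn_sum, Finset.sum_apply]
  by_cases hm : m ∈ S
  · rw [Finset.sum_eq_single m (fun n _ hn => atSite_apply_ne hn.symm _)
      (fun h => absurd hm h), atSite_apply_self,
      latticeRestrict_apply_of_notMem (by simpa using hm), zero_add]
  · rw [latticeRestrict_apply_of_mem (by simpa using hm), Finset.sum_eq_zero, add_zero]
    intro n hn
    exact atSite_apply_ne (ne_of_mem_of_not_mem hn hm).symm _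

variable {V : ℝ → ℝ} {K : C(AddCircle T, ℝ) →L[ℝ] H2e T}
  {hN : ContDiff ℝ ∞ (nonlinearForce V)} {h0 : nonlinearForce V 0 = 0}

theorem siteForce_smul (hodd : ∀ x, nonlinearForce V (-x) = -nonlinearForce V x) {σ : ℝ}
    (hσ : σ = 1 ∨ σ = -1) (w : H2e T) : siteForce K hN (σ • w) = σ • siteForce K hN w := by
  rcases hσ with rfl | rfl
  · rw [one_smul, one_smul]
  · rw [neg_one_smul, neg_one_smul, siteForce, map_neg, superpose_neg_of_odd _ hodd, map_neg]
    rfl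

/-- The lattice equation is invariant under translations and sign changes. -/
theorem kgMap_smul_latticeShift (hodd : ∀ x, nonlinearForce V (-x) = -nonlinearForce V x) {σ : ℝ}
    (hσ : σ = 1 ∨ σ = -1) (j : ℤ) (ε : ℝ) (u : LatticeSpace T) :
    kgMap K hN h0 (ε, σ • latticeShift j u) = σ • latticeShift j (kgMap K hN h0 (ε, u)) := by
  ext1
  funext n
  rw [kgMap_apply, lp.coeFn_smul, lp.coeFn_smul, Pi.smul_apply, Pi.smul_apply, Pi.smul_apply,
    Pi.smul_apply, latticeShift_apply, latticeShift_apply, latticeShift_apply, latticeShift_apply,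
    kgMap_apply, show n + 1 - j = n - j + 1 by ring, sub_right_comm n 1 j]
  have h1 := siteForce_smul (K := K) (hN := hN) hodd hσ (u (n - j))
  have h2 : σ • u (n - j + 1) - (2 : ℝ) • σ • u (n - j) + σ • u (n - j - 1) =
      σ • (u (n - j + 1) - (2 : ℝ) • u (n - j) + u (n - j - 1)) := by
    rw [smul_add, smul_sub, smul_comm]
  rw [siteForce, siteForce] at h1
  rw [h1, h2, map_smul, map_smul, smul_comm ε σ, ← smul_add, ← smul_sub]

/-- At an excited site, the tail `z ≈ ε^N p` of the other breather feeds the linearisation at the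
excited state `v₀`: the response is `ε^N q`, where `q` solves the linearised equation with the
source of `p`. Hence adding `ε^N (q - p)` cancels the interaction to leading order. -/
theorem excited_site_isBigO {g : ℝ → ℝ} {hg : ContDiff ℝ ∞ g} (hg0 : g 0 = 0) (hg1 : deriv g 0 = 0)
    {N : ℕ} (hN1 : 1 ≤ N) {v₀ p q : H2e T}
    (hq : q + K (superpose hg.infty_deriv (H2e.toCCLM T v₀) * H2e.toCCLM T q) = p)
    {x z : ℝ → H2e T} (hx : (fun ε => x ε - v₀) =O[𝓝 0] fun ε : ℝ => ε)
    (hz : (fun ε => z ε - ε ^ N • p) =O[𝓝 0] fun ε : ℝ => ε ^ (N + 1)) :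
    (fun ε => siteForce K hg (x ε + (z ε + ε ^ N • (q - p))) - siteForce K hg (x ε) -
      siteForce K hg (z ε) + ε ^ N • (q - p)) =O[𝓝 0] fun ε : ℝ => ε ^ (N + 1) := by
  have hpow : ∀ r : H2e T, (fun ε : ℝ => ε ^ N • r) =O[𝓝 0] fun ε : ℝ => ε ^ N := fun r => by
    refine IsBigO.of_bound ‖r‖ (.of_forall fun ε => ?_)
    rw [norm_smul, mul_comm]
  have hzN : z =O[𝓝 0] fun ε : ℝ => ε ^ N := by
    refine ((hz.trans (isBigO_pow_of_le (Nat.le_succ N))).add (hpow p)).congr_left fun ε => ?_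
    rw [sub_add_cancel]
  set y : ℝ → H2e T := fun ε => z ε + ε ^ N • (q - p) with hy
  have hyN : y =O[𝓝 0] fun ε : ℝ => ε ^ N := hzN.add (hpow _)
  have hyq : (fun ε => y ε - ε ^ N • q) =O[𝓝 0] fun ε : ℝ => ε ^ (N + 1) := by
    refine hz.congr_left fun ε => ?_
    simp only [hy, smul_sub]
    abel
  have hsq : ∀ {F : ℝ → H2e T}, F =O[𝓝 0] (fun ε : ℝ => ε ^ N) →
      (fun ε => ‖F ε‖ ^ 2) =O[𝓝 0] fun ε : ℝ => ε ^ (N + 1) := fun {F} hF => by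
    refine (hF.norm_left.pow 2).trans ((isBigO_pow_of_le (m := N + 1) (n := N * 2)
      (by omega)).congr_left fun ε => ?_)
    rw [pow_mul]
  obtain ⟨Rz, hRz0, hRz⟩ := eventually_norm_le_of_isBigO_pow hzN
  obtain ⟨Ry, hRy0, hRy⟩ := eventually_norm_le_of_isBigO_pow hyN
  have hRx := eventually_norm_le_of_isBigO_sub hx
  -- the tail is so small that its own nonlinear force is of higher order
  have hforce : (fun ε => siteForce K hg (z ε)) =O[𝓝 0] fun ε : ℝ => ε ^ (N + 1) := by
    obtain ⟨M, -, hM⟩ := exists_norm_siteForce_le_sq K hg hg0 hg1 Rz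
    refine IsBigO.trans (IsBigO.of_bound M ?_) (hsq hzN)
    filter_upwards [hRz] with ε hε
    rw [norm_pow, norm_norm]
    exact hM _ hε
  set L : H2e T → H2e T := fun w =>
    K (superpose hg.infty_deriv (H2e.toCCLM T v₀) * H2e.toCCLM T w) with hL
  have hlin : (fun ε => siteForce K hg (x ε + y ε) - siteForce K hg (x ε) - L (y ε)) =O[𝓝 0]
      fun ε : ℝ => ε ^ (N + 1) := by
    obtain ⟨M, -, hM⟩ := exists_norm_siteForce_add_sub_linear_le K hg (‖v₀‖ + 1 + Ry)
    refine IsBigO.trans (IsBigO.of_bound M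
      (g := fun ε => ‖y ε‖ ^ 2 + ‖x ε - v₀‖ * ‖y ε‖) ?_) ((hsq hyN).add ?_)
    · filter_upwards [hRx, hRy] with ε hε hε'
      rw [Real.norm_of_nonneg (by positivity)]
      exact hM v₀ _ _ (by linarith) (by linarith) (by linarith [norm_nonneg v₀])
    · exact (hx.norm_left.mul hyN.norm_left).congr_right fun ε => (pow_succ' ε N).symm
  set A : H2e T →L[ℝ] H2e T := K ∘L ContinuousLinearMap.mul ℝ C(AddCircle T, ℝ)
    (superpose hg.infty_deriv (H2e.toCCLM T v₀)) ∘L H2e.toCCLM T with hA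
  have hAL : ∀ w, L w = A w := fun w => rfl
  have hres := (A.isBigO_comp (fun ε => y ε - ε ^ N • q) (𝓝 0)).trans hyq
  refine ((hlin.sub hforce).add hres).congr_left fun ε => ?_
  have hq' : A q = p - q := by rw [← hq, ← hAL, hL]; abel
  change _ = siteForce K hg (x ε + y ε) - _ - _ + _
  rw [map_sub, map_smul, hq', hAL, smul_sub, smul_sub]
  generalize siteForce K hg (x ε + y ε) = s
  abel

/-- The approximate two-site solution built from the fundamental breather `Φ ε` solves the lattice
equation up to an error of order `ε^(N+1)`. -/
theorem kgMap_superposition_isBigO (hodd : ∀ x, nonlinearForce V (-x) = -nonlinearForce V x)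
    (h1 : deriv (nonlinearForce V) 0 = 0) (h2 : deriv (deriv (nonlinearForce V)) 0 = 0)
    {Φ : ℝ → LatticeSpace T} {φs : ℕ → H2e T} {ψ : H2e T} {N : ℕ} {j k : ℤ} (hjk : j ≠ k)
    (hd : (N : ℤ) = |j - k|) {σj σk : ℝ} (hσj : σj = 1 ∨ σj = -1) (hσk : σk = 1 ∨ σk = -1)
    (hsol : ∀ᶠ ε in 𝓝 (0 : ℝ), kgMap K hN h0 (ε, Φ ε) = 0)
    (hΦ : (fun ε => Φ ε - atSite 0 (φs 0)) =O[𝓝 0] fun ε : ℝ => ε)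
    (hφs : ∀ i < N, φs (i + 1) = K (H2e.toCCLM T (φs i)))
    (hψ : ψ + K (superpose hN.infty_deriv (H2e.toCCLM T (φs 0)) * H2e.toCCLM T ψ) = φs N) :
    (fun ε => kgMap K hN h0 (ε, σj • latticeShift j (Φ ε) + σk • latticeShift k (Φ ε) +
      ε ^ N • (σj • atSite k (ψ - φs N) + σk • atSite j (ψ - φs N)))) =O[𝓝 0]
      fun ε : ℝ => ε ^ (N + 1) := by
  have hN1 : 1 ≤ N := by
    have := abs_pos.2 (sub_ne_zero.2 hjk)
    omega
  have hσn : ∀ {σ : ℝ}, (σ = 1 ∨ σ = -1) → ‖σ‖ = 1 := fun h => by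
    rcases h with rfl | rfl <;> simp
  set χ := ψ - φs N with hχ
  set U₁ : ℝ → LatticeSpace T := fun ε => σj • latticeShift j (Φ ε) with hU₁
  set U₂ : ℝ → LatticeSpace T := fun ε => σk • latticeShift k (Φ ε) with hU₂
  set R₀ : LatticeSpace T := σj • atSite k χ + σk • atSite j χ with hR₀
  have hU₁n : ∀ ε n, U₁ ε n = σj • Φ ε (n - j) := fun ε n => rfl
  have hU₂n : ∀ ε n, U₂ ε n = σk • Φ ε (n - k) := fun ε n => rfl
  have hR₀n : ∀ n, n ≠ j → n ≠ k → R₀ n = 0 := fun n hnj hnk => by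
    change σj • atSite k χ n + σk • atSite j χ n = 0
    rw [atSite_apply_ne hnj, atSite_apply_ne hnk, smul_zero, smul_zero, add_zero]
  have hR₀j : R₀ j = σk • χ := by
    change σj • atSite k χ j + σk • atSite j χ j = _
    rw [atSite_apply_ne hjk, atSite_apply_self, smul_zero, zero_add]
  have hR₀k : R₀ k = σj • χ := by
    change σj • atSite k χ k + σk • atSite j χ k = _
    rw [atSite_apply_ne hjk.symm, atSite_apply_self, smul_zero, add_zero]
  set P : LatticeSpace T → LatticeSpace T := latticeSuperpose (H2e.toCCLM T) K hN h0 with hP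
  set Err : ℝ → LatticeSpace T := fun ε =>
    P (U₁ ε + U₂ ε + ε ^ N • R₀) - P (U₁ ε) - P (U₂ ε) + ε ^ N • R₀ with hErr
  have hErrn : ∀ ε n, Err ε n = siteForce K hN (U₁ ε n + U₂ ε n + ε ^ N • R₀ n) -
      siteForce K hN (U₁ ε n) - siteForce K hN (U₂ ε n) + ε ^ N • R₀ n := fun ε n => rfl
  -- boundedness of the breather and decay of its translates
  have hB := eventually_norm_le_of_isBigO_sub hΦ
  set B := ‖atSite 0 (φs 0)‖ + 1 with hBdef
  have hB0 : 0 < B := by positivity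
  have hU₁B : ∀ ε, ‖Φ ε‖ ≤ B → ∀ n, ‖U₁ ε n‖ ≤ B := fun ε h n => by
    rw [hU₁n, norm_smul, hσn hσj, one_mul]
    exact (lp_norm_apply_le _ _).trans h
  have hU₂B : ∀ ε, ‖Φ ε‖ ≤ B → ∀ n, ‖U₂ ε n‖ ≤ B := fun ε h n => by
    rw [hU₂n, norm_smul, hσn hσk, one_mul]
    exact (lp_norm_apply_le _ _).trans h
  obtain ⟨M, hM0, hM⟩ := exists_norm_siteForce_add_sub_sub_le K hN h0 h2 B
  -- the excited sites
  have hexc : ∀ {σ σ' : ℝ}, (σ = 1 ∨ σ = -1) → (σ' = 1 ∨ σ' = -1) → ∀ {l : ℤ}, |l| = N →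
      (fun ε => siteForce K hN (σ • Φ ε 0 + (σ' • Φ ε l + ε ^ N • σ' • χ)) -
        siteForce K hN (σ • Φ ε 0) - siteForce K hN (σ' • Φ ε l) + ε ^ N • σ' • χ) =O[𝓝 0]
        fun ε : ℝ => ε ^ (N + 1) := fun {σ σ'} hσ hσ' {l} hl => by
    have hdeven : superpose hN.infty_deriv (H2e.toCCLM T (σ • φs 0)) =
        superpose hN.infty_deriv (H2e.toCCLM T (φs 0)) := by
      rcases hσ with rfl | rfl
      · rw [one_smul]
      · rw [neg_one_smul, map_neg]
        ext t
        have h3 := deriv_comp_neg (nonlinearForce V) (H2e.toCCLM T (φs 0) t)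
        rw [funext hodd, deriv.fun_neg, neg_inj] at h3
        exact h3.symm
    have hq : σ' • ψ + K (superpose hN.infty_deriv (H2e.toCCLM T (σ • φs 0)) *
        H2e.toCCLM T (σ' • ψ)) = σ' • φs N := by
      rw [hdeven, map_smul, mul_smul_comm, map_smul, ← smul_add, hψ]
    have hx : (fun ε => σ • Φ ε 0 - σ • φs 0) =O[𝓝 0] fun ε : ℝ => ε := by
      refine IsBigO.trans (IsBigO.of_bound 1 (.of_forall fun ε => ?_)) hΦ
      rw [← smul_sub, norm_smul, hσn hσ]
      gcongr
      have := lp_norm_apply_le (Φ ε - atSite 0 (φs 0)) 0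
      rwa [lp.coeFn_sub, Pi.sub_apply, atSite_apply_self] at this
    have hz : (fun ε => σ' • Φ ε l - ε ^ N • σ' • φs N) =O[𝓝 0] fun ε : ℝ => ε ^ (N + 1) := by
      have hl' : ∃ s : ℤ, (s = 1 ∨ s = -1) ∧ l = s * N := by
        rcases abs_choice l with h | h
        · exact ⟨1, Or.inl rfl, by rw [one_mul, ← hl, h]⟩
        · exact ⟨-1, Or.inr rfl, by rw [neg_one_mul, ← hl, h, neg_neg]⟩
      obtain ⟨s, hs, rfl⟩ := hl'
      refine ((breather_leading_term h1 hsol hΦ hs N hφs).const_smul_left σ').congr_left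
        fun ε => ?_
      rw [Pi.smul_apply, smul_sub, smul_comm]
    refine (excited_site_isBigO (hg := hN) h0 h1 hN1 hq hx hz).congr_left fun ε => ?_
    rw [hχ, smul_sub σ']
  have hErrO : Err =O[𝓝 0] fun ε : ℝ => ε ^ (N + 1) := by
    refine isBigO_of_latticeRestrict (Finset.Icc (j - N) (j + N)) (fun n _ => ?_) ?_
    · by_cases hnj : n = j
      · subst hnj
        refine (hexc hσj hσk (l := n - k) hd.symm).congr_left fun ε => ?_
        rw [hErrn, hU₁n, hU₂n, hR₀j, sub_self, add_assoc]
      by_cases hnk : n = k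
      · subst hnk
        refine (hexc hσk hσj (l := n - j) (by rw [abs_sub_comm, hd])).congr_left fun ε => ?_
        rw [hErrn, hU₁n, hU₂n, hR₀k, sub_self, sub_right_comm, add_assoc, add_left_comm]
      have hp : 1 ≤ |n - j| := by
        have := abs_pos.2 (sub_ne_zero.2 hnj)
        omega
      have hq : 1 ≤ |n - k| := by
        have := abs_pos.2 (sub_ne_zero.2 hnk)
        omega
      have hpq : |j - k| ≤ |n - j| + |n - k| := by
        rw [abs_sub_comm n j]
        exact abs_sub_le j n k
      have hexp : N + 1 ≤ (n - j).natAbs + (n - k).natAbs + 1 := by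
        simp only [Int.abs_eq_natAbs] at hpq hd
        omega
      have hOU : ∀ (l : ℤ) (σ : ℝ), (fun ε => σ • Φ ε (n - l)) =O[𝓝 0]
          fun ε : ℝ => ε ^ (n - l).natAbs := fun l σ =>
        (breather_apply_isBigO h1 hsol hΦ (Int.natCast_natAbs _).le).const_smul_left σ
      have hOj := hOU j σj
      have hOk := hOU k σk
      have h1j := hOj.trans (isBigO_pow_of_le (m := 1) (by omega))
      have h1k := hOk.trans (isBigO_pow_of_le (m := 1) (by omega))
      refine IsBigO.trans (IsBigO.of_bound M
        (g := fun ε => ‖U₁ ε n‖ * ‖U₂ ε n‖ * (‖U₁ ε n‖ + ‖U₂ ε n‖)) ?_) ?_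
      · filter_upwards [hB] with ε hε
        rw [Real.norm_of_nonneg (by positivity), hErrn, hR₀n n hnj hnk, smul_zero, add_zero,
          add_zero]
        exact hM _ _ (hU₁B ε hε n) (hU₂B ε hε n)
      · refine ((hOj.norm_left.mul hOk.norm_left).mul (h1j.norm_left.add h1k.norm_left)).trans ?_
        refine (isBigO_pow_of_le (m := N + 1)
          (n := (n - j).natAbs + (n - k).natAbs + 1) hexp).congr_left fun ε => ?_
        rw [pow_add, pow_add]
    · set S : Set ℤ := {n : ℤ | n ∉ Finset.Icc (j - N) (j + N)} with hS
      have hfar : ∀ n ∈ S, ((N + 1 : ℕ) : ℤ) ≤ |n - j| := fun n hn => by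
        rw [hS, Set.mem_ofPred_eq, Finset.mem_Icc] at hn
        rw [Int.abs_eq_natAbs]
        omega
      refine IsBigO.trans (IsBigO.of_bound (M * (B * (B + B))) ?_) (breather_decay h1 hsol hΦ (N + 1))
      filter_upwards [hB] with ε hε
      have key := lp_norm_le_mul (latticeRestrict S (Err ε))
        (latticeShift j (latticeRestrict {n : ℤ | ((N + 1 : ℕ) : ℤ) ≤ |n|} (Φ ε)))
        (C := M * (B * (B + B))) (by positivity) fun n => ?_
      · rwa [norm_latticeShift] at key
      by_cases hn : n ∈ S
      · have hnj : n ≠ j := by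
          rintro rfl
          have := hfar n hn
          rw [sub_self, abs_zero] at this
          omega
        have hnk : n ≠ k := by
          rintro rfl
          have := hfar n hn
          rw [abs_sub_comm, ← hd] at this
          omega
        rw [latticeRestrict_apply_of_mem hn, latticeShift_apply,
          latticeRestrict_apply_of_mem (S := {n : ℤ | ((N + 1 : ℕ) : ℤ) ≤ |n|}) (hfar n hn), hErrn, hR₀n n hnj hnk, smul_zero, add_zero,
          add_zero]
        refine (hM _ _ (hU₁B ε hε n) (hU₂B ε hε n)).trans ?_
        have e1 : ‖U₁ ε n‖ = ‖Φ ε (n - j)‖ := by rw [hU₁n, norm_smul, hσn hσj, one_mul]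
        have h3 := hU₁B ε hε n
        have h4 := hU₂B ε hε n
        calc M * (‖U₁ ε n‖ * ‖U₂ ε n‖ * (‖U₁ ε n‖ + ‖U₂ ε n‖))
            ≤ M * (‖U₁ ε n‖ * B * (B + B)) := by gcongr
          _ = _ := by rw [e1]; ring
      · rw [latticeRestrict_apply_of_notMem hn, norm_zero]
        positivity
  have hlap : (fun ε : ℝ => ε • latticeLaplacian K (ε ^ N • R₀)) =O[𝓝 0]
      fun ε : ℝ => ε ^ (N + 1) := by
    refine IsBigO.of_bound ‖latticeLaplacian K R₀‖ (.of_forall fun ε => ?_)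
    rw [map_smul, smul_smul, ← pow_succ', norm_smul, mul_comm]
  refine (hErrO.sub hlap).congr' ?_ EventuallyEq.rfl
  filter_upwards [hsol] with ε hε
  have hz₁ : kgMap K hN h0 (ε, U₁ ε) = 0 := by
    rw [hU₁, kgMap_smul_latticeShift hodd hσj, hε]
    exact smul_zero σj
  have hz₂ : kgMap K hN h0 (ε, U₂ ε) = 0 := by
    rw [hU₂, kgMap_smul_latticeShift hodd hσk, hε]
    exact smul_zero σk
  have hdef : ∀ w, kgMap K hN h0 (ε, w) = w + P w - ε • latticeLaplacian K w := fun w => rfl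
  rw [hdef] at hz₁ hz₂
  have hsum : kgMap K hN h0 (ε, U₁ ε + U₂ ε + ε ^ N • R₀) =
      (Err ε - ε • latticeLaplacian K (ε ^ N • R₀)) +
        (U₁ ε + P (U₁ ε) - ε • latticeLaplacian K (U₁ ε)) +
        (U₂ ε + P (U₂ ε) - ε • latticeLaplacian K (U₂ ε)) := by
    have hE : Err ε = P (U₁ ε + U₂ ε + ε ^ N • R₀) - P (U₁ ε) - P (U₂ ε) + ε ^ N • R₀ := rfl
    rw [hE]
    generalize ε ^ N • R₀ = R
    rw [hdef, map_add, map_add, smul_add, smul_add]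
    abel
  rw [hsum, hz₁, hz₂, add_zero, add_zero]

end Residual

/-! ### Continuation in the coupling constant and the expansion -/

section Continuation

variable {T : ℝ} [Fact (0 < T)]

theorem sub_taylorPoly_isBigO {Φ : ℝ → LatticeSpace T} {δ : ℝ} (hδ : 0 < δ)
    (hΦ : ContDiffOn ℝ ∞ Φ (Set.Ioo (-δ) δ)) (N : ℕ) :
    (fun ε => Φ ε - taylorPoly Φ N ε) =O[𝓝 0] fun ε : ℝ => ε ^ (N + 1) := by
  have hmem : (0 : ℝ) ∈ Set.Ioo (-δ) δ := ⟨neg_lt_zero.2 hδ, hδ⟩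
  have h1 := taylor_isLittleO (n := N + 1) (convex_Ioo (-δ) δ) hmem
    (hΦ.of_le (by exact_mod_cast le_top))
  rw [isOpen_Ioo.nhdsWithin_eq hmem] at h1
  simp only [sub_zero] at h1
  have h2 : (fun ε : ℝ => (((N + 1 : ℝ) * N.factorial)⁻¹ * ε ^ (N + 1)) •
      iteratedDerivWithin (N + 1) Φ (Set.Ioo (-δ) δ) 0) =O[𝓝 0] fun ε : ℝ => ε ^ (N + 1) := by
    refine IsBigO.of_bound (‖((N + 1 : ℝ) * N.factorial)⁻¹‖ *
      ‖iteratedDerivWithin (N + 1) Φ (Set.Ioo (-δ) δ) 0‖) (.of_forall fun ε => ?_)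
    rw [norm_smul, norm_mul, mul_right_comm]
  refine (h1.isBigO.add h2).congr_left fun ε => ?_
  have h3 : taylorWithinEval Φ N (Set.Ioo (-δ) δ) 0 ε = taylorPoly Φ N ε := by
    rw [taylor_within_apply, taylorPoly]
    refine Finset.sum_congr rfl fun i _ => ?_
    rw [iteratedDerivWithin_of_isOpen isOpen_Ioo hmem, sub_zero, div_eq_inv_mul]
  rw [taylorWithinEval_succ, h3, sub_zero]
  abel

variable {V : ℝ → ℝ} {K : C(AddCircle T, ℝ) →L[ℝ] H2e T}
  {hN : ContDiff ℝ ∞ (nonlinearForce V)} {h0 : nonlinearForce V 0 = 0}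

theorem IsContinuation.eventually_kgMap_eq_zero (hK : IsL0Inverse K) {u₀ : LatticeSpace T}
    {u : ℝ → LatticeSpace T} (h : IsContinuation V u₀ u) :
    ∀ᶠ ε in 𝓝 (0 : ℝ), kgMap K hN h0 (ε, u ε) = 0 := by
  obtain ⟨ε₀, hε₀, C, -, h⟩ := h
  filter_upwards [Metric.ball_mem_nhds (0 : ℝ) hε₀] with ε hε
  rw [mem_ball_zero_iff, Real.norm_eq_abs] at hε
  exact (solvesKleinGordon_iff hN h0 hK ε _).1 (h ε hε).1

theorem IsContinuation.sub_isBigO {u₀ : LatticeSpace T} {u : ℝ → LatticeSpace T}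
    (h : IsContinuation V u₀ u) : (fun ε => u ε - u₀) =O[𝓝 0] fun ε : ℝ => ε := by
  obtain ⟨ε₀, hε₀, C, -, h⟩ := h
  refine IsBigO.of_bound C ?_
  filter_upwards [Metric.ball_mem_nhds (0 : ℝ) hε₀] with ε hε
  rw [mem_ball_zero_iff, Real.norm_eq_abs] at hε
  exact (h ε hε).2

theorem tendsto_of_sub_isBigO {u₀ : LatticeSpace T} {u : ℝ → LatticeSpace T}
    (h : (fun ε => u ε - u₀) =O[𝓝 0] fun ε : ℝ => ε) : Tendsto u (𝓝 0) (𝓝 u₀) :=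
  tendsto_sub_nhds_zero_iff.1 (h.trans_tendsto (continuous_id.tendsto' (0 : ℝ) 0 rfl))

/-- A nondegenerate solution at zero coupling has a unique continuation, which is a smooth branch;
the distance of any nearby family to the branch is controlled by its residual. -/
theorem exists_continuation_branch (hK : IsL0Inverse K) {u₀ : LatticeSpace T}
    (hG : kgMap K hN h0 (0, u₀) = 0) (D : LatticeSpace T ≃L[ℝ] LatticeSpace T)
    (hD : HasFDerivAt (fun v => kgMap K hN h0 (0, v)) (D : LatticeSpace T →L[ℝ] LatticeSpace T) u₀) :
    HasUniqueContinuation V u₀ ∧ ∃ δ > 0, ∃ U : ℝ → LatticeSpace T,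
      ContDiffOn ℝ ∞ U (Set.Ioo (-δ) δ) ∧ ∀ W : ℝ → LatticeSpace T, Tendsto W (𝓝 0) (𝓝 u₀) →
        (fun ε => W ε - U ε) =O[𝓝 0] fun ε => kgMap K hN h0 (ε, W ε) := by
  obtain ⟨δ, hδ, r, hr, C, hC, U, hU0, hUc, hU⟩ :=
    exists_smooth_branch (contDiff_kgMap hN h0) hG D hD
  refine ⟨?_, δ, hδ, U, hUc, fun W hW => ?_⟩
  · have hmem : Set.Ioo (-δ) δ ∈ 𝓝 (0 : ℝ) := Ioo_mem_nhds (neg_lt_zero.2 hδ) hδ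
    have hUd : DifferentiableAt ℝ U 0 := (hUc.differentiableOn (by simp)).differentiableAt hmem
    have hUO := hUd.isBigO_sub
    simp only [hU0, sub_zero] at hUO
    obtain ⟨C₀, hC₀, hb⟩ := hUO.exists_pos
    obtain ⟨δ', hδ', hb'⟩ := Metric.eventually_nhds_iff.1 hb.bound
    refine ⟨min (min δ δ') (r / C₀), by positivity, C₀, hC₀, fun ε hε => ?_⟩
    have hε₁ : |ε| < δ := hε.trans_le ((min_le_left _ _).trans (min_le_left _ _))
    have hε₂ : |ε| < δ' := hε.trans_le ((min_le_left _ _).trans (min_le_right _ _))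
    have hε₃ : C₀ * |ε| < r := by
      rw [mul_comm]
      exact (lt_div_iff₀ hC₀).1 (hε.trans_le (min_le_right _ _))
    obtain ⟨hsol, huniq⟩ := hU ε hε₁
    refine ⟨U ε, ⟨(solvesKleinGordon_iff hN h0 hK ε _).2 hsol,
      hb' (by rwa [Real.dist_0_eq_abs])⟩, fun v hv => ?_⟩
    have h1 := huniq v (hv.2.trans_lt hε₃)
    rw [(solvesKleinGordon_iff hN h0 hK ε v).1 hv.1, norm_zero, mul_zero] at h1
    exact sub_eq_zero.1 (norm_le_zero_iff.1 h1)
  · refine IsBigO.of_bound C ?_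
    filter_upwards [Metric.ball_mem_nhds (0 : ℝ) hδ, hW.eventually (Metric.ball_mem_nhds u₀ hr)]
      with ε hε hWε
    rw [mem_ball_zero_iff, Real.norm_eq_abs] at hε
    rw [dist_eq_norm] at hWε
    exact (hU ε hε).2 _ hWε

theorem eventuallyEq_of_sub_isBigO_kgMap {u U : ℝ → LatticeSpace T}
    (hsol : ∀ᶠ ε in 𝓝 (0 : ℝ), kgMap K hN h0 (ε, u ε) = 0)
    (h : (fun ε => u ε - U ε) =O[𝓝 0] fun ε => kgMap K hN h0 (ε, u ε)) : u =ᶠ[𝓝 0] U := by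
  obtain ⟨C, hC⟩ := h.bound
  filter_upwards [hsol, hC] with ε hε hε'
  rw [hε, norm_zero, mul_zero] at hε'
  exact sub_eq_zero.1 (norm_le_zero_iff.1 hε')

theorem deriv_nonlinearForce_zero {s : ℝ}
    (hVexp : (fun x : ℝ => deriv V x - (x + s * x ^ 3)) =O[𝓝 0] (fun x : ℝ => x ^ 5))
    (h0 : nonlinearForce V 0 = 0) : deriv (nonlinearForce V) 0 = 0 := by
  have h1 : (fun x : ℝ => s * x ^ 3) =O[𝓝 0] fun x : ℝ => x ^ 2 :=
    (isBigO_pow_of_le (by norm_num)).const_mul_left s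
  have h2 : nonlinearForce V =O[𝓝 0] fun x : ℝ => x ^ 2 := by
    refine ((hVexp.trans (isBigO_pow_of_le (m := 2) (by norm_num))).add h1).congr_left fun x => ?_
    rw [nonlinearForce]
    ring
  have h3 : HasDerivAt (nonlinearForce V) 0 0 := by
    rw [hasDerivAt_iff_isLittleO]
    simp only [h0, sub_zero, smul_zero]
    exact h2.trans_isLittleO (by simpa using isLittleO_pow_pow (𝕜 := ℝ) one_lt_two)
  exact h3.deriv

end Continuation

theorem mainTheorem5
    -- the potential: smooth, even, `V'(u) = u ± u³ + O(u⁵)`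
    (V : ℝ → ℝ) (hV : ContDiff ℝ ∞ V) (hVeven : ∀ x, V (-x) = V x)
    (hVexp : ∃ s : ℝ, (s = 1 ∨ s = -1) ∧
      (fun x : ℝ => deriv V x - (x + s * x ^ 3)) =O[𝓝 0] (fun x : ℝ => x ^ 5))
    -- the energy level, its turning point, and the period
    (E a T : ℝ) [Fact (0 < T)] (hE : V 0 < E)
    (ha : IsLeast {x : ℝ | 0 < x ∧ V x = E} a)
    (hT : T = oscillatorPeriod V E)
    (hT' : deriv (oscillatorPeriod V) E ≠ 0)
    (hres : ∀ n : ℕ, T ≠ 2 * Real.pi * n)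
    -- the even periodic solution of the oscillator at this energy level
    (φ : H2e T) (hφ : SolvesOscillator V φ) (hφ0 : onReal φ 0 = a)
    -- the two excited sites
    (j k : ℤ) (hjk : j ≠ k) (N : ℕ) (hN : (N : ℤ) = |j - k|)
    (σj σk : ℝ) (hσj : σj = 1 ∨ σj = -1) (hσk : σk = 1 ∨ σk = -1) :
    -- the breathers and the solutions of the linear equations are well defined
    HasUniqueContinuation V (atSite 0 φ) ∧
    HasUniqueContinuation V (atSite j (σj • φ) + atSite k (σk • φ)) ∧
    (∀ f : H2e T, ∃! w : H2e T, SolvesL0 w f) ∧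
    (∀ f : H2e T, ∃! w : H2e T, SolvesLe V φ w f) ∧
    -- the expansion
    ∀ (Φ u : ℝ → LatticeSpace T) (φs : ℕ → H2e T) (ψ : H2e T),
      IsContinuation V (atSite 0 φ) Φ →
      IsContinuation V (atSite j (σj • φ) + atSite k (σk • φ)) u →
      φs 0 = φ → (∀ m : ℕ, 1 ≤ m → m ≤ N → SolvesL0 (φs m) (φs (m - 1))) →
      SolvesLe V φ ψ (φs (N - 1)) →
      (∃ ε₁ > 0, ContDiffOn ℝ ∞ Φ (Set.Ioo (-ε₁) ε₁)) ∧
      (fun ε : ℝ => u ε -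
        (σj • latticeShift j (taylorPoly Φ N ε) + σk • latticeShift k (taylorPoly Φ N ε) +
          ε ^ N • (σj • atSite k (ψ - φs N) + σk • atSite j (ψ - φs N))))
        =O[𝓝 0] (fun ε : ℝ => ε ^ (N + 1)) := by
  have hTpos : (0 : ℝ) < T := Fact.out
  have hg : ContDiff ℝ ∞ (nonlinearForce V) := contDiff_nonlinearForce hV
  have hodd : ∀ x, nonlinearForce V (-x) = -nonlinearForce V x := fun x => by
    rw [nonlinearForce, nonlinearForce, deriv_odd_of_even hVeven]
    ring
  have hg0 : nonlinearForce V 0 = 0 := by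
    rw [nonlinearForce, deriv_zero_of_even hVeven, sub_zero]
  have hg1 : deriv (nonlinearForce V) 0 = 0 := by
    obtain ⟨s, -, hs⟩ := hVexp
    exact deriv_nonlinearForce_zero hs hg0
  have hg2 : deriv (deriv (nonlinearForce V)) 0 = 0 := by
    refine deriv_zero_of_even fun x => ?_
    rw [deriv_nonlinearForce hV, deriv_nonlinearForce hV, deriv_deriv_even_of_even hVeven]
  obtain ⟨K, hK⟩ := exists_isL0Inverse (sin_half_ne_zero hTpos hres)
  -- `L_e` is invertible on even functions, because `T'(E) ≠ 0`
  obtain ⟨e, he⟩ := hK.exists_equiv (superpose hg.infty_deriv (H2e.toCCLM T φ))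
    (superpose_toCCLM_neg _ φ) fun w hw => by
      refine onReal_injective (funext fun t => ?_)
      refine linearized_eq_zero hV hVeven hE ha hTpos hT hT' hφ (onReal_neg φ)
        (onReal_add_period φ) hφ0 ?_ (onReal_neg w) (onReal_add_period w) t
      convert hw using 3
      rw [superpose_apply, deriv_nonlinearForce hV, H2e.toCCLM_apply_coe]
      ring
  have hLe : ∀ w f : H2e T, SolvesLe V φ w f ↔ e w = K (H2e.toCCLM T f) := fun w f => by
    rw [he, solvesLe_iff hg hV hK]
  have hφK := (solvesOscillator_iff hg hK φ).1 hφ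
  have hσφ : ∀ {σ : ℝ}, (σ = 1 ∨ σ = -1) → σ • φ = φ ∨ σ • φ = -φ := fun h => by
    rcases h with rfl | rfl
    · exact Or.inl (one_smul ℝ φ)
    · exact Or.inr (neg_one_smul ℝ φ)
  have hsites₁ : ∀ n, atSite 0 φ n = 0 ∨ atSite 0 φ n = φ ∨ atSite 0 φ n = -φ := fun n => by
    by_cases hn : n = 0
    · subst hn
      exact Or.inr (Or.inl (atSite_apply_self 0 φ))
    · exact Or.inl (atSite_apply_ne hn φ)
  set u₀ : LatticeSpace T := atSite j (σj • φ) + atSite k (σk • φ) with hu₀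
  have hsites₂ : ∀ n, u₀ n = 0 ∨ u₀ n = φ ∨ u₀ n = -φ := fun n => by
    have hn' : u₀ n = atSite j (σj • φ) n + atSite k (σk • φ) n := rfl
    rw [hn']
    by_cases hn : n = j
    · subst hn
      rw [atSite_apply_self, atSite_apply_ne hjk, add_zero]
      exact Or.inr (hσφ hσj)
    by_cases hn : n = k
    · subst hn
      rw [atSite_apply_self, atSite_apply_ne hjk.symm, zero_add]
      exact Or.inr (hσφ hσk)
    · rw [atSite_apply_ne ‹n ≠ j›, atSite_apply_ne hn, add_zero]
      exact Or.inl rfl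
  obtain ⟨D₁, hD₁⟩ := exists_equiv_hasFDerivAt_kgMap hg hg0 e he hodd hg1 hsites₁
  obtain ⟨D₂, hD₂⟩ := exists_equiv_hasFDerivAt_kgMap hg hg0 e he hodd hg1 hsites₂
  obtain ⟨hun₁, δ₁, hδ₁, U₁, hU₁c, hU₁⟩ := exists_continuation_branch hK
    (kgMap_zero_eq_zero hg hg0 hφK hodd hsites₁) D₁ hD₁
  obtain ⟨hun₂, -, -, U₂, -, hU₂⟩ := exists_continuation_branch hK
    (kgMap_zero_eq_zero hg hg0 hφK hodd hsites₂) D₂ hD₂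
  refine ⟨hun₁, hun₂, fun f => ?_, fun f => ?_, fun Φ u φs ψ hΦ hu hφs0 hφs hψ => ?_⟩
  · exact ⟨_, (solvesL0_iff hK _ f).2 rfl, fun w hw => (solvesL0_iff hK w f).1 hw⟩
  · refine ⟨e.symm (K (H2e.toCCLM T f)), (hLe _ f).2 (e.apply_symm_apply _), fun w hw => ?_⟩
    rw [← (hLe w f).1 hw, e.symm_apply_apply]
  subst hφs0
  have hN1 : 1 ≤ N := by
    have := abs_pos.2 (sub_ne_zero.2 hjk)
    omega
  have hΦsol := hΦ.eventually_kgMap_eq_zero (hN := hg) (h0 := hg0) hK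
  have husol := hu.eventually_kgMap_eq_zero (hN := hg) (h0 := hg0) hK
  have hΦU : Φ =ᶠ[𝓝 0] U₁ :=
    eventuallyEq_of_sub_isBigO_kgMap hΦsol (hU₁ Φ (tendsto_of_sub_isBigO hΦ.sub_isBigO))
  have huU : u =ᶠ[𝓝 0] U₂ :=
    eventuallyEq_of_sub_isBigO_kgMap husol (hU₂ u (tendsto_of_sub_isBigO hu.sub_isBigO))
  obtain ⟨δ, hδ, hΦc⟩ : ∃ δ > 0, ContDiffOn ℝ ∞ Φ (Set.Ioo (-δ) δ) := by
    obtain ⟨δ', hδ', h⟩ := Metric.eventually_nhds_iff.1 hΦU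
    refine ⟨min δ₁ δ', lt_min hδ₁ hδ', (hU₁c.mono ?_).congr fun ε hε => h ?_⟩
    · exact Set.Ioo_subset_Ioo (neg_le_neg (min_le_left _ _)) (min_le_left _ _)
    · rw [Real.dist_0_eq_abs]
      exact (abs_lt.2 hε).trans_le (min_le_right _ _)
  refine ⟨⟨δ, hδ, hΦc⟩, ?_⟩
  have hstep : ∀ i < N, φs (i + 1) = K (H2e.toCCLM T (φs i)) := fun i hi =>
    (solvesL0_iff hK _ _).1 (hφs (i + 1) (by omega) hi)
  have hψN : ψ + K (superpose hg.infty_deriv (H2e.toCCLM T (φs 0)) * H2e.toCCLM T ψ) = φs N := by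
    rw [(solvesLe_iff hg hV hK _ _ _).1 hψ, ← hstep (N - 1) (by omega), Nat.sub_add_cancel hN1]
  set R₀ : LatticeSpace T := σj • atSite k (ψ - φs N) + σk • atSite j (ψ - φs N) with hR₀
  set W : ℝ → LatticeSpace T := fun ε =>
    σj • latticeShift j (Φ ε) + σk • latticeShift k (Φ ε) + ε ^ N • R₀ with hW
  -- `W` tends to `u₀`, so its distance to the branch is controlled by its residual
  have hWt : Tendsto W (𝓝 0) (𝓝 u₀) := by
    have hΦt := tendsto_of_sub_isBigO hΦ.sub_isBigO
    have hsh : ∀ l : ℤ, Tendsto (fun ε => latticeShift l (Φ ε)) (𝓝 0)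
        (𝓝 (latticeShift l (atSite 0 (φs 0)))) := fun l =>
      ((latticeShiftCLM T l).continuous.tendsto _).comp hΦt
    have hsite : ∀ (l : ℤ) (σ : ℝ), σ • latticeShift l (atSite 0 (φs 0)) = atSite l (σ • φs 0) :=
      fun l σ => by
        ext1
        funext n
        change σ • atSite 0 (φs 0) (n - l) = _
        by_cases hn : n = l
        · subst hn
          rw [sub_self, atSite_apply_self, atSite_apply_self]
        · rw [atSite_apply_ne (sub_ne_zero.2 hn), atSite_apply_ne hn, smul_zero]
    have hpow : Tendsto (fun ε : ℝ => ε ^ N • R₀) (𝓝 0) (𝓝 0) := by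
      have h : Continuous fun ε : ℝ => ε ^ N • R₀ := by fun_prop
      exact h.tendsto' _ _ (by rw [zero_pow (by omega), zero_smul])
    have h := (((hsh j).const_smul σj).add ((hsh k).const_smul σk)).add hpow
    rwa [hsite, hsite, add_zero] at h
  have huW : (fun ε => W ε - U₂ ε) =O[𝓝 0] fun ε : ℝ => ε ^ (N + 1) :=
    (hU₂ W hWt).trans (kgMap_superposition_isBigO hodd hg1 hg2 hjk hN hσj hσk hΦsol hΦ.sub_isBigO
      hstep hψN)
  have hTay : ∀ (l : ℤ) (σ : ℝ), (fun ε => σ • latticeShift l (Φ ε) -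
      σ • latticeShift l (taylorPoly Φ N ε)) =O[𝓝 0] fun ε : ℝ => ε ^ (N + 1) := fun l σ => by
    have h := ((latticeShiftCLM T l).isBigO_comp _ _).trans (sub_taylorPoly_isBigO hδ hΦc N)
    refine (h.const_smul_left σ).congr_left fun ε => ?_
    rw [Pi.smul_apply, map_sub, smul_sub]
    rfl
  refine (((hTay j σj).add (hTay k σk)).sub huW).congr' ?_ EventuallyEq.rfl
  filter_upwards [huU] with ε hε
  have hWε : W ε = σj • latticeShift j (Φ ε) + σk • latticeShift k (Φ ε) + ε ^ N • R₀ := rfl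
  rw [hε, hWε]
  generalize ε ^ N • R₀ = R
  abel
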